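/- Let $\Omega\subset\mathbb R^3$ be a bounded polyhedral domain (a nonempty connected set that is the interior of a finite union of closed nondegenerate tetrahedra), $\alpha>0$, $Z\in\mathbb N$, and let $V:\Omega\to\mathbb R$, $\mathcal N_1:[0,\infty)\to\mathbb R$, $q\in\mathbb R$ and $K$ be given. Put $\mathcal N(\rho)=\mathcal N_1(\rho)+\rho^{q-1}\int_\Omega \rho^q(y)K(\cdot-y)\,dy$ and $\mathcal E(s)=\int_0^s\mathcal N_1(t)\,dt$. For $p,c_2\ge 0$, $c_1\in\mathbb R$ write $f\in Pol(p,(c_1,c_2))$ if there are $a_1,a_2\in\mathbb R$ with $c_1t^p+a_1\le f(t)\le c_2t^p+a_2$ for all $t\ge0$. Assume: (i) $V\in L^2(\Omega)$; (ii) $\mathcal E\in Pol(p,(c_1,c_2))$ for some $p,c_1,c_2$ such that $c_1>0$, or $p\le 4/3$, or $c_1<0$, $p>4/3$ and $\frac{|c_1|}{\alpha}Z^{p-1}<\inf\{\int_\Omega|\nabla u|^2/\int_\Omega|u|^{2p}: u\in H^1_0(\Omega),\ \|u\|_{0,\Omega}=1\}$; (iii) $\mathcal N_1$ is differentiable on $[0,\infty)$,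 $\mathcal N_1\in Pol(p_1,(c_1',c_2'))$ for some $p_1\in[0,2)$ and some $c_1',c_2'$, and $\mathcal N_1'\in Pol(p_2,(c_1'',c_2''))$ for some $p_2\in[0,1)$ and some $c_1'',c_2''$; (iv) $K\in L^2(\tilde\Omega)$ with $\tilde\Omega=\{x-y:x,y\in\Omega\}$, $K$ is nonnegative and even, and $q\in[1,3/2)$. Let $\mathcal A=\{\psi\in H^1_0(\Omega):\|\psi\|_{0,\Omega}^2=Z,\ \psi\ge0\}$. Let $\mathcal T_h$ be a conforming mesh of $\Omega$ into tetrahedra $T$ that is shape regular with constant $\gamma^*$, that is, $h_T/\rho_T\le\gamma^*$ for all $T\in\mathcal T_h$, where $h_T$ is the diameter of $T$ and $\rho_T$ the diameter of the biggest ball contained in $T$. Let $S^h_0(\Omega)\subset H^1_0(\Omega)$ be the space of continuous functions vanishing on $\partial\Omega$ which are polynomials of degree at most $n$ on every element, where $n\ge1$ is fixed, and let $V_h=S^h_0(\Omega)\cap\mathcal A$. Let $\mathcal E_h$ be the set of interior faces, $h_e$ the diameter of $e\in\mathcal E_h$, and let the patch $\omega_h(T)$ be the union of all elements of $\mathcal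 T_h$ that have at least one vertex in common with $T$. A pair $(\lambda_h,u_h)\in\mathbb R\times V_h$ is a discrete solution if $$\alpha(\nabla u_h,\nabla v)+(Vu_h+\mathcal N(u_h^2)u_h,v)=\lambda_h(u_h,v)\qquad\forall\, v\in S^h_0(\Omega).$$ For such a pair put $$\mathcal R_T(u_h)=\lambda_hu_h+\alpha\Delta u_h-Vu_h-\mathcal N(u_h^2)u_h\ \text{ in } T,$$ $$J_e(u_h)=\alpha\nabla u_h|_{T_1}\cdot n_1+\alpha\nabla u_h|_{T_2}\cdot n_2\ \text{ on } e\in\mathcal E_h,$$ where $T_1,T_2$ are the two elements sharing $e$ and $n_i$ is the outward unit normal of $T_i$ on $e$. Let $$\eta_h(u_h,T)^2=h_T^2\|\mathcal R_T(u_h)\|_{0,T}^2+\sum_{e\in\mathcal E_h,\ e\subset\partial T}h_e\|J_e(u_h)\|_{0,e}^2,$$ $$\langle \mathbf R_h(u_h),v\rangle=\lambda_h(u_h,v)-(\alpha\nabla u_h,\nabla v)-(Vu_h,v)-(\mathcal N(u_h^2)u_h,v),\qquad v\in H^1_0(\Omega).$$ Then for given data $\Omega,\alpha,Z,V,\mathcal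 N_1,K,q$, given $n$ and given $\gamma^*$ there is a constant $C>0$, independent of the mesh $\mathcal T_h$, of $(\lambda_h,u_h)$ and of $v$, such that for every conforming mesh $\mathcal T_h$ of $\Omega$ that is shape regular with constant $\gamma^*$ and every discrete solution $(\lambda_h,u_h)$, $$|\langle\mathbf R_h(u_h),v\rangle|\le C\sum_{T\in\mathcal T_h}\eta_h(u_h,T)\,\|v\|_{1,\omega_h(T)}\qquad\forall\, v\in H^1_0(\Omega),$$ where $\|v\|_{1,\omega}^2=\int_\omega|v|^2+\int_\omega|\nabla v|^2$. -/

import Mathlib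

open MeasureTheory Set
open scoped ContDiff ENNReal InnerProductSpace

namespace NonlinearEigen

/-- Three-dimensional Euclidean space. -/
abbrev E3 : Type := EuclideanSpace ℝ (Fin 3)

noncomputable section

/-! ### Sobolev spaces -/

/-- Smooth functions with compact support contained in `Ω`. -/
structure IsTestFunction (Ω : Set E3) (φ : E3 → ℝ) : Prop where
  smooth : ContDiff ℝ ∞ φ
  compact : HasCompactSupport φ
  support : tsupport φ ⊆ Ω

/-- `v ∈ L²(Ω)`, and `g ∈ L²(Ω; ℝ³)` is the weak gradient of `v` in `Ω`. -/
structure IsWeakGradient (Ω : Set E3) (v : E3 → ℝ) (g : E3 → E3) : Prop where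
  memLp : MemLp v 2 (volume.restrict Ω)
  memLp_grad : MemLp g 2 (volume.restrict Ω)
  integral_eq : ∀ φ : E3 → ℝ, IsTestFunction Ω φ → ∀ y : E3,
    ∫ x in Ω, v x * fderiv ℝ φ x y = -∫ x in Ω, ⟪g x, y⟫_ℝ * φ x

/-- `v ∈ H¹(Ω)`. -/
def MemH1 (Ω : Set E3) (v : E3 → ℝ) : Prop := ∃ g : E3 → E3, IsWeakGradient Ω v g

open Classical in
/-- The weak gradient `∇v` of `v ∈ H¹(Ω)` (unique up to null sets). -/
def weakGrad (Ω : Set E3) (v : E3 → ℝ) : E3 → E3 :=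
  if h : MemH1 Ω v then h.choose else 0

theorem weakGrad_spec {Ω : Set E3} {v : E3 → ℝ} (h : MemH1 Ω v) :
    IsWeakGradient Ω v (weakGrad Ω v) := by
  rw [weakGrad, dif_pos h]
  exact h.choose_spec

/-- `v ∈ H¹₀(Ω)`: `v ∈ H¹(Ω)` lies in the `H¹(Ω)`-closure of the test functions. -/
def MemH10 (Ω : Set E3) (v : E3 → ℝ) : Prop :=
  MemH1 Ω v ∧ ∀ ε : ℝ, 0 < ε → ∃ φ : E3 → ℝ, IsTestFunction Ω φ ∧
    eLpNorm (fun x => v x - φ x) 2 (volume.restrict Ω) ≤ ENNReal.ofReal ε ∧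
    eLpNorm (fun x => weakGrad Ω v x - gradient φ x) 2 (volume.restrict Ω) ≤ ENNReal.ofReal ε

/-- The norm `‖v‖_{1,D} = (∫_D |v|² + ∫_D |∇v|²)^{1/2}` of `v ∈ H¹(Ω)` over a part `D` of the
closure of `Ω`. -/
def h1Norm (Ω D : Set E3) (v : E3 → ℝ) : ℝ :=
  √((∫ x in D, v x ^ 2) + ∫ x in D, ‖weakGrad Ω v x‖ ^ 2)

/-! ### The nonlinear eigenvalue problem -/

/-- The class `Pol(p,(c₁,c₂))` of functions on `[0,∞)` with
`c₁ tᵖ + a₁ ≤ f t ≤ c₂ tᵖ + a₂` for some `a₁, a₂`. -/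
def Pol (p c₁ c₂ : ℝ) : Set (ℝ → ℝ) :=
  {f | 0 ≤ p ∧ 0 ≤ c₂ ∧ ∃ a₁ a₂ : ℝ, ∀ t : ℝ, 0 ≤ t →
    c₁ * |t| ^ p + a₁ ≤ f t ∧ f t ≤ c₂ * |t| ^ p + a₂}

/-- The data of `(-αΔ + V + 𝒩(u²)) u = λ u` in `Ω`, `∫_Ω |u|² = Z`, where
`𝒩(ρ) = N₁(ρ) + ρ^{q-1} ∫_Ω ρ^q(y) K(· - y) dy`. Only the values of `V` on `Ω`, of `N₁` on
`[0,∞)` and of `K` on `{x - y : x, y ∈ Ω}` matter. -/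
structure ProblemData where
  Ω : Set E3
  α : ℝ
  V : E3 → ℝ
  N₁ : ℝ → ℝ
  K : E3 → ℝ
  q : ℝ
  Z : ℕ

/-- A closed simplex, given by its set of vertices. -/
def cell (t : Finset E3) : Set E3 := convexHull ℝ (t : Set E3)

/-- Bounded polyhedral domains: nonempty connected sets that are the interior of a finite union of
closed nondegenerate tetrahedra. -/
def IsPolyhedralDomain (Ω : Set E3) : Prop :=
  IsConnected Ω ∧ ∃ S : Finset (Finset E3),
    (∀ t ∈ S, t.card = 4 ∧ AffineIndependent ℝ ((↑) : t → E3)) ∧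
    Ω = interior (⋃ t ∈ S, cell t)

namespace ProblemData

/-- The set `{x - y : x, y ∈ Ω}`. -/
def diffSet (P : ProblemData) : Set E3 := {z | ∃ x ∈ P.Ω, ∃ y ∈ P.Ω, z = x - y}

/-- The antiderivative `ℰ(s) = ∫₀ˢ N₁(t) dt`. -/
def calE (P : ProblemData) (s : ℝ) : ℝ := ∫ t in (0 : ℝ)..s, P.N₁ t

/-- The nonlocal term `𝒩₂(ρ)`. -/
def N₂ (P : ProblemData) (ρ : E3 → ℝ) (x : E3) : ℝ :=
  ρ x ^ (P.q - 1) * ∫ y in P.Ω, ρ y ^ P.q * P.K (x - y)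

/-- The nonlinear term `𝒩(ρ) = 𝒩₁(ρ) + 𝒩₂(ρ)`. -/
def N (P : ProblemData) (ρ : E3 → ℝ) (x : E3) : ℝ := P.N₁ (ρ x) + P.N₂ ρ x

/-- The infimum of `∫_Ω |∇u|² / ∫_Ω |u|^{2p}` over `u ∈ H¹₀(Ω)` with `‖u‖_{0,Ω} = 1`. -/
def rayleighInf (P : ProblemData) (p : ℝ) : ℝ≥0∞ :=
  ⨅ (u : E3 → ℝ) (_ : MemH10 P.Ω u) (_ : ∫ x in P.Ω, u x ^ 2 = 1),
    (∫⁻ x in P.Ω, ‖weakGrad P.Ω u x‖ₑ ^ 2) / ∫⁻ x in P.Ω, ‖u x‖ₑ ^ (2 * p)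

/-- The standing assumptions on the data. -/
structure Admissible (P : ProblemData) : Prop where
  domain : IsPolyhedralDomain P.Ω
  α_pos : 0 < P.α
  potential : MemLp P.V 2 (volume.restrict P.Ω)
  energy_growth : ∃ p c₁ c₂ : ℝ, P.calE ∈ Pol p c₁ c₂ ∧
    (0 < c₁ ∨ p ≤ 4 / 3 ∨ (c₁ < 0 ∧ 4 / 3 < p ∧
      ENNReal.ofReal (|c₁| / P.α * (P.Z : ℝ) ^ (p - 1)) < P.rayleighInf p))
  local_growth : ∃ p₁ c₁ c₂ : ℝ, p₁ < 2 ∧ P.N₁ ∈ Pol p₁ c₁ c₂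
  local_diff : DifferentiableOn ℝ P.N₁ (Ici 0)
  local_deriv_growth : ∃ p₂ c₁ c₂ : ℝ, p₂ < 1 ∧ derivWithin P.N₁ (Ici 0) ∈ Pol p₂ c₁ c₂
  kernel : MemLp P.K 2 (volume.restrict P.diffSet)
  kernel_nonneg : ∀ z ∈ P.diffSet, 0 ≤ P.K z
  kernel_even : ∀ z ∈ P.diffSet, P.K (-z) = P.K z
  q_mem : P.q ∈ Ico (1 : ℝ) (3 / 2)

/-- The admissible class `𝒜`: functions `ψ ∈ H¹₀(Ω)` with `‖ψ‖²_{0,Ω} = Z` and `ψ ≥ 0`. -/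
def admissibleClass (P : ProblemData) : Set (E3 → ℝ) :=
  {ψ | MemH10 P.Ω ψ ∧ ∫ x in P.Ω, ψ x ^ 2 = P.Z ∧ ∀ᵐ x ∂volume.restrict P.Ω, 0 ≤ ψ x}

end ProblemData

/-! ### Meshes -/

/-- A conforming tetrahedral mesh of `Ω`: a finite simplicial complex all of whose maximal
simplices are tetrahedra and whose union is the closure of `Ω`. -/
structure TetMesh (Ω : Set E3) where
  complex : Geometry.SimplicialComplex ℝ E3
  finite : complex.faces.Finite
  pure : ∀ s ∈ complex.faces, ∃ t ∈ complex.faces, s ⊆ t ∧ t.card = 4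
  space_eq : complex.space = closure Ω

/-- The diameter `h_T` of a simplex. -/
def diamCell (t : Finset E3) : ℝ := Metric.diam (cell t)

/-- The diameter `ρ_T` of the biggest ball contained in `T`. -/
def inballDiam (t : Finset E3) : ℝ := sSup {d : ℝ | ∃ x : E3, Metric.ball x (d / 2) ⊆ cell t}

/-- `ν` is a unit outward normal vector of the tetrahedron `t` on its face `e`. -/
structure IsOutwardNormal (t e : Finset E3) (ν : E3) : Prop where
  norm_eq : ‖ν‖ = 1
  orthogonal : ∀ x ∈ e, ∀ y ∈ e, ⟪ν, x - y⟫_ℝ = 0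
  outward : ∀ x ∈ e, ∀ a ∈ t, a ∉ e → ⟪ν, a - x⟫_ℝ < 0

open Classical in
/-- The outward unit normal vector of the tetrahedron `t` on its face `e`. -/
def outwardNormal (t e : Finset E3) : E3 :=
  if h : ∃ ν, IsOutwardNormal t e ν then h.choose else 0

theorem outwardNormal_spec {t e : Finset E3} (ht : AffineIndependent ℝ ((↑) : t → E3))
    (htc : t.card = 4) (he : e ⊆ t) (hec : e.card = 3) :
    IsOutwardNormal t e (outwardNormal t e) := by
  have hex : ∃ ν, IsOutwardNormal t e ν := by
    classical
    obtain ⟨a, ha⟩ : ∃ a, t \ e = {a} := by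
      rw [← Finset.card_eq_one, Finset.card_sdiff_of_subset he, htc, hec]
    have hat : a ∈ t ∧ a ∉ e := by
      have h : a ∈ t \ e := by rw [ha]; exact Finset.mem_singleton_self a
      simpa using h
    have huniq : ∀ b ∈ t, b ∉ e → b = a := fun b hb hbe => by
      have h : b ∈ t \ e := by simp [hb, hbe]
      simpa [ha] using h
    obtain ⟨x₀, hx₀⟩ : e.Nonempty := by rw [← Finset.card_pos]; omega
    set A : AffineSubspace ℝ E3 := affineSpan ℝ (e : Set E3) with hA
    have : Nonempty A := ⟨⟨x₀, subset_affineSpan ℝ _ hx₀⟩⟩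
    have hmem : ∀ x ∈ e, x ∈ A := fun x hx => subset_affineSpan ℝ _ hx
    have haA : a ∉ A := by
      have h := ht.notMem_affineSpan_sdiff ⟨a, hat.1⟩ (Set.univ)
      intro hc
      apply h
      refine affineSpan_mono ℝ ?_ hc
      intro x hx
      refine ⟨⟨x, he hx⟩, ⟨Set.mem_univ _, ?_⟩, rfl⟩
      intro hxa
      have hxa' : x = a := congrArg Subtype.val hxa
      exact hat.2 (hxa' ▸ hx)
    set b : E3 := (EuclideanGeometry.orthogonalProjection A a : E3) with hb
    have hbA : b ∈ A := (EuclideanGeometry.orthogonalProjection A a).2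
    have hab : b - a ≠ 0 := fun h => haA (sub_eq_zero.1 h ▸ hbA)
    have horth : ∀ w ∈ A.direction, ⟪b - a, w⟫_ℝ = 0 := by
      intro w hw
      have h := EuclideanGeometry.orthogonalProjection_vsub_mem_direction_orthogonal A a
      rw [real_inner_comm]
      exact h w hw
    have hpos : 0 < ‖b - a‖ := norm_pos_iff.2 hab
    refine ⟨‖b - a‖⁻¹ • (b - a), ?_, ?_, ?_⟩
    · rw [norm_smul, norm_inv, norm_norm, inv_mul_cancel₀ hpos.ne']
    · intro x hx y hy
      have h := horth _ (AffineSubspace.vsub_mem_direction (hmem x hx) (hmem y hy))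
      rw [vsub_eq_sub] at h
      rw [real_inner_smul_left, h, mul_zero]
    · intro x hx c hc hce
      obtain rfl := huniq c hc hce
      rw [real_inner_smul_left]
      have h1 : ⟪b - c, c - x⟫_ℝ = -‖b - c‖ ^ 2 := by
        have h2 := horth _ (AffineSubspace.vsub_mem_direction hbA (hmem x hx))
        have h3 : c - x = (b -ᵥ x) - (b - c) := by simp
        rw [h3, inner_sub_right, h2, real_inner_self_eq_norm_sq, zero_sub]
      rw [h1]
      have : 0 < ‖b - c‖⁻¹ * ‖b - c‖ ^ 2 := by positivity
      linarith
  rw [outwardNormal, dif_pos hex]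
  exact hex.choose_spec

namespace TetMesh

variable {Ω : Set E3}

open Classical in
/-- The elements (tetrahedra) of the mesh. -/
def elements (M : TetMesh Ω) : Finset (Finset E3) :=
  M.finite.toFinset.filter fun t => t.card = 4

open Classical in
/-- The interior faces of the mesh: triangles shared by two different elements. -/
def interiorFaces (M : TetMesh Ω) : Finset (Finset E3) :=
  M.finite.toFinset.filter fun e => e.card = 3 ∧
    ∃ t₁ ∈ M.elements, ∃ t₂ ∈ M.elements, t₁ ≠ t₂ ∧ e ⊆ t₁ ∧ e ⊆ t₂

/-- Shape regularity with constant `γ`: `h_T / ρ_T ≤ γ` for all elements `T`. -/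
def ShapeRegular (M : TetMesh Ω) (γ : ℝ) : Prop :=
  ∀ t ∈ M.elements, diamCell t / inballDiam t ≤ γ

/-- The patch `ω_h(T)`: the union of all elements that meet `T`, i.e. that share at least one
vertex with `T`. -/
def patch (M : TetMesh Ω) (t : Finset E3) : Set E3 :=
  ⋃ t' ∈ M.elements, ⋃ (_ : ∃ z, z ∈ t ∧ z ∈ t'), cell t'

/-- The space `S^h(Ω)` of continuous functions on the closure of `Ω` that are polynomials of degree
at most `n` on every element. -/
def feSpace (M : TetMesh Ω) (n : ℕ) : Set (E3 → ℝ) :=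
  {v | ContinuousOn v (closure Ω) ∧ ∀ t ∈ M.elements, ∃ p : MvPolynomial (Fin 3) ℝ,
    p.totalDegree ≤ n ∧ ∀ x ∈ cell t, v x = MvPolynomial.eval (fun i => x i) p}

/-- The space `S^h_0(Ω) = S^h(Ω) ∩ H¹₀(Ω)`. -/
def feSpace₀ (M : TetMesh Ω) (n : ℕ) : Set (E3 → ℝ) := {v | v ∈ M.feSpace n ∧ MemH10 Ω v}

end TetMesh

/-! ### Discrete problem, residuals and indicators -/

namespace ProblemData

variable (P : ProblemData) (M : TetMesh P.Ω)

/-- `(l, u) ∈ ℝ × V_h`, `V_h = S^h_0(Ω) ∩ 𝒜`, solves the discrete eigenvalue problem: `u ∈ V_h`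
(which includes `‖u‖²_{0,Ω} = Z`) and
`α(∇u,∇v) + (Vu + 𝒩(u²)u, v) = l (u,v)` for all `v ∈ S^h_0(Ω)`. -/
structure IsDiscreteSolution (n : ℕ) (l : ℝ) (u : E3 → ℝ) : Prop where
  mem_feSpace₀ : u ∈ M.feSpace₀ n
  mem_admissibleClass : u ∈ P.admissibleClass
  equation : ∀ v ∈ M.feSpace₀ n,
    P.α * (∫ x in P.Ω, ⟪weakGrad P.Ω u x, weakGrad P.Ω v x⟫_ℝ) +
      (∫ x in P.Ω, (P.V x * u x + P.N (fun y => u y ^ 2) x * u x) * v x) =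
    l * ∫ x in P.Ω, u x * v x

/-- The global residual
`⟨R_h(u), v⟩ = l(u,v) - (α∇u,∇v) - (Vu,v) - (𝒩(u²)u,v)`. -/
def globalResidual (l : ℝ) (u v : E3 → ℝ) : ℝ :=
  l * (∫ x in P.Ω, u x * v x)
    - (∫ x in P.Ω, ⟪P.α • weakGrad P.Ω u x, weakGrad P.Ω v x⟫_ℝ)
    - (∫ x in P.Ω, P.V x * u x * v x)
    - ∫ x in P.Ω, P.N (fun y => u y ^ 2) x * u x * v x

/-- The element residual `R_T(u) = l u + αΔu - Vu - 𝒩(u²)u` on the element `T`. -/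
def elementResidual (l : ℝ) (u : E3 → ℝ) (t : Finset E3) (x : E3) : ℝ :=
  l * u x + P.α * InnerProductSpace.laplacianWithin u (cell t) x - P.V x * u x
    - P.N (fun y => u y ^ 2) x * u x

variable {P}

open Classical in
/-- The jump residual `J_e(u) = α∇u|_{T₁}·n₁ + α∇u|_{T₂}·n₂` on the interior face `e`, where `T₁`,
`T₂` are the two elements which share `e`. -/
def jumpResidual (u : E3 → ℝ) (e : Finset E3) (x : E3) : ℝ :=
  ∑ t ∈ M.elements with e ⊆ t, ⟪P.α • gradientWithin u (cell t) x, outwardNormal t e⟫_ℝ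

open Classical in
/-- The local error indicator
`η_h(u,T) = (h_T² ‖R_T(u)‖²_{0,T} + ∑_{e ⊂ ∂T} h_e ‖J_e(u)‖²_{0,e})^{1/2}`, the sum being over the
interior faces `e` of `T`, with the surface measure on `e`. -/
def errorIndicator (l : ℝ) (u : E3 → ℝ) (t : Finset E3) : ℝ :=
  √(diamCell t ^ 2 * (∫ x in cell t, P.elementResidual l u t x ^ 2) +
    ∑ e ∈ M.interiorFaces with e ⊆ t,
      diamCell e * ∫ x in cell e, jumpResidual M u e x ^ 2 ∂Measure.euclideanHausdorffMeasure 2)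

end ProblemData

end

end NonlinearEigen

open Topology

namespace NonlinearEigen

noncomputable section

/-! ### Integration over simplices -/

/-! The residual vanishes on the finite element space (`IsDiscreteSolution.globalResidual_eq_zero`),
so `v` may be replaced by `v - I v` with `I v` in that space. Integration by parts on each
tetrahedron turns the residual into the integrals of `R_T (v - I v)` over elements and of `J_e (v -
I v)` over interior faces (`globalResidual_eq_sum`). Cauchy-Schwarz gives the claim once `‖v - I v‖`
is bounded by `C h_T ‖∇v‖` on `T` and by `C h_e^{1/2} ‖∇v‖` on `e`, with the gradient taken over the
patch. This is done for test functions and extended to `H¹₀` by density, for a fixed mesh and a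
fixed discrete solution.

The interpolant `interp` is piecewise linear. Its value at an interior vertex is the mean over one
element there, and zero at the other vertices. Its error reduces to the Poincaré inequality
(`poincare_cell`) and to comparing means over elements with a common vertex `z`. Two elements that
share a face are compared through the mean over that face (`sq_faceMean_sub_cellMean_le`), and
elements further apart along a chain. Shape regularity bounds the number of elements at `z`
(`ShapeRegular.card_star_le`), hence the length of the chain and the ratios of the diameters along
it.

That the chains exist is a topological fact, `star_dichotomy`. A component of the star of `z`,
linked through faces at `z`, either closes up around `z`, and then `z` is interior and the component
is the whole star, or it has a face that belongs to no other element. Such a face misses `Ω`, so a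
test function vanishes on it, and its face mean matches the nodal value zero. Nothing is assumed on
the shape of the boundary near `z`.

Two tools are built by hand: the divergence theorem on a tetrahedron (`IsTet.integral_fderiv`),
which yields Green's formula, the trace inequality and the face means; and the membership of the hat
functions in `H¹₀` (`memH10_hat`), by truncation and mollification. All constants of the estimate
depend on `γ` only. -/

/-- The standard simplex `{x ≥ 0, ∑ xᵢ ≤ 1}` of `ℝⁿ`. -/
def stdCorner (n : ℕ) : Set (Fin n → ℝ) := {x | (∀ i, 0 ≤ x i) ∧ ∑ i, x i ≤ 1}

theorem isClosed_stdCorner (n : ℕ) : IsClosed (stdCorner n) := by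
  have : stdCorner n = (⋂ i, {x | 0 ≤ x i}) ∩ {x | ∑ i, x i ≤ 1} := by
    ext x; simp [stdCorner]
  rw [this]
  refine (isClosed_iInter fun i => isClosed_le continuous_const (continuous_apply i)).inter
    (isClosed_le (by fun_prop) continuous_const)

theorem stdCorner_subset_Icc (n : ℕ) : stdCorner n ⊆ Icc 0 1 := by
  rintro x ⟨h0, h1⟩
  refine ⟨h0, fun i => ?_⟩
  exact (Finset.single_le_sum (fun j _ => h0 j) (Finset.mem_univ i)).trans h1

theorem isCompact_stdCorner (n : ℕ) : IsCompact (stdCorner n) :=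
  (isCompact_Icc).of_isClosed_subset (isClosed_stdCorner n) (stdCorner_subset_Icc n)

theorem convex_stdCorner (n : ℕ) : Convex ℝ (stdCorner n) := by
  rintro x ⟨hx0, hx1⟩ y ⟨hy0, hy1⟩ a b ha hb hab
  refine ⟨fun i => ?_, ?_⟩
  · have := hx0 i; have := hy0 i
    simp only [Pi.add_apply, Pi.smul_apply, smul_eq_mul]; positivity
  · simp only [Pi.add_apply, Pi.smul_apply, smul_eq_mul, Finset.sum_add_distrib, ← Finset.mul_sum]
    nlinarith

/-- Affine parametrisation with base point `p` and edge vectors `v`. -/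
def param {n : ℕ} (p : E3) (v : Fin n → E3) (x : Fin n → ℝ) : E3 := p + ∑ i, x i • v i

theorem continuous_param {n : ℕ} (p : E3) (v : Fin n → E3) : Continuous (param p v) := by
  unfold param; fun_prop

theorem param_image_stdCorner {n : ℕ} (p : E3) (v : Fin n → E3) :
    param p v '' stdCorner n = convexHull ℝ (insert p (range fun i => p + v i)) := by
  apply subset_antisymm
  · rintro _ ⟨x, ⟨h0, h1⟩, rfl⟩
    have := (convex_convexHull ℝ (insert p (range fun i => p + v i))).sum_mem
      (t := (Finset.univ : Finset (Option (Fin n))))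
      (w := fun o => o.elim (1 - ∑ i, x i) x) (z := fun o => o.elim p fun i => p + v i)
      (by rintro (_ | i) - <;> simp [h1, h0]) (by simp [Fintype.sum_option])
      (by
        rintro (_ | i) -
        · exact subset_convexHull _ _ (mem_insert _ _)
        · exact subset_convexHull _ _ (mem_insert_of_mem _ ⟨i, rfl⟩))
    convert! this using 1
    simp only [param, Fintype.sum_option, Option.elim, smul_add, Finset.sum_add_distrib,
      ← Finset.sum_smul, sub_smul, one_smul]
    abel
  · refine convexHull_min ?_ ?_
    · rintro y (rfl | ⟨i, rfl⟩)
      · exact ⟨0, by simp [stdCorner], by simp [param]⟩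
      · refine ⟨Pi.single i 1, ⟨fun j => ?_, by simp⟩, ?_⟩
        · by_cases h : j = i
          · subst h; simp
          · simp [h]
        · simp [param, Pi.single_apply, ite_smul]
    · have : param p v = fun x => p + Fintype.linearCombination ℝ v x := by
        ext x; simp [param, Fintype.linearCombination_apply]
      rw [this, ← image_image (fun y => p + y)]
      exact ((convex_stdCorner n).linear_image _).translate p

/-- The volume factor of the parallelepiped spanned by `v`. -/
def gramVol {n : ℕ} (v : Fin n → E3) : ℝ := √(Matrix.gram ℝ v).det

theorem gramVol_nonneg {n : ℕ} (v : Fin n → E3) : 0 ≤ gramVol v := Real.sqrt_nonneg _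

theorem param_injective {n : ℕ} (p : E3) {v : Fin n → E3} (hv : LinearIndependent ℝ v) :
    Function.Injective (param p v) := by
  intro x y h
  have h' : ∑ i, x i • v i = ∑ i, y i • v i := add_left_cancel h
  rw [Fintype.linearIndependent_iff] at hv
  funext i
  have := hv (fun i => x i - y i) (by simp [sub_smul, h']) i
  linarith

/-- The area formula for a linear map, whose volume factor is the root of the Gram determinant of
its columns. The case `n = 3` describes the tetrahedra and `n = 2` the surface measure on their
faces. -/
theorem euclideanHausdorff_param_image {n : ℕ} (p : E3) (v : Fin n → E3) (s : Set (Fin n → ℝ)) :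

    Measure.euclideanHausdorffMeasure n (param p v '' s) = ENNReal.ofReal (gramVol v) * volume s := by
  let f : EuclideanSpace ℝ (Fin n) →ₗ[ℝ] E3 :=
    Fintype.linearCombination ℝ v ∘ₗ (WithLp.linearEquiv 2 ℝ (Fin n → ℝ)).toLinearMap
  have hf : ∀ x, f x = ∑ i, x i • v i := fun x => by
    simp [f, Fintype.linearCombination_apply]
  have h1 : param p v '' s = (fun y => p + y) '' (f '' (WithLp.toLp 2 '' s)) := by
    rw [image_image, image_image]
    refine image_congr fun x _ => ?_
    simp [param, hf]
  have hiso : Isometry (fun y : E3 => p + y) := isometry_add_left p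
  have h2 := f.euclideanHausdorffMeasure_image_eq_normDet_mul_volume (WithLp.toLp 2 '' s)
  rw [finrank_euclideanSpace_fin] at h2
  rw [h1, hiso.euclideanHausdorffMeasure_image, h2]
  have h3 : f.normDet = gramVol v := by
    have h := f.normDet_sq_eq_det_gram (EuclideanSpace.basisFun (Fin n) ℝ)
    have h' : (fun i => f (EuclideanSpace.basisFun (Fin n) ℝ i)) = v := by
      funext i; simp [hf, ite_smul]
    rw [h'] at h
    rw [gramVol, ← h]
    simp [Real.sqrt_sq f.normDet_nonneg]
  have h4 : volume (WithLp.toLp 2 '' s) = volume s := by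
    have := (EuclideanSpace.volume_preserving_symm_measurableEquiv_toLp (Fin n)).measure_preimage_equiv s
    rw [← this]
    congr 1
    ext x
    constructor
    · rintro ⟨y, hy, rfl⟩; simpa using hy
    · intro hx; exact ⟨_, hx, by simp⟩
  rw [h3, h4]

theorem integral_param_image {n : ℕ} (p : E3) {v : Fin n → E3} (hv : LinearIndependent ℝ v)
    (s : Set (Fin n → ℝ)) (f : E3 → ℝ) :
    ∫ x in param p v '' s, f x ∂Measure.euclideanHausdorffMeasure n =
      gramVol v * ∫ z in s, f (param p v z) := by
  have hemb : MeasurableEmbedding (param p v) :=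
    (continuous_param p v).measurableEmbedding (param_injective p hv)
  have h1 : (Measure.euclideanHausdorffMeasure n : Measure E3).restrict (param p v '' s) =
      ENNReal.ofReal (gramVol v) • Measure.map (param p v) (volume.restrict s) := by
    ext u hu
    rw [Measure.restrict_apply hu, Measure.smul_apply, hemb.map_apply,
      Measure.restrict_apply (hemb.measurable hu), smul_eq_mul,
      ← euclideanHausdorff_param_image p v _,
      image_preimage_inter]
  rw [h1, integral_smul_measure, hemb.integral_map, ENNReal.toReal_ofReal (gramVol_nonneg v),
    smul_eq_mul]

/-- Volume is base area times height. This trades the Jacobian of the reference map for a surface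
factor weighted by the normal. -/
theorem gramVol_three {u v w ν : E3} (hvw : LinearIndependent ℝ ![v, w]) (hν : ‖ν‖ = 1)
    (h1 : ⟪ν, v⟫_ℝ = 0) (h2 : ⟪ν, w⟫_ℝ = 0) :
    gramVol ![u, v, w] = |⟪u, ν⟫_ℝ| * gramVol ![v, w] := by
  have hpos : 0 < (Matrix.gram ℝ ![v, w]).det :=
    (Matrix.posDef_gram_of_linearIndependent hvw).det_pos
  have key : (Matrix.gram ℝ ![u, v, w]).det = ⟪u, ν⟫_ℝ ^ 2 * (Matrix.gram ℝ ![v, w]).det := by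
    have hν' : ⟪ν, ν⟫_ℝ = 1 := by rw [real_inner_self_eq_norm_sq, hν]; norm_num
    -- After multiplication by the Gram determinant `G` of `v, w`, everything is expressed by `D₁ =
    -- det (u, v, w)` and `D₂ = det (ν, v, w)`. Products of determinants are mixed Gram
    -- determinants, so that `D₂² = G` and `D₁ D₂ = ⟪u, ν⟫ G`.
    rw [← mul_left_inj' hpos.ne']
    clear hpos hvw hν
    simp only [Matrix.det_fin_two, Matrix.det_fin_three, Matrix.gram_apply, Matrix.cons_val_zero,
      Matrix.cons_val_one, Matrix.cons_val] at *
    set D₁ := u 0 * (v 1 * w 2 - v 2 * w 1) - u 1 * (v 0 * w 2 - v 2 * w 0) +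
      u 2 * (v 0 * w 1 - v 1 * w 0) with hD₁
    set D₂ := ν 0 * (v 1 * w 2 - v 2 * w 1) - ν 1 * (v 0 * w 2 - v 2 * w 0) +
      ν 2 * (v 0 * w 1 - v 1 * w 0) with hD₂
    have hc : ∀ x y : E3, ⟪x, y⟫_ℝ = x 0 * y 0 + x 1 * y 1 + x 2 * y 2 := fun x y => by
      simp [PiLp.inner_apply, Fin.sum_univ_three]; ring
    have e1 : D₁ * D₂ = ⟪u, ν⟫_ℝ * (⟪v, v⟫_ℝ * ⟪w, w⟫_ℝ - ⟪v, w⟫_ℝ * ⟪w, v⟫_ℝ) -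
        ⟪u, v⟫_ℝ * (⟪ν, v⟫_ℝ * ⟪w, w⟫_ℝ - ⟪v, w⟫_ℝ * ⟪ν, w⟫_ℝ) +
        ⟪u, w⟫_ℝ * (⟪ν, v⟫_ℝ * ⟪v, w⟫_ℝ - ⟪v, v⟫_ℝ * ⟪ν, w⟫_ℝ) := by
      rw [hD₁, hD₂]; simp only [hc]; ring
    have e2 : D₂ * D₂ = ⟪ν, ν⟫_ℝ * (⟪v, v⟫_ℝ * ⟪w, w⟫_ℝ - ⟪v, w⟫_ℝ * ⟪w, v⟫_ℝ) -
        ⟪ν, v⟫_ℝ * (⟪ν, v⟫_ℝ * ⟪w, w⟫_ℝ - ⟪v, w⟫_ℝ * ⟪ν, w⟫_ℝ) +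
        ⟪ν, w⟫_ℝ * (⟪ν, v⟫_ℝ * ⟪v, w⟫_ℝ - ⟪v, v⟫_ℝ * ⟪ν, w⟫_ℝ) := by
      rw [hD₂]; simp only [hc]; ring
    have e3 : ⟪u, u⟫_ℝ * ⟪v, v⟫_ℝ * ⟪w, w⟫_ℝ - ⟪u, u⟫_ℝ * ⟪v, w⟫_ℝ * ⟪w, v⟫_ℝ -
        ⟪u, v⟫_ℝ * ⟪v, u⟫_ℝ * ⟪w, w⟫_ℝ + ⟪u, v⟫_ℝ * ⟪v, w⟫_ℝ * ⟪w, u⟫_ℝ +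
        ⟪u, w⟫_ℝ * ⟪v, u⟫_ℝ * ⟪w, v⟫_ℝ - ⟪u, w⟫_ℝ * ⟪v, v⟫_ℝ * ⟪w, u⟫_ℝ = D₁ * D₁ := by
      rw [hD₁]; simp only [hc]; ring
    rw [h1, h2, hν'] at e2
    rw [h1, h2] at e1
    rw [e3]
    calc D₁ * D₁ * (⟪v, v⟫_ℝ * ⟪w, w⟫_ℝ - ⟪v, w⟫_ℝ * ⟪w, v⟫_ℝ)
        = D₁ * D₁ * (D₂ * D₂) := by rw [e2]; ring
      _ = (D₁ * D₂) * (D₁ * D₂) := by ring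
      _ = _ := by rw [e1]; ring
  rw [gramVol, gramVol, key, Real.sqrt_mul (sq_nonneg _), Real.sqrt_sq_eq_abs]

/-- Column operations preserve the determinant. For edges `u, v, w` at one vertex, `v - u` and `w -
u` are edges at the end point of `u`, so the volume factor may be computed from either vertex. -/
theorem gramVol_shear (u v w : E3) : gramVol ![u, v - u, w - u] = gramVol ![u, v, w] := by
  have hc : ∀ x y : E3, ⟪x, y⟫_ℝ = x 0 * y 0 + x 1 * y 1 + x 2 * y 2 := fun x y => by
    simp [PiLp.inner_apply, Fin.sum_univ_three]; ring
  rw [gramVol, gramVol]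
  congr 1
  simp only [Matrix.det_fin_three, Matrix.gram_apply, Matrix.cons_val_zero,
      Matrix.cons_val_one, Matrix.cons_val, inner_sub_left, inner_sub_right]
  rw [real_inner_comm u v, real_inner_comm u w, real_inner_comm v w]
  ring

/-- Fubini with the first coordinate innermost: the fibre over `z` is the interval `[0, 1 - ∑ z i]`,
on which the fundamental theorem of calculus applies. -/
theorem integral_stdCorner_fderiv {g : (Fin 3 → ℝ) → ℝ} (hg : ContDiff ℝ 1 g) :
    ∫ x in stdCorner 3, fderiv ℝ g x (Pi.single 0 1) =
      ∫ z in stdCorner 2, (g (Fin.cons (1 - ∑ i, z i) z) - g (Fin.cons 0 z)) := by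
  set F : (Fin 3 → ℝ) → ℝ := fun x => fderiv ℝ g x (Pi.single 0 1) with hF
  have hFc : Continuous F := (hg.continuous_fderiv one_ne_zero).clm_apply continuous_const
  have hms : MeasurableSet (stdCorner 3) := (isClosed_stdCorner 3).measurableSet
  have hInt : Integrable ((stdCorner 3).indicator F) :=
    (integrable_indicator_iff hms).2 (hFc.continuousOn.integrableOn_compact (isCompact_stdCorner 3))
  have hmp := (volume_preserving_piFinSuccAbove (fun _ : Fin 3 => ℝ) 0).symm
  rw [← integral_indicator hms, ← hmp.integral_comp', Measure.volume_eq_prod,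
    integral_prod_symm _ (by
      rw [← Measure.volume_eq_prod]
      exact (hmp.integrable_comp_emb (MeasurableEquiv.measurableEmbedding _)).2 hInt),
    ← integral_indicator (isClosed_stdCorner 2).measurableSet]
  congr 1
  funext z
  have hmem : ∀ r : ℝ, ((MeasurableEquiv.piFinSuccAbove (fun _ : Fin 3 => ℝ) 0).symm (r, z)) =
      Fin.cons r z := fun r => by
    simp [MeasurableEquiv.piFinSuccAbove]; rfl
  have hiff : ∀ r : ℝ, (Fin.cons r z : Fin 3 → ℝ) ∈ stdCorner 3 ↔
      z ∈ stdCorner 2 ∧ r ∈ Icc 0 (1 - ∑ i, z i) := fun r => by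
    simp only [stdCorner, mem_ofPred_eq, Fin.forall_fin_succ (n := 2), Fin.sum_univ_succ (n := 2),
      Fin.cons_zero, Fin.cons_succ, mem_Icc]
    constructor
    · rintro ⟨⟨h0, h1⟩, h2⟩
      exact ⟨⟨h1, by linarith⟩, h0, by linarith⟩
    · rintro ⟨⟨h1, _⟩, h0, h2⟩
      exact ⟨⟨h0, h1⟩, by linarith⟩
  by_cases hz : z ∈ stdCorner 2
  · rw [indicator_of_mem hz]
    have h1 : (fun r : ℝ => (stdCorner 3).indicator F
        ((MeasurableEquiv.piFinSuccAbove (fun _ : Fin 3 => ℝ) 0).symm (r, z))) =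
        (Icc 0 (1 - ∑ i, z i)).indicator fun r => F (Fin.cons r z) := by
      funext r
      rw [hmem]
      by_cases hr : r ∈ Icc 0 (1 - ∑ i, z i)
      · rw [indicator_of_mem hr, indicator_of_mem ((hiff r).2 ⟨hz, hr⟩)]
      · rw [indicator_of_notMem hr, indicator_of_notMem fun h => hr ((hiff r).1 h).2]
    have hle : 0 ≤ 1 - ∑ i, z i := by linarith [hz.2]
    have hcons : ∀ r : ℝ, HasDerivAt (fun r : ℝ => (Fin.cons r z : Fin 3 → ℝ)) (Pi.single 0 1) r := by
      intro r
      rw [hasDerivAt_pi]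
      intro i
      refine Fin.cases ?_ (fun j => ?_) i
      · simpa using hasDerivAt_id' r
      · simpa [Pi.single_apply] using hasDerivAt_const r (z j)
    have hcc : Continuous fun r : ℝ => (Fin.cons r z : Fin 3 → ℝ) :=
      continuous_iff_continuousAt.2 fun r => (hcons r).continuousAt
    rw [h1, integral_indicator measurableSet_Icc, integral_Icc_eq_integral_Ioc,
      ← intervalIntegral.integral_of_le hle]
    refine intervalIntegral.integral_eq_sub_of_hasDerivAt (f := fun r => g (Fin.cons r z))
      (fun r _ => ?_) ((hFc.comp hcc).intervalIntegrable _ _)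
    exact ((hg.differentiable one_ne_zero) _).hasFDerivAt.comp_hasDerivAt r (hcons r)
  · rw [indicator_of_notMem hz]
    refine integral_eq_zero_of_ae (Filter.Eventually.of_forall fun r => ?_)
    simp only [hmem]
    exact indicator_of_notMem (fun h => hz ((hiff r).1 h).1) _

/-! ### Barycentric coordinates -/

/-- `t` is the vertex set of a nondegenerate tetrahedron. -/
structure IsTet (t : Finset E3) : Prop where
  indep : AffineIndependent ℝ ((↑) : t → E3)
  card : t.card = 4

theorem IsTet.affineSpan_eq_top {t : Finset E3} (ht : IsTet t) :
    affineSpan ℝ (range ((↑) : t → E3)) = ⊤ := by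
  rw [ht.indep.affineSpan_eq_top_iff_card_eq_finrank_add_one]
  simp [ht.card]

/-- The vertices of a tetrahedron as an affine basis. -/
def IsTet.basis {t : Finset E3} (ht : IsTet t) : AffineBasis t ℝ E3 :=
  ⟨(↑), ht.indep, ht.affineSpan_eq_top⟩

open Classical in
/-- The barycentric coordinate of the tetrahedron `t` at `a`; zero if `a` is not a vertex. -/
def bary (t : Finset E3) (a : E3) : E3 →ᵃ[ℝ] ℝ :=
  if h : IsTet t ∧ a ∈ t then h.1.basis.coord ⟨a, h.2⟩ else 0

variable {t : Finset E3} {a b x : E3}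

theorem bary_of_notMem (h : a ∉ t) (x : E3) : bary t a x = 0 := by
  rw [bary, dif_neg (fun h' => h h'.2)]; rfl

theorem IsTet.bary_eq (ht : IsTet t) (ha : a ∈ t) : bary t a = ht.basis.coord ⟨a, ha⟩ := by
  rw [bary, dif_pos ⟨ht, ha⟩]

theorem IsTet.bary_self (ht : IsTet t) (ha : a ∈ t) : bary t a a = 1 := by
  rw [ht.bary_eq ha]
  exact ht.basis.coord_apply_eq ⟨a, ha⟩

theorem IsTet.bary_of_ne (ht : IsTet t) (hb : b ∈ t) (hab : a ≠ b) : bary t a b = 0 := by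
  by_cases ha : a ∈ t
  · rw [ht.bary_eq ha]
    exact ht.basis.coord_apply_ne (i := ⟨a, ha⟩) (j := ⟨b, hb⟩) (by simpa using hab)
  · exact bary_of_notMem ha b

theorem IsTet.sum_bary (ht : IsTet t) (x : E3) : ∑ a ∈ t, bary t a x = 1 := by
  rw [← ht.basis.sum_coord_apply_eq_one x, ← Finset.sum_coe_sort]
  exact Finset.sum_congr rfl fun a _ => by rw [ht.bary_eq a.2]

theorem IsTet.sum_bary_smul (ht : IsTet t) (x : E3) : ∑ a ∈ t, bary t a x • a = x := by
  conv_rhs => rw [← ht.basis.linear_combination_coord_eq_self x]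
  rw [← Finset.sum_coe_sort]
  exact Finset.sum_congr rfl fun a _ => by rw [ht.bary_eq a.2]; rfl

theorem IsTet.bary_combination (ht : IsTet t) {w : E3 → ℝ} (hw : ∑ a ∈ t, w a = 1) (ha : a ∈ t) :
    bary t a (∑ b ∈ t, w b • b) = w a := by
  have h := ht.basis.coord_apply_combination_of_mem (s := Finset.univ) (i := ⟨a, ha⟩)
    (Finset.mem_univ _) (w := fun b : t => w b) (by rw [Finset.sum_coe_sort t w]; exact hw)
  rw [Finset.affineCombination_eq_linear_combination _ _ _
    (by rw [Finset.sum_coe_sort t w]; exact hw)] at h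
  rw [ht.bary_eq ha, ← h]
  congr 1
  exact (Finset.sum_coe_sort t fun b => w b • b).symm

theorem range_coe_finset (t : Finset E3) : range ((↑) : t → E3) = (t : Set E3) := by simp

theorem IsTet.mem_cell_iff (ht : IsTet t) : x ∈ cell t ↔ ∀ a ∈ t, 0 ≤ bary t a x := by
  have h := ht.basis.convexHull_eq_nonneg_coord
  have h' : range ht.basis = (t : Set E3) := range_coe_finset t
  rw [cell, ← h', h]
  simp only [mem_ofPred_eq, Subtype.forall]
  exact forall₂_congr fun a ha => by rw [ht.bary_eq ha]

theorem IsTet.mem_interior_iff (ht : IsTet t) :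
    x ∈ interior (cell t) ↔ ∀ a ∈ t, 0 < bary t a x := by
  have h := ht.basis.interior_convexHull
  have h' : range ht.basis = (t : Set E3) := range_coe_finset t
  rw [cell, ← h', h]
  simp only [mem_ofPred_eq, Subtype.forall]
  exact forall₂_congr fun a ha => by rw [ht.bary_eq ha]

theorem mem_cell_iff_exists {s : Finset E3} : x ∈ cell s ↔
    ∃ w : E3 → ℝ, (∀ a ∈ s, 0 ≤ w a) ∧ ∑ a ∈ s, w a = 1 ∧ ∑ a ∈ s, w a • a = x := by
  rw [cell, Finset.mem_convexHull']

theorem IsTet.mem_subcell_iff (ht : IsTet t) {s : Finset E3} (hs : s ⊆ t) :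
    x ∈ cell s ↔ x ∈ cell t ∧ ∀ a ∈ t, a ∉ s → bary t a x = 0 := by
  classical
  constructor
  · intro hx
    refine ⟨convexHull_mono (by exact_mod_cast hs) hx, fun a ha has => ?_⟩
    obtain ⟨w, h0, h1, h2⟩ := mem_cell_iff_exists.1 hx
    have e1 : ∑ b ∈ t, (if b ∈ s then w b else 0) = 1 := by
      rw [← Finset.sum_filter, Finset.filter_mem_eq_inter, Finset.inter_eq_right.2 hs, h1]
    have e2 : ∑ b ∈ t, (if b ∈ s then w b else 0) • b = x := by
      simp only [ite_smul, zero_smul]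
      rw [← Finset.sum_filter, Finset.filter_mem_eq_inter, Finset.inter_eq_right.2 hs, h2]
    rw [← e2, ht.bary_combination e1 ha, if_neg has]
  · rintro ⟨hx, h0⟩
    refine mem_cell_iff_exists.2 ⟨fun a => bary t a x, fun a ha => ht.mem_cell_iff.1 hx a (hs ha),
      ?_, ?_⟩
    · rw [← ht.sum_bary x]
      exact Finset.sum_subset hs fun a ha has => h0 a ha has
    · conv_rhs => rw [← ht.sum_bary_smul x]
      exact Finset.sum_subset hs fun a ha has => by simp only [h0 a ha has, zero_smul]

theorem cell_eq_closure_interior (ht : IsTet t) : closure (interior (cell t)) = cell t := by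
  have hne : (interior (cell t)).Nonempty := by
    obtain ⟨y, hy⟩ : ∃ y : E3, y = ∑ a ∈ t, (4⁻¹ : ℝ) • a := ⟨_, rfl⟩
    refine ⟨y, ht.mem_interior_iff.2 fun a ha => ?_⟩
    rw [hy, ht.bary_combination (w := fun _ => 4⁻¹) (by simp [ht.card]) ha]
    norm_num
  have hc : IsClosed (cell t) := (t.finite_toSet.isCompact_convexHull ℝ).isClosed
  exact ((convex_convexHull ℝ _).closure_interior_eq_closure_of_nonempty_interior hne).trans
    hc.closure_eq

theorem interior_cell_nonempty (ht : IsTet t) : (interior (cell t)).Nonempty := by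
  by_contra h
  have h1 := cell_eq_closure_interior ht
  rw [not_nonempty_iff_eq_empty.1 h, closure_empty] at h1
  have h2 : t.Nonempty := by rw [← Finset.card_pos, ht.card]; norm_num
  obtain ⟨a, ha⟩ := h2
  have : a ∈ cell t := subset_convexHull ℝ _ ha
  rw [← h1] at this
  exact this

theorem isCompact_cell (t : Finset E3) : IsCompact (cell t) := t.finite_toSet.isCompact_convexHull ℝ

theorem convex_cell (t : Finset E3) : Convex ℝ (cell t) := convex_convexHull ℝ _

theorem mem_cell_of_mem (ha : a ∈ t) : a ∈ cell t := subset_convexHull ℝ _ ha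

theorem volume_cell_diff_interior (t : Finset E3) : volume (cell t \ interior (cell t)) = 0 := by
  have := (convex_cell t).addHaar_frontier volume
  rwa [frontier, (isCompact_cell t).isClosed.closure_eq] at this

theorem uniqueDiffOn_cell (ht : IsTet t) : UniqueDiffOn ℝ (cell t) :=
  uniqueDiffOn_convex (convex_cell t) (interior_cell_nonempty ht)

/-- The linear part of a barycentric coordinate. -/
def baryLin (t : Finset E3) (a : E3) : E3 →L[ℝ] ℝ := (bary t a).linear.toContinuousLinearMap

theorem bary_sub (t : Finset E3) (a x y : E3) : bary t a x - bary t a y = baryLin t a (x - y) := by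
  have := (bary t a).linearMap_vsub x y
  simpa [baryLin] using this.symm

theorem bary_eq_add (t : Finset E3) (a x : E3) : bary t a x = baryLin t a x + bary t a 0 := by
  have := bary_sub t a x 0
  rw [sub_zero] at this
  linarith

theorem hasFDerivAt_bary (t : Finset E3) (a x : E3) : HasFDerivAt (bary t a) (baryLin t a) x := by
  have : (bary t a : E3 → ℝ) = fun x => baryLin t a x + bary t a 0 := by
    funext x; exact bary_eq_add t a x
  rw [this]
  exact (baryLin t a).hasFDerivAt.add_const _

theorem contDiff_bary (t : Finset E3) (a : E3) {n : WithTop ℕ∞} : ContDiff ℝ n (bary t a) := by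
  have : (bary t a : E3 → ℝ) = fun x => baryLin t a x + bary t a 0 := by
    funext x; exact bary_eq_add t a x
  rw [this]
  exact (baryLin t a).contDiff.add contDiff_const

theorem continuous_bary (t : Finset E3) (a : E3) : Continuous (bary t a) :=
  (contDiff_bary t a (n := 0)).continuous

theorem IsTet.sum_baryLin (ht : IsTet t) (v : E3) : ∑ a ∈ t, baryLin t a v = 0 := by
  have h := ht.sum_bary v
  rw [Finset.sum_congr rfl fun a _ => bary_eq_add t a v, Finset.sum_add_distrib, ht.sum_bary 0] at h
  linarith

theorem IsTet.sum_baryLin_smul (ht : IsTet t) (v : E3) : ∑ a ∈ t, baryLin t a v • a = v := by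
  have h := ht.sum_bary_smul v
  rw [Finset.sum_congr rfl fun a _ => by rw [bary_eq_add t a v, add_smul], Finset.sum_add_distrib,
    ht.sum_bary_smul 0, add_zero] at h
  exact h

theorem IsTet.bary_le_one (ht : IsTet t) (hx : x ∈ cell t) (a : E3) : bary t a x ≤ 1 := by
  by_cases ha : a ∈ t
  · rw [← ht.sum_bary x]
    exact Finset.single_le_sum (f := fun a => bary t a x) (fun b hb => ht.mem_cell_iff.1 hx b hb) ha
  · rw [bary_of_notMem ha]; norm_num

theorem IsTet.bary_nonneg (ht : IsTet t) (hx : x ∈ cell t) (a : E3) : 0 ≤ bary t a x := by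
  by_cases ha : a ∈ t
  · exact ht.mem_cell_iff.1 hx a ha
  · rw [bary_of_notMem ha]

/-! ### Size of a tetrahedron -/

/-- Along a chord of a ball of diameter `d` in the direction `v`, the barycentric coordinate varies
by `|baryLin t a v| * d / ‖v‖`, but it stays in `[0, 1]`. The balls are open, so slightly shorter
chords are used. The outcome is that gradients of barycentric coordinates are at most `1 / ρ_T`. -/
theorem inballDiam_set_bddAbove (ht : IsTet t) :
    ∀ d ∈ {d : ℝ | ∃ x : E3, Metric.ball x (d / 2) ⊆ cell t}, ∀ a ∈ t, ∀ v : E3,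
      |baryLin t a v| * d ≤ ‖v‖ := by
  rintro d ⟨x, hx⟩ a ha v
  rcases le_or_gt d 0 with hd | hd
  · exact (mul_nonpos_of_nonneg_of_nonpos (abs_nonneg _) hd).trans (norm_nonneg _)
  rcases eq_or_ne v 0 with rfl | hv
  · simp
  have hv' : 0 < ‖v‖ := norm_pos_iff.2 hv
  refine le_of_forall_lt fun c hc => ?_
  by_contra hcon
  push Not at hcon
  rcases le_or_gt (|baryLin t a v| * d) 0 with h | h
  · linarith [norm_nonneg v]
  -- pick `r < d / 2` with `2 r |L v| > ‖v‖`
  have hL : 0 < |baryLin t a v| := by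
    by_contra h'
    have : |baryLin t a v| = 0 := le_antisymm (not_lt.1 h') (abs_nonneg _)
    rw [this, zero_mul] at h; exact lt_irrefl _ h
  obtain ⟨r, hr1, hr2⟩ := exists_between (show ‖v‖ / (2 * |baryLin t a v|) < d / 2 by
    rw [div_lt_div_iff₀ (by positivity) (by norm_num)]; linarith)
  have hr0 : 0 < r := lt_trans (by positivity) hr1
  have hmem : ∀ σ : ℝ, |σ| = r → x + (σ / ‖v‖) • v ∈ cell t := fun σ hσ => hx <| by
    rw [Metric.mem_ball, dist_eq_norm, add_sub_cancel_left, norm_smul, norm_div, norm_norm,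
      Real.norm_eq_abs, hσ, div_mul_cancel₀ _ hv'.ne']
    exact hr2
  have e1 := hmem r (abs_of_pos hr0)
  have e2 := hmem (-r) (by rw [abs_neg, abs_of_pos hr0])
  have key : |baryLin t a (((2 * r) / ‖v‖) • v)| ≤ 1 := by
    have : ((2 * r) / ‖v‖) • v = (x + (r / ‖v‖) • v) - (x + (-r / ‖v‖) • v) := by
      rw [add_sub_add_left_eq_sub, ← sub_smul]; congr 1; ring
    rw [this, ← bary_sub, abs_le]
    have := ht.bary_le_one e1 a; have := ht.bary_le_one e2 a
    have := ht.bary_nonneg e1 a; have := ht.bary_nonneg e2 a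
    constructor <;> linarith
  rw [map_smul, smul_eq_mul, abs_mul, abs_of_pos (by positivity), div_mul_eq_mul_div,
    div_le_one hv'] at key
  rw [div_lt_iff₀ (by positivity)] at hr1
  linarith

theorem IsTet.exists_ne (ht : IsTet t) (a : E3) : ∃ b ∈ t, b ≠ a :=
  Finset.exists_mem_ne (by rw [ht.card]; norm_num) a

theorem inballDiam_bddAbove (ht : IsTet t) :
    BddAbove {d : ℝ | ∃ x : E3, Metric.ball x (d / 2) ⊆ cell t} := by
  obtain ⟨a, ha, -⟩ := ht.exists_ne 0
  obtain ⟨b, hb, hab⟩ := ht.exists_ne a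
  refine ⟨‖a - b‖, fun d hd => ?_⟩
  have h := inballDiam_set_bddAbove ht d hd a ha (a - b)
  rwa [← bary_sub, ht.bary_self ha, ht.bary_of_ne hb hab.symm, sub_zero, abs_one, one_mul] at h

theorem abs_baryLin_mul_inballDiam_le (ht : IsTet t) (ha : a ∈ t) (v : E3) :
    |baryLin t a v| * inballDiam t ≤ ‖v‖ := by
  rcases (abs_nonneg (baryLin t a v)).eq_or_lt with h | h
  · rw [← h, zero_mul]; exact norm_nonneg _
  rw [mul_comm, ← le_div_iff₀ h]
  refine csSup_le ⟨0, 0, by simp⟩ fun d hd => ?_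
  rw [le_div_iff₀ h, mul_comm]
  exact inballDiam_set_bddAbove ht d hd a ha v

theorem inballDiam_le_dist (ht : IsTet t) (ha : a ∈ t) (hb : b ∈ t) (hab : a ≠ b) :
    inballDiam t ≤ dist a b := by
  have h := abs_baryLin_mul_inballDiam_le ht ha (a - b)
  rwa [← bary_sub, ht.bary_self ha, ht.bary_of_ne hb hab, sub_zero, abs_one, one_mul,
    ← dist_eq_norm] at h

theorem inballDiam_pos (ht : IsTet t) : 0 < inballDiam t := by
  obtain ⟨x, hx⟩ := interior_cell_nonempty ht
  obtain ⟨r, hr, hb⟩ := Metric.isOpen_iff.1 isOpen_interior x hx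
  have : 2 * r ≤ inballDiam t := le_csSup (inballDiam_bddAbove ht)
    ⟨x, by rw [mul_div_cancel_left₀ _ (two_ne_zero)]; exact hb.trans interior_subset⟩
  linarith

theorem dist_le_diamCell (t : Finset E3) {x y : E3} (hx : x ∈ cell t) (hy : y ∈ cell t) :
    dist x y ≤ diamCell t := Metric.dist_le_diam_of_mem (isCompact_cell t).isBounded hx hy

theorem inballDiam_le_diamCell (ht : IsTet t) : inballDiam t ≤ diamCell t := by
  obtain ⟨a, ha, -⟩ := ht.exists_ne 0
  obtain ⟨b, hb, hab⟩ := ht.exists_ne a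
  exact (inballDiam_le_dist ht ha hb hab.symm).trans
    (dist_le_diamCell t (mem_cell_of_mem ha) (mem_cell_of_mem hb))

theorem diamCell_pos (ht : IsTet t) : 0 < diamCell t :=
  (inballDiam_pos ht).trans_le (inballDiam_le_diamCell ht)

/-- The supremum `inballDiam` need not be known to be attained; giving up half of the diameter
yields an actual ball, of radius `inballDiam t / 4`. -/
theorem exists_ball_subset_cell (ht : IsTet t) : ∃ x, Metric.ball x (inballDiam t / 4) ⊆ cell t := by
  have h := inballDiam_pos ht
  obtain ⟨d, ⟨x, hx⟩, hd⟩ := exists_lt_of_lt_csSup (b := inballDiam t / 2)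
    (s := {d : ℝ | ∃ x : E3, Metric.ball x (d / 2) ⊆ cell t}) ⟨0, 0, by simp⟩
    (half_lt_self h)
  exact ⟨x, (Metric.ball_subset_ball (by linarith)).trans hx⟩

/-! ### The divergence theorem on a tetrahedron -/

variable {t : Finset E3}

open Classical in
theorem IsTet.exists_eq_insert (ht : IsTet t) {a b : E3} (ha : a ∈ t) (hb : b ∈ t) (hab : a ≠ b) :
    ∃ c d : E3, t = {a, b, c, d} ∧ c ≠ a ∧ c ≠ b ∧ d ≠ a ∧ d ≠ b ∧ c ≠ d := by
  have hb' : b ∈ t.erase a := Finset.mem_erase.2 ⟨hab.symm, hb⟩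
  have hcard : ((t.erase a).erase b).card = 2 := by
    rw [Finset.card_erase_of_mem hb', Finset.card_erase_of_mem ha, ht.card]
  obtain ⟨c, d, hcd, h⟩ := Finset.card_eq_two.1 hcard
  have hc : c ∈ (t.erase a).erase b := by rw [h]; simp
  have hd : d ∈ (t.erase a).erase b := by rw [h]; simp
  simp only [Finset.mem_erase] at hc hd
  refine ⟨c, d, ?_, hc.2.1, hc.1, hd.2.1, hd.1, hcd⟩
  rw [← h, Finset.insert_erase hb', Finset.insert_erase ha]

theorem cell_triple (p q r : E3) [DecidableEq E3] :
    cell {p, q, r} = param p ![q - p, r - p] '' stdCorner 2 := by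
  rw [param_image_stdCorner, cell]
  congr 1
  ext x
  simp [Fin.exists_fin_two, eq_comm]

theorem cell_quadruple (p q r s : E3) [DecidableEq E3] :
    cell {p, q, r, s} = param p ![q - p, r - p, s - p] '' stdCorner 3 := by
  rw [param_image_stdCorner, cell]
  congr 1
  ext x
  simp [Fin.exists_fin_succ, eq_comm]

theorem IsTet.linearIndependent_edges (ht : IsTet t) {a b c d : E3} (ha : a ∈ t) (hb : b ∈ t)
    (hc : c ∈ t) (hd : d ∈ t) (hab : a ≠ b) (hac : a ≠ c) (had : a ≠ d) (hbc : b ≠ c)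
    (hbd : b ≠ d) (hcd : c ≠ d) : LinearIndependent ℝ ![b - a, c - a, d - a] := by
  rw [Fintype.linearIndependent_iff]
  intro g hg
  simp only [Fin.sum_univ_three, Matrix.cons_val_zero, Matrix.cons_val_one, Matrix.cons_val] at hg
  have key : ∀ e ∈ t, g 0 * (bary t e b - bary t e a) + g 1 * (bary t e c - bary t e a) +
      g 2 * (bary t e d - bary t e a) = 0 := fun e _ => by
    have := congrArg (baryLin t e) hg
    simpa [bary_sub] using this
  have kb := key b hb
  have kc := key c hc
  have kd := key d hd
  rw [ht.bary_self hb, ht.bary_of_ne ha hab.symm, ht.bary_of_ne hc hbc, ht.bary_of_ne hd hbd] at kb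
  rw [ht.bary_self hc, ht.bary_of_ne ha hac.symm, ht.bary_of_ne hb hbc.symm,
    ht.bary_of_ne hd hcd] at kc
  rw [ht.bary_self hd, ht.bary_of_ne ha had.symm, ht.bary_of_ne hb hbd.symm,
    ht.bary_of_ne hc hcd.symm] at kd
  intro i
  fin_cases i
  · simpa using kb
  · simpa using kc
  · simpa using kd

theorem linearIndependent_tail {u v w : E3} (h : LinearIndependent ℝ ![u, v, w]) :
    LinearIndependent ℝ ![v, w] :=
  h.comp Fin.succ (Fin.succ_injective _)

open Classical in
theorem IsTet.outwardNormal_erase (ht : IsTet t) {a : E3} (ha : a ∈ t) :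
    IsOutwardNormal t (t.erase a) (outwardNormal t (t.erase a)) :=
  outwardNormal_spec ht.indep ht.card (Finset.erase_subset _ _)
    (by rw [Finset.card_erase_of_mem ha, ht.card])

-- In affine coordinates with origin `a` and first axis `b - a`, this is
-- `integral_stdCorner_fderiv`. The two boundary terms live on the faces opposite `a` and `b`. The
-- other two faces contain the edge, so their normals are orthogonal to it.
open Classical in
theorem IsTet.integral_fderiv_edge (ht : IsTet t) {f : E3 → ℝ} (hf : ContDiff ℝ 1 f) {a b : E3}
    (ha : a ∈ t) (hb : b ∈ t) (hab : a ≠ b) :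
    ∫ x in cell t, fderiv ℝ f x (b - a) = ∑ k ∈ t, ⟪b - a, outwardNormal t (t.erase k)⟫_ℝ *
      ∫ x in cell (t.erase k), f x ∂Measure.euclideanHausdorffMeasure 2 := by
  obtain ⟨c, d, h, hca, hcb, hda, hdb, hcd⟩ := ht.exists_eq_insert ha hb hab
  have hc : c ∈ t := by rw [h]; simp
  have hd : d ∈ t := by rw [h]; simp
  have hli := ht.linearIndependent_edges ha hb hc hd hab hca.symm hda.symm hcb.symm hdb.symm hcd
  have hli' := ht.linearIndependent_edges hb ha hc hd hab.symm hcb.symm hdb.symm hca.symm hda.symm hcd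
  have hN := fun k (hk : k ∈ t) => ht.outwardNormal_erase hk
  have hmem : ∀ k x : E3, x ∈ t → x ≠ k → x ∈ t.erase k := fun k x hx hxk =>
    Finset.mem_erase.2 ⟨hxk, hx⟩
  have hea : t.erase a = {b, c, d} := by
    rw [h]; ext x; simp only [Finset.mem_erase, Finset.mem_insert, Finset.mem_singleton]
    constructor
    · rintro ⟨h1, h2⟩; tauto
    · rintro (rfl | rfl | rfl) <;> simp_all [eq_comm]
  have heb : t.erase b = {a, c, d} := by
    rw [h]; ext x; simp only [Finset.mem_erase, Finset.mem_insert, Finset.mem_singleton]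
    constructor
    · rintro ⟨h1, h2⟩; tauto
    · rintro (rfl | rfl | rfl) <;> simp_all [eq_comm]
  have hsum : ∀ F : E3 → ℝ, ∑ k ∈ t, F k = F a + F b + F c + F d := fun F => by
    rw [h, Finset.sum_insert, Finset.sum_insert, Finset.sum_insert, Finset.sum_singleton]
    · ring
    · simpa using hcd
    · simp [hcb.symm, hdb.symm]
    · simp [hab, hca.symm, hda.symm]
  rw [hsum]
  have hzero : ∀ k ∈ t, k ≠ a → k ≠ b → ⟪b - a, outwardNormal t (t.erase k)⟫_ℝ = 0 :=
    fun k hk hka hkb => by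
      rw [real_inner_comm]
      exact (hN k hk).orthogonal b (hmem k b hb hkb.symm) a (hmem k a ha hka.symm)
  rw [hzero c hc hca hcb, hzero d hd hda hdb, zero_mul, zero_mul, add_zero, add_zero]
  -- the two surface integrals
  have hSb : ⟪b - a, outwardNormal t (t.erase b)⟫_ℝ *
      ∫ x in cell (t.erase b), f x ∂Measure.euclideanHausdorffMeasure 2 =
      -(gramVol ![b - a, c - a, d - a] * ∫ z in stdCorner 2, f (param a ![c - a, d - a] z)) := by
    set ν := outwardNormal t (t.erase b) with hν
    have hlt : ⟪b - a, ν⟫_ℝ < 0 := by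
      rw [real_inner_comm]
      exact (hN b hb).outward a (hmem b a ha hab) b hb (Finset.notMem_erase b t)
    rw [gramVol_three (linearIndependent_tail hli) (hN b hb).norm_eq
      ((hN b hb).orthogonal c (hmem b c hc hcb) a (hmem b a ha hab))
      ((hN b hb).orthogonal d (hmem b d hd hdb) a (hmem b a ha hab)), abs_of_neg hlt, heb,
      cell_triple, integral_param_image _ (linearIndependent_tail hli)]
    ring
  have hSa : ⟪b - a, outwardNormal t (t.erase a)⟫_ℝ *
      ∫ x in cell (t.erase a), f x ∂Measure.euclideanHausdorffMeasure 2 =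
      gramVol ![b - a, c - a, d - a] * ∫ z in stdCorner 2, f (param b ![c - b, d - b] z) := by
    set ν := outwardNormal t (t.erase a) with hν
    have hlt : 0 < ⟪b - a, ν⟫_ℝ := by
      have := (hN a ha).outward b (hmem a b hb hab.symm) a ha (Finset.notMem_erase a t)
      rw [real_inner_comm, ← neg_sub, inner_neg_right] 
      linarith
    have hsh := gramVol_shear (b - a) (c - a) (d - a)
    simp only [sub_sub_sub_cancel_right] at hsh
    rw [← hsh, gramVol_three (linearIndependent_tail hli') (hN a ha).norm_eq
      ((hN a ha).orthogonal c (hmem a c hc hca) b (hmem a b hb hab.symm))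
      ((hN a ha).orthogonal d (hmem a d hd hda) b (hmem a b hb hab.symm)), abs_of_pos hlt, hea,
      cell_triple, integral_param_image _ (linearIndependent_tail hli')]
    ring
  rw [hSa, hSb]
  -- the volume integral
  set P := param a ![b - a, c - a, d - a] with hP
  have hPc : ContDiff ℝ 1 P := by
    rw [hP]; unfold param; fun_prop
  have hPd : ∀ z, fderiv ℝ P z (Pi.single 0 1) = b - a := fun z => by
    have h1 : HasFDerivAt P (∑ i, (ContinuousLinearMap.proj (R := ℝ) (φ := fun _ : Fin 3 => ℝ) i).smulRight
        (![b - a, c - a, d - a] i)) z := by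
      rw [hP]; unfold param
      refine HasFDerivAt.const_add _ ?_
      refine HasFDerivAt.fun_sum fun i _ => ?_
      exact ((ContinuousLinearMap.proj (R := ℝ) (φ := fun _ : Fin 3 => ℝ) i).hasFDerivAt (x := z)).smul_const _
    rw [h1.fderiv]
    simp [Fin.sum_univ_three]
  have hg : ContDiff ℝ 1 (f ∘ P) := hf.comp hPc
  have hvol : ∫ x in cell t, fderiv ℝ f x (b - a) = gramVol ![b - a, c - a, d - a] *
      ∫ z in stdCorner 3, fderiv ℝ (f ∘ P) z (Pi.single 0 1) := by
    have h3 := integral_param_image a hli (stdCorner 3) fun x => fderiv ℝ f x (b - a)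
    rw [EuclideanSpace.euclideanHausdorffMeasure_eq_volume, ← cell_quadruple, ← h] at h3
    rw [h3]
    congr 2
    funext z
    rw [fderiv_comp z ((hf.differentiable one_ne_zero) _) ((hPc.differentiable one_ne_zero) _),
      ContinuousLinearMap.comp_apply, hPd]
  rw [hvol, integral_stdCorner_fderiv hg, integral_sub]
  · rw [mul_sub, sub_eq_add_neg]
    congr 4
    · funext z
      simp only [Function.comp, hP, param, Fin.sum_univ_three, Fin.sum_univ_two, Matrix.cons_val_zero,
        Matrix.cons_val_one, Matrix.cons_val, Fin.cons_zero, Fin.cons_one]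
      congr 1
      have : (Fin.cons (1 - (z 0 + z 1)) z : Fin 3 → ℝ) 2 = z 1 := rfl
      rw [this]
      simp only [sub_smul, smul_sub, add_smul, one_smul]
      abel
    · funext z
      simp only [Function.comp, hP, param, Fin.sum_univ_three, Fin.sum_univ_two, Matrix.cons_val_zero,
        Matrix.cons_val_one, Matrix.cons_val, Fin.cons_zero, Fin.cons_one, zero_smul, zero_add]
      rfl
  · refine ContinuousOn.integrableOn_compact (isCompact_stdCorner 2) (Continuous.continuousOn ?_)
    refine hg.continuous.comp (continuous_pi fun i => ?_)
    refine Fin.cases ?_ (fun j => ?_) i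
    · simp only [Fin.cons_zero]; fun_prop
    · simp only [Fin.cons_succ]; fun_prop
  · refine ContinuousOn.integrableOn_compact (isCompact_stdCorner 2) (Continuous.continuousOn ?_)
    refine hg.continuous.comp (continuous_pi fun i => ?_)
    refine Fin.cases ?_ (fun j => ?_) i
    · simp only [Fin.cons_zero]; fun_prop
    · simp only [Fin.cons_succ]; fun_prop

theorem integrableOn_cell {f : E3 → ℝ} (hf : Continuous f) (t : Finset E3) :
    IntegrableOn f (cell t) := hf.continuousOn.integrableOn_compact (isCompact_cell t)

open Classical in
/-- The divergence theorem on a tetrahedron, for a field of constant direction. -/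
theorem IsTet.integral_fderiv (ht : IsTet t) {f : E3 → ℝ} (hf : ContDiff ℝ 1 f) (y : E3) :
    ∫ x in cell t, fderiv ℝ f x y = ∑ k ∈ t, ⟪y, outwardNormal t (t.erase k)⟫_ℝ *
      ∫ x in cell (t.erase k), f x ∂Measure.euclideanHausdorffMeasure 2 := by
  obtain ⟨a, ha, -⟩ := ht.exists_ne 0
  -- The coefficients `baryLin t b y` sum to zero, so the expansion of `y` in vertices is also one
  -- in edges at `a`.
  have hy : y = ∑ b ∈ t, baryLin t b y • (b - a) := by
    simp only [smul_sub, Finset.sum_sub_distrib, ht.sum_baryLin_smul, ← Finset.sum_smul,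
      ht.sum_baryLin, zero_smul, sub_zero]
  have hint : ∀ v : E3, IntegrableOn (fun x => fderiv ℝ f x v) (cell t) := fun v =>
    integrableOn_cell ((hf.continuous_fderiv one_ne_zero).clm_apply continuous_const) t
  have h1 : ∀ x, fderiv ℝ f x y = ∑ b ∈ t, baryLin t b y * fderiv ℝ f x (b - a) := fun x => by
    conv_lhs => rw [hy]
    simp [map_sum]
  simp only [h1]
  rw [integral_finsetSum _ fun b _ => (hint _).const_mul _]
  have h2 : ∀ k, ⟪y, outwardNormal t (t.erase k)⟫_ℝ =
      ∑ b ∈ t, baryLin t b y * ⟪b - a, outwardNormal t (t.erase k)⟫_ℝ := fun k => by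
    conv_lhs => rw [hy]
    simp [sum_inner, real_inner_smul_left]
  simp only [h2, Finset.sum_mul]
  rw [Finset.sum_comm]
  refine Finset.sum_congr rfl fun b hb => ?_
  rw [integral_const_mul]
  rcases eq_or_ne a b with rfl | hab
  · simp
  · rw [ht.integral_fderiv_edge hf ha hb hab, Finset.mul_sum]
    exact Finset.sum_congr rfl fun k _ => by ring

/-! ### Polyhedral domains -/

theorem IsPolyhedralDomain.isOpen {Ω : Set E3} (h : IsPolyhedralDomain Ω) : IsOpen Ω := by
  obtain ⟨-, S, -, rfl⟩ := h
  exact isOpen_interior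

theorem IsPolyhedralDomain.interior_closure {Ω : Set E3} (h : IsPolyhedralDomain Ω) :
    interior (closure Ω) = Ω := by
  refine subset_antisymm ?_ (h.isOpen.subset_interior_iff.2 subset_closure)
  obtain ⟨-, S, -, rfl⟩ := h
  have hc : IsClosed (⋃ t ∈ S, cell t) :=
    S.finite_toSet.isClosed_biUnion fun t _ => (isCompact_cell t).isClosed
  exact interior_mono (closure_minimal interior_subset hc)

theorem IsPolyhedralDomain.isCompact_closure {Ω : Set E3} (h : IsPolyhedralDomain Ω) :
    IsCompact (closure Ω) := by
  obtain ⟨-, S, -, rfl⟩ := h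
  have hc : IsCompact (⋃ t ∈ S, cell t) :=
    S.finite_toSet.isCompact_biUnion fun t _ => isCompact_cell t
  exact hc.of_isClosed_subset isClosed_closure (closure_minimal interior_subset hc.isClosed)

/-! ### Combinatorics of a mesh -/

namespace TetMesh

variable {Ω : Set E3} (M : TetMesh Ω) {s t : Finset E3} {x a : E3}

theorem mem_elements : t ∈ M.elements ↔ t ∈ M.complex.faces ∧ t.card = 4 := by
  simp [elements]

variable {M}

theorem isTet (ht : t ∈ M.elements) : IsTet t :=
  ⟨M.complex.indep (M.mem_elements.1 ht).1, (M.mem_elements.1 ht).2⟩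

theorem mem_closure_iff : x ∈ closure Ω ↔ ∃ t ∈ M.elements, x ∈ cell t := by
  rw [← M.space_eq, Geometry.SimplicialComplex.mem_space_iff]
  constructor
  · rintro ⟨s, hs, hx⟩
    obtain ⟨t, ht, hst, hc⟩ := M.pure s hs
    exact ⟨t, M.mem_elements.2 ⟨ht, hc⟩, convexHull_mono (by exact_mod_cast hst) hx⟩
  · rintro ⟨t, ht, hx⟩
    exact ⟨t, (M.mem_elements.1 ht).1, hx⟩

theorem cell_subset_closure (ht : t ∈ M.elements) : cell t ⊆ closure Ω := fun _ hx =>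
  M.mem_closure_iff.2 ⟨t, ht, hx⟩

theorem interior_cell_subset (hΩ : IsPolyhedralDomain Ω) (ht : t ∈ M.elements) :
    interior (cell t) ⊆ Ω := by
  conv_rhs => rw [← hΩ.interior_closure]
  exact interior_mono (cell_subset_closure ht)

/-- Conformity puts `x` in the hull of the common vertices. The weights there, padded by zero, are
the barycentric coordinates in both elements. This makes the hat functions well defined. -/
theorem bary_eq_of_mem (hs : s ∈ M.elements) (ht : t ∈ M.elements) (hxs : x ∈ cell s)
    (hxt : x ∈ cell t) (a : E3) : bary s a x = bary t a x := by
  classical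
  have hx : x ∈ cell (s ∩ t) := by
    have := M.complex.inter_subset_convexHull (M.mem_elements.1 hs).1 (M.mem_elements.1 ht).1
      ⟨hxs, hxt⟩
    rwa [cell, Finset.coe_inter]
  obtain ⟨w, h0, h1, h2⟩ := mem_cell_iff_exists.1 hx
  have key : ∀ u : Finset E3, IsTet u → s ∩ t ⊆ u →
      bary u a x = if a ∈ s ∩ t then w a else 0 := by
    intro u hu hsub
    by_cases ha : a ∈ u
    · have e1 : ∑ b ∈ u, (if b ∈ s ∩ t then w b else 0) = 1 := by
        rw [← Finset.sum_filter, Finset.filter_mem_eq_inter, Finset.inter_eq_right.2 hsub, h1]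
      have e2 : ∑ b ∈ u, (if b ∈ s ∩ t then w b else 0) • b = x := by
        simp only [ite_smul, zero_smul]
        rw [← Finset.sum_filter, Finset.filter_mem_eq_inter, Finset.inter_eq_right.2 hsub, h2]
      rw [← e2, hu.bary_combination e1 ha]
    · rw [bary_of_notMem ha, if_neg fun h => ha (hsub h)]
  rw [key s (isTet hs) Finset.inter_subset_left, key t (isTet ht) Finset.inter_subset_right]

theorem mem_of_bary_pos (hs : s ∈ M.elements) (ht : t ∈ M.elements) (hxs : x ∈ cell s)
    (hxt : x ∈ cell t) (h : 0 < bary s a x) : a ∈ t := by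
  by_contra ha
  rw [bary_eq_of_mem hs ht hxs hxt, bary_of_notMem ha] at h
  exact lt_irrefl _ h

theorem eq_of_mem_interior (hs : s ∈ M.elements) (ht : t ∈ M.elements)
    (hxs : x ∈ interior (cell s)) (hxt : x ∈ cell t) : s = t := by
  refine Finset.eq_of_subset_of_card_le (fun a ha => ?_) (by rw [(isTet hs).card, (isTet ht).card])
  exact mem_of_bary_pos hs ht (interior_subset hxs) hxt ((isTet hs).mem_interior_iff.1 hxs a ha)

theorem volume_cell_inter (hs : s ∈ M.elements) (ht : t ∈ M.elements) (hst : s ≠ t) :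
    volume (cell s ∩ cell t) = 0 :=
  measure_mono_null (t := cell s \ interior (cell s))
    (fun _ hx => ⟨hx.1, fun hi => hst (eq_of_mem_interior hs ht hi hx.2)⟩)
    (volume_cell_diff_interior s)

-- The cells that miss `x` are finitely many closed sets, so a neighbourhood of `x` avoids them all.
variable (M) in
theorem eventually_cells (x : E3) :
    ∀ᶠ y in 𝓝 x, ∀ t ∈ M.elements, y ∈ cell t → x ∈ cell t := by
  rw [Filter.eventually_all_finset]
  intro t _
  by_cases hx : x ∈ cell t
  · exact Filter.Eventually.of_forall fun _ _ => hx
  · filter_upwards [(isCompact_cell t).isClosed.isOpen_compl.mem_nhds hx] with y hy h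
    exact absurd h hy

theorem bary_lineMap (t : Finset E3) (a x y : E3) (r : ℝ) :
    bary t a (AffineMap.lineMap x y r) = (1 - r) * bary t a x + r * bary t a y := by
  rw [AffineMap.apply_lineMap, AffineMap.lineMap_apply_module]; simp

theorem tendsto_lineMap_zero (x y : E3) :
    Filter.Tendsto (fun r : ℝ => (AffineMap.lineMap x y r : E3)) (𝓝[>] 0) (𝓝 x) := by
  have : Continuous fun r : ℝ => (AffineMap.lineMap x y r : E3) := AffineMap.lineMap_continuous
  have h := this.tendsto 0
  rw [AffineMap.lineMap_apply_zero] at h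
  exact h.mono_left nhdsWithin_le_nhds

open Classical in
/-- A face lying in one element only does not meet the domain. -/
theorem cell_erase_inter_eq_empty (hΩ : IsPolyhedralDomain Ω) (ht : t ∈ M.elements) (ha : a ∈ t)
    (huniq : ∀ t' ∈ M.elements, t.erase a ⊆ t' → t' = t) (hx : x ∈ cell (t.erase a)) : x ∉ Ω := by
  intro hxΩ
  have hT := isTet ht
  have hx' := (hT.mem_subcell_iff (Finset.erase_subset a t)).1 hx
  -- the case of a relatively interior point
  have key : ∀ p ∈ cell (t.erase a), p ∈ Ω → ¬∀ b ∈ t.erase a, 0 < bary t b p := by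
    intro p hp hpΩ hpos
    have hp' := (hT.mem_subcell_iff (Finset.erase_subset a t)).1 hp
    have h0 : bary t a p = 0 := hp'.2 a ha (Finset.notMem_erase a t)
    -- Push `p` slightly through the face, away from `a`. An element covering the pushed point
    -- contains `p`, hence every vertex of the face, so it is `t`; but the coordinate of the pushed
    -- point at `a` is `-r < 0`.
    have hcont : Filter.Tendsto (fun r : ℝ => p + r • (p - a)) (𝓝[>] 0) (𝓝 p) := by
      have : Continuous fun r : ℝ => p + r • (p - a) := by fun_prop
      simpa using (this.tendsto 0).mono_left (nhdsWithin_le_nhds (s := Ioi 0))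
    obtain ⟨r, hr1, hr2, hr0⟩ := ((hcont.eventually (M.eventually_cells p)).and
      ((hcont.eventually (hΩ.isOpen.mem_nhds hpΩ)).and self_mem_nhdsWithin)).exists
    obtain ⟨t', ht', hrt'⟩ := M.mem_closure_iff.1 (subset_closure hr2)
    have hpt' := hr1 t' ht' hrt'
    have : t' = t := huniq t' ht' fun b hb => mem_of_bary_pos ht ht' hp'.1 hpt' (hpos b hb)
    subst this
    have h1 := bary_sub t' a (p + r • (p - a)) p
    rw [add_sub_cancel_left, map_smul, ← bary_sub, h0, hT.bary_self ha] at h1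
    have h2 := hT.bary_nonneg hrt' a
    have : 0 < r := hr0
    simp at h1
    linarith
  -- move towards the centroid of the face
  set w : E3 → ℝ := fun b => if b = a then 0 else 3⁻¹ with hw
  set c : E3 := ∑ b ∈ t, w b • b with hc
  have hw1 : ∑ b ∈ t, w b = 1 := by
    rw [← Finset.add_sum_erase t w ha]
    rw [Finset.sum_congr rfl (g := fun _ => (3⁻¹ : ℝ)) fun b hb => by
      rw [hw]; simp [(Finset.mem_erase.1 hb).1]]
    simp [hw, Finset.card_erase_of_mem ha, hT.card]
  obtain ⟨r, hr1, hr0, hr2⟩ := (((tendsto_lineMap_zero x c).eventually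
    (hΩ.isOpen.mem_nhds hxΩ)).and (Ioo_mem_nhdsGT one_pos)).exists
  have hlm : ∀ b ∈ t, bary t b (AffineMap.lineMap x c r) = (1 - r) * bary t b x + r * w b :=
    fun b hb => by rw [bary_lineMap, hc, hT.bary_combination hw1 hb]
  refine key (AffineMap.lineMap x c r) ((hT.mem_subcell_iff (Finset.erase_subset a t)).2
    ⟨hT.mem_cell_iff.2 fun b hb => ?_, fun b hb hba => ?_⟩) hr1 fun b hb => ?_
  · rw [hlm b hb]
    have h1 := hT.bary_nonneg hx'.1 b
    have h2 : 0 ≤ w b := by rw [hw]; dsimp only; split_ifs <;> norm_num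
    have : 0 ≤ (1 - r) * bary t b x := mul_nonneg (by linarith) h1
    have : 0 ≤ r * w b := mul_nonneg hr0.le h2
    linarith
  · have hbeq : b = a := by
      by_contra hne; exact hba (Finset.mem_erase.2 ⟨hne, hb⟩)
    rw [hlm b hb, hx'.2 b hb hba, hw]; simp [hbeq]
  · have hb' := Finset.mem_erase.1 hb
    rw [hlm b hb'.2]
    have h1 := hT.bary_nonneg hx'.1 b
    have h2 : w b = 3⁻¹ := by rw [hw]; simp [hb'.1]
    have : 0 ≤ (1 - r) * bary t b x := mul_nonneg (by linarith) h1
    rw [h2]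
    linarith

/-- A point with a positive barycentric coordinate at an interior vertex lies in the domain. -/
theorem mem_of_bary_pos_of_mem (hΩ : IsPolyhedralDomain Ω) (ht : t ∈ M.elements) (ha : a ∈ Ω)
    (hx : x ∈ cell t) (hpos : 0 < bary t a x) : x ∈ Ω := by
  rw [← hΩ.interior_closure, mem_interior_iff_mem_nhds]
  -- A homothety with centre `a` and small ratio `r` carries `x` and all nearby `y` into `Ω`, where
  -- an element `t'` covers the image of `y`. It contains `a`, and undoing the homothety only
  -- rescales the coordinates at its other vertices, so these stay nonnegative; the coordinate at
  -- `a` is positive at `x` and hence near `x`.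
  obtain ⟨r, hr1, hr0, hr2⟩ := (((tendsto_lineMap_zero a x).eventually
    (hΩ.isOpen.mem_nhds ha)).and (Ioo_mem_nhdsGT one_pos)).exists
  have hat : a ∈ t := by
    by_contra h; rw [bary_of_notMem h] at hpos; exact lt_irrefl _ hpos
  set p : E3 := AffineMap.lineMap a x r with hp
  have hcont : Filter.Tendsto (fun y : E3 => (AffineMap.lineMap a y r : E3)) (𝓝 x) (𝓝 p) := by
    have : Continuous fun y : E3 => (AffineMap.lineMap a y r : E3) := by
      simp only [AffineMap.lineMap_apply_module]; fun_prop
    exact this.tendsto x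
  have hpt : p ∈ cell t := by
    rw [(isTet ht).mem_cell_iff]
    intro b hb
    rw [hp, bary_lineMap]
    have := (isTet ht).bary_nonneg hx b
    have := (isTet ht).bary_nonneg (mem_cell_of_mem hat) b
    have : 0 < 1 - r := by linarith
    positivity
  have hfin : ∀ᶠ y in 𝓝 x, ∀ t' ∈ M.elements, 0 < bary t' a x → 0 < bary t' a y := by
    rw [Filter.eventually_all_finset]
    intro t' _
    by_cases h : 0 < bary t' a x
    · filter_upwards [(continuous_bary t' a).tendsto x (Ioi_mem_nhds h)] with y hy _ using hy
    · exact Filter.Eventually.of_forall fun _ h' => absurd h' h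
  filter_upwards [hfin, hcont.eventually (hΩ.isOpen.mem_nhds hr1),
    hcont.eventually (M.eventually_cells p)] with y hy1 hy2 hy3
  obtain ⟨t', ht', hyt'⟩ := M.mem_closure_iff.1 (subset_closure hy2)
  have hpt' := hy3 t' ht' hyt'
  have hT' := isTet ht'
  have hpa : 0 < bary t a p := by
    rw [hp, bary_lineMap, (isTet ht).bary_self hat]
    have : 0 < 1 - r := by linarith
    positivity
  have hat' : a ∈ t' := mem_of_bary_pos ht ht' hpt hpt' hpa
  have hxa : bary t' a x = bary t a x := by
    have h := bary_eq_of_mem ht ht' hpt hpt' a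
    rw [hp, bary_lineMap, bary_lineMap, (isTet ht).bary_self hat, hT'.bary_self hat'] at h
    have : r * bary t a x = r * bary t' a x := by linarith
    exact (mul_left_cancel₀ hr0.ne' this).symm
  refine M.mem_closure_iff.2 ⟨t', ht', hT'.mem_cell_iff.2 fun b hb => ?_⟩
  rcases eq_or_ne b a with rfl | hba
  · exact (hy1 t' ht' (hxa ▸ hpos)).le
  · have h := hT'.bary_nonneg hyt' b
    rw [bary_lineMap, hT'.bary_of_ne hat' hba, mul_zero, zero_add] at h
    exact nonneg_of_mul_nonneg_right h hr0

open Classical in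
/-- Two elements sharing a face cover a neighbourhood of its relatively interior points. -/
theorem union_mem_nhds_of_face (hs : s ∈ M.elements) (ht : t ∈ M.elements) (hst : s ≠ t)
    {k p : E3} (hk : k ∈ s) (hsub : s.erase k ⊆ t) (hp : p ∈ cell s) (hpk : bary s k p = 0)
    (hpos : ∀ b ∈ s.erase k, 0 < bary s b p) : cell s ∪ cell t ∈ 𝓝 p := by
  have hS := isTet hs
  have hT := isTet ht
  have hkt : k ∉ t := fun h => hst (Finset.eq_of_subset_of_card_le (fun b hb => by
    rcases eq_or_ne b k with rfl | hbk
    · exact h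
    · exact hsub (Finset.mem_erase.2 ⟨hbk, hb⟩)) (by rw [hS.card, hT.card]))
  obtain ⟨k', hk'⟩ : ∃ k', t \ s.erase k = {k'} := by
    rw [← Finset.card_eq_one, Finset.card_sdiff_of_subset hsub, hT.card,
      Finset.card_erase_of_mem hk, hS.card]
  have hk't : k' ∈ t ∧ k' ∉ s.erase k := by
    have h : k' ∈ t \ s.erase k := by rw [hk']; exact Finset.mem_singleton_self _
    simpa only [Finset.mem_sdiff] using h
  have huniq : ∀ b ∈ t, b ∉ s.erase k → b = k' := fun b hb hbe => by
    have h : b ∈ t \ s.erase k := Finset.mem_sdiff.2 ⟨hb, hbe⟩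
    simpa only [hk', Finset.mem_singleton] using h
  have hpe : p ∈ cell (s.erase k) := (hS.mem_subcell_iff (Finset.erase_subset k s)).2
    ⟨hp, fun b hb hbe => by
      have : b = k := by by_contra h; exact hbe (Finset.mem_erase.2 ⟨h, hb⟩)
      rw [this, hpk]⟩
  have hpt : p ∈ cell t := convexHull_mono (by exact_mod_cast hsub) hpe
  -- Both coordinates vanish on the plane of the shared face, so they are proportional; the factor
  -- is the value at `k`.
  have hexp : ∀ y, bary t k' y = bary s k y * bary t k' k := fun y => by
    have h1 : bary t k' y = ∑ b ∈ s, bary s b y * bary t k' b := by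
      rw [bary_eq_add t k' y]
      conv_lhs => rw [← hS.sum_bary_smul y, ← one_mul (bary t k' 0), ← hS.sum_bary y,
        Finset.sum_mul, map_sum, ← Finset.sum_add_distrib]
      refine Finset.sum_congr rfl fun b _ => ?_
      rw [map_smul, smul_eq_mul, ← mul_add, ← bary_eq_add]
    rw [h1, ← Finset.add_sum_erase s _ hk, add_eq_left]
    refine Finset.sum_eq_zero fun b hb => ?_
    have hne : k' ≠ b := by rintro rfl; exact hk't.2 hb
    rw [hT.bary_of_ne (hsub hb) hne, mul_zero]
  have hc0 : bary t k' k ≠ 0 := fun h => by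
    have := hexp k'
    rw [hT.bary_self hk't.1, h, mul_zero] at this
    exact one_ne_zero this
  have hposS : ∀ᶠ y in 𝓝 p, ∀ b ∈ s.erase k, 0 < bary s b y := by
    rw [Filter.eventually_all_finset]
    exact fun b hb => (continuous_bary s b).tendsto p (Ioi_mem_nhds (hpos b hb))
  have hposT : ∀ᶠ y in 𝓝 p, ∀ b ∈ s.erase k, 0 < bary t b y := by
    rw [Filter.eventually_all_finset]
    refine fun b hb => (continuous_bary t b).tendsto p (Ioi_mem_nhds ?_)
    rw [← bary_eq_of_mem hs ht hp hpt]
    exact hpos b hb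
  have hmemS : ∀ y, (∀ b ∈ s.erase k, 0 < bary s b y) → 0 ≤ bary s k y → y ∈ cell s :=
    fun y h1 h2 => hS.mem_cell_iff.2 fun b hb => by
      rcases eq_or_ne b k with rfl | hbk
      · exact h2
      · exact (h1 b (Finset.mem_erase.2 ⟨hbk, hb⟩)).le
  have hmemT : ∀ y, (∀ b ∈ s.erase k, 0 < bary t b y) → 0 ≤ bary t k' y → y ∈ cell t :=
    fun y h1 h2 => hT.mem_cell_iff.2 fun b hb => by
      by_cases hbe : b ∈ s.erase k
      · exact (h1 b hbe).le
      · rw [huniq b hb hbe]; exact h2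
  -- The two elements lie on opposite sides of the face: with a positive factor, interior points of
  -- `s` near `p` would also lie in `t`.
  have hc : bary t k' k < 0 := by
    refine lt_of_le_of_ne (not_lt.1 fun hcpos => ?_) hc0
    obtain ⟨r, ⟨hr1, hr3⟩, hr0, hr2⟩ := (((tendsto_lineMap_zero p k).eventually
      (hposS.and hposT)).and (Ioo_mem_nhdsGT one_pos)).exists
    have hbk : bary s k (AffineMap.lineMap p k r) = r := by
      rw [bary_lineMap, hpk, hS.bary_self hk]; ring
    refine hst (eq_of_mem_interior hs ht (x := AffineMap.lineMap p k r)
      (hS.mem_interior_iff.2 fun b hb => ?_) (hmemT _ hr3 ?_))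
    · rcases eq_or_ne b k with rfl | h
      · rw [hbk]; exact hr0
      · exact hr1 b (Finset.mem_erase.2 ⟨h, hb⟩)
    · rw [hexp, hbk]; exact (mul_pos hr0 hcpos).le
  filter_upwards [hposS, hposT] with y h1 h2
  rcases le_or_gt 0 (bary s k y) with h | h
  · exact Or.inl (hmemS y h1 h)
  · exact Or.inr (hmemT y h2 (by rw [hexp]; exact (mul_pos_of_neg_of_neg h hc).le))

end TetMesh

theorem volume_affine_zero (g : E3 →ᵃ[ℝ] ℝ) {y : E3} (hy : g y ≠ 0) :
    volume {x : E3 | g x = 0} = 0 := by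
  have h := Measure.addHaar_affineSubspace (volume : Measure E3)
    ((AffineSubspace.mk' (0 : ℝ) ⊥).comap g) (by
      intro htop
      have : y ∈ (AffineSubspace.mk' (0 : ℝ) ⊥).comap g := by rw [htop]; trivial
      simp [AffineSubspace.mem_comap] at this
      exact hy this)
  refine measure_mono_null (fun x hx => ?_) h
  have hx' : g x = 0 := hx
  simp [hx']

/-! ### The star of a vertex -/

namespace TetMesh

variable {Ω : Set E3} {M : TetMesh Ω} {s t : Finset E3} {x a z : E3}

-- Suppose a point near `z` is uncovered. Join a generic point `x` of a cell to a generic uncovered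
-- point `y` by a segment inside `U`, where the coordinates at `z` are positive, so that faces
-- opposite `z` are never met. By genericity the segment crosses the other faces only at relatively
-- interior points, where two members of `S` cover a neighbourhood (`union_mem_nhds_of_face`). The
-- covered parameters thus form a closed set that always extends to the right, and `y` is covered
-- after all.
open Classical in
theorem iUnion_mem_nhds_of_closed_faces {S : Finset (Finset E3)}
    (hS : ∀ t ∈ S, t ∈ M.elements ∧ z ∈ t) (hne : S.Nonempty)
    (hcl : ∀ t ∈ S, ∀ k ∈ t, k ≠ z → ∃ t' ∈ S, t' ≠ t ∧ t.erase k ⊆ t') :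
    (⋃ t ∈ S, cell t) ∈ 𝓝 z := by
  by_contra hK
  set K := ⋃ t ∈ S, cell t with hKdef
  have hKc : IsClosed K := S.finite_toSet.isClosed_biUnion fun t _ => (isCompact_cell t).isClosed
  set U : Set E3 := ⋂ t ∈ S, {x | 0 < bary t z x} with hU
  have hUo : IsOpen U := isOpen_biInter_finset fun t _ =>
    isOpen_lt continuous_const (continuous_bary t z)
  have hUmem : ∀ x, x ∈ U ↔ ∀ t ∈ S, 0 < bary t z x := fun x => by simp [hU]
  have hzU : z ∈ U := (hUmem z).2 fun t ht => by
    rw [(isTet (hS t ht).1).bary_self (hS t ht).2]; norm_num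
  obtain ⟨y₀, hy₀U, hy₀K⟩ : ∃ y, y ∈ U ∧ y ∉ K := by
    by_contra! h
    exact hK (Filter.mem_of_superset (hUo.mem_nhds hzU) h)
  have hpick : ∀ (O N : Set E3), IsOpen O → O.Nonempty → volume N = 0 → ∃ x ∈ O, x ∉ N := by
    intro O N hO hOne hN
    by_contra! h
    exact (hO.measure_pos volume hOne).ne' (measure_mono_null h hN)
  obtain ⟨t₀, ht₀⟩ := hne
  -- a generic starting point
  obtain ⟨x, ⟨hxU, hxi⟩, hxN⟩ := hpick (U ∩ interior (cell t₀))
    (⋃ t ∈ S, ⋃ j ∈ t, {x | bary t j x = 0}) (hUo.inter isOpen_interior) (by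
      have hz : z ∈ closure (interior (cell t₀)) := by
        rw [cell_eq_closure_interior (isTet (hS t₀ ht₀).1)]
        exact mem_cell_of_mem (hS t₀ ht₀).2
      exact mem_closure_iff_nhds.1 hz U (hUo.mem_nhds hzU)) (by
      refine (measure_biUnion_null_iff S.countable_toSet).2 fun t ht => ?_
      refine (measure_biUnion_null_iff t.countable_toSet).2 fun j hj => ?_
      exact volume_affine_zero (bary t j) (y := j)
        (by rw [(isTet (hS t ht).1).bary_self hj]; exact one_ne_zero))
  have hx0 : ∀ t ∈ S, ∀ j ∈ t, bary t j x ≠ 0 := by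
    simpa using hxN
  -- a generic end point
  obtain ⟨y, ⟨hyU, hyK⟩, hyN⟩ := hpick (U ∩ Kᶜ)
    (⋃ t ∈ S, ⋃ j ∈ t, ⋃ k ∈ t.erase j,
      {y | (bary t j x • bary t k - bary t k x • bary t j) y = 0})
    (hUo.inter hKc.isOpen_compl) ⟨y₀, hy₀U, hy₀K⟩ (by
      refine (measure_biUnion_null_iff S.countable_toSet).2 fun t ht => ?_
      refine (measure_biUnion_null_iff t.countable_toSet).2 fun j hj => ?_
      refine (measure_biUnion_null_iff (t.erase j).countable_toSet).2 fun k hk => ?_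
      have hk' := Finset.mem_erase.1 hk
      refine volume_affine_zero _ (y := j) ?_
      have hT := isTet (hS t ht).1
      simp [hT.bary_self hj, hT.bary_of_ne hj hk'.1, hx0 t ht k hk'.2])
  -- If the coordinates at `j` and `k` vanished at the same point of the segment, other than `x`,
  -- this two by two determinant would be zero. Its nonvanishing keeps the segment away from the
  -- intersections of two faces.
  have hyg : ∀ t ∈ S, ∀ j ∈ t, ∀ k ∈ t, k ≠ j →
      bary t j x * bary t k y - bary t k x * bary t j y ≠ 0 := by
    intro t ht j hj k hk hkj h
    refine hyN ?_
    simp only [mem_iUnion]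
    exact ⟨t, ht, j, hj, k, Finset.mem_erase.2 ⟨hkj, hk⟩, by simpa using h⟩
  have hcont : Continuous fun r : ℝ => (AffineMap.lineMap x y r : E3) := AffineMap.lineMap_continuous
  refine hyK ?_
  have h1 : (1 : ℝ) ∈ {r : ℝ | (AffineMap.lineMap x y r : E3) ∈ K} := by
    refine IsClosed.mem_of_ge_of_forall_exists_gt (a := (0 : ℝ))
      ((hKc.preimage hcont).inter isClosed_Icc) ?_ zero_le_one ?_
    · change (AffineMap.lineMap x y (0 : ℝ) : E3) ∈ K
      rw [AffineMap.lineMap_apply_zero]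
      exact mem_biUnion (s := {t | t ∈ S}) ht₀ (interior_subset hxi)
    · rintro r ⟨hrK, hr0, hr1⟩
      set p : E3 := AffineMap.lineMap x y r with hp
      have hpK : p ∈ K := hrK
      have hpU : ∀ t ∈ S, 0 < bary t z p := fun t ht => by
        rw [hp, bary_lineMap]
        have h1 := (hUmem x).1 hxU t ht
        have h2 := (hUmem y).1 hyU t ht
        have : 0 < 1 - r := by linarith
        positivity
      have hnhds : K ∈ 𝓝 p := by
        obtain ⟨t₁, ht₁, hp₁⟩ := mem_iUnion₂.1 hpK
        have hT₁ := isTet (hS t₁ ht₁).1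
        by_cases hall : ∀ b ∈ t₁, 0 < bary t₁ b p
        · exact Filter.mem_of_superset
            (isOpen_interior.mem_nhds (hT₁.mem_interior_iff.2 hall))
            (interior_subset.trans (subset_biUnion_of_mem (u := cell) (s := {t | t ∈ S}) ht₁))
        · push Not at hall
          obtain ⟨k, hk, hkp⟩ := hall
          have hk0 : bary t₁ k p = 0 := le_antisymm hkp (hT₁.bary_nonneg hp₁ k)
          have hkz : k ≠ z := by rintro rfl; exact absurd (hpU t₁ ht₁) (by rw [hk0]; simp)
          have hpos : ∀ b ∈ t₁.erase k, 0 < bary t₁ b p := by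
            intro b hb
            have hb' := Finset.mem_erase.1 hb
            refine lt_of_le_of_ne (hT₁.bary_nonneg hp₁ b) fun hb0 => ?_
            rw [hp, bary_lineMap] at hk0 hb0
            have hr : r ≠ 0 := by
              rintro rfl
              refine hx0 t₁ ht₁ k hk ?_
              linarith
            refine hyg t₁ ht₁ k hk b hb'.2 hb'.1 (mul_left_cancel₀ hr ?_)
            linear_combination -bary t₁ k x * hb0 - bary t₁ b x * hk0
          obtain ⟨t₂, ht₂, hne₂, hsub⟩ := hcl t₁ ht₁ k hk hkz
          exact Filter.mem_of_superset
            (union_mem_nhds_of_face (hS t₁ ht₁).1 (hS t₂ ht₂).1 hne₂.symm hk hsub hp₁ hk0 hpos)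
            (union_subset (subset_biUnion_of_mem (u := cell) (s := {t | t ∈ S}) ht₁)
              (subset_biUnion_of_mem (u := cell) (s := {t | t ∈ S}) ht₂))
      have hev : ∀ᶠ r' in 𝓝[>] r, (AffineMap.lineMap x y r' : E3) ∈ K :=
        ((hcont.tendsto r).mono_left nhdsWithin_le_nhds).eventually hnhds
      obtain ⟨r', hr', hr''⟩ := (hev.and (Ioc_mem_nhdsGT hr1)).exists
      exact ⟨r', hr', hr''⟩
  change (AffineMap.lineMap x y (1 : ℝ) : E3) ∈ K at h1
  rwa [AffineMap.lineMap_apply_one] at h1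

/-- Elements at a vertex `z`, adjacent when they share a face which contains `z`. -/
def starGraph (M : TetMesh Ω) (z : E3) : SimpleGraph {t : Finset E3 // t ∈ M.elements ∧ z ∈ t} where
  Adj t t' := t ≠ t' ∧ ∃ e : Finset E3, e.card = 3 ∧ z ∈ e ∧ e ⊆ t.1 ∧ e ⊆ t'.1
  symm := ⟨fun _ _ h => ⟨h.1.symm, h.2.imp fun _ he => ⟨he.1, he.2.1, he.2.2.2, he.2.2.1⟩⟩⟩
  loopless := ⟨fun _ h => h.1 rfl⟩

instance (M : TetMesh Ω) (z : E3) : Finite {t : Finset E3 // t ∈ M.elements ∧ z ∈ t} :=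
  Finite.of_injective (β := M.elements) (fun t => ⟨t.1, t.2.1⟩) fun t t' h =>
    Subtype.ext (by simpa using h)

-- Let `S` be the component of `t`. If every face at `z` of a member of `S` is shared, then `S`
-- covers a neighbourhood of `z`; so `z` is interior, and any element at `z`, having interior points
-- arbitrarily close to `z`, belongs to `S`. Otherwise some face at `z` belongs to a single element.
open Classical in
theorem star_dichotomy (hΩ : IsPolyhedralDomain Ω) (t : {t : Finset E3 // t ∈ M.elements ∧ z ∈ t}) :
    (z ∈ Ω ∧ ∀ t', (M.starGraph z).Reachable t t') ∨
    ∃ t', (M.starGraph z).Reachable t t' ∧ ∃ k ∈ t'.1, k ≠ z ∧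
      ∀ t'' ∈ M.elements, t'.1.erase k ⊆ t'' → t'' = t'.1 := by
  by_cases hex : ∃ t', (M.starGraph z).Reachable t t' ∧ ∃ k ∈ t'.1, k ≠ z ∧
      ∀ t'' ∈ M.elements, t'.1.erase k ⊆ t'' → t'' = t'.1
  · exact Or.inr hex
  refine Or.inl ?_
  push Not at hex
  set S : Finset (Finset E3) := M.elements.filter fun u =>
    ∃ h : u ∈ M.elements ∧ z ∈ u, (M.starGraph z).Reachable t ⟨u, h⟩ with hSdef
  have hSmem : ∀ u, u ∈ S ↔ ∃ h : u ∈ M.elements ∧ z ∈ u, (M.starGraph z).Reachable t ⟨u, h⟩ :=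
    fun u => by
      rw [hSdef, Finset.mem_filter]
      exact ⟨fun h => h.2, fun h => ⟨h.1.1, h⟩⟩
  have hnhds : (⋃ u ∈ S, cell u) ∈ 𝓝 z := by
    refine iUnion_mem_nhds_of_closed_faces (M := M) (fun u hu => ((hSmem u).1 hu).1)
      ⟨t.1, (hSmem t.1).2 ⟨t.2, SimpleGraph.Reachable.refl _⟩⟩ fun u hu k hk hkz => ?_
    obtain ⟨hu', hreach⟩ := (hSmem u).1 hu
    obtain ⟨u', hu'1, hsub, hne⟩ := hex ⟨u, hu'⟩ hreach k hk hkz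
    have hz : z ∈ u.erase k := Finset.mem_erase.2 ⟨hkz.symm, hu'.2⟩
    refine ⟨u', (hSmem u').2 ⟨⟨hu'1, hsub hz⟩, hreach.trans (SimpleGraph.Adj.reachable ?_)⟩,
      hne, hsub⟩
    refine ⟨fun h => hne (congrArg Subtype.val h).symm, u.erase k, ?_, hz, Finset.erase_subset _ _,
      hsub⟩
    rw [Finset.card_erase_of_mem hk, (isTet hu'.1).card]
  constructor
  · rw [← hΩ.interior_closure, mem_interior_iff_mem_nhds]
    exact Filter.mem_of_superset hnhds
      (iUnion₂_subset fun u hu => cell_subset_closure ((hSmem u).1 hu).1.1)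
  · intro t'
    have hz : z ∈ closure (interior (cell t'.1)) := by
      rw [cell_eq_closure_interior (isTet t'.2.1)]
      exact mem_cell_of_mem t'.2.2
    obtain ⟨y, hy1, hy2⟩ := mem_closure_iff_nhds.1 hz _ hnhds
    obtain ⟨u, hu, hyu⟩ := mem_iUnion₂.1 hy1
    obtain ⟨hu', hreach⟩ := (hSmem u).1 hu
    have : t' = ⟨u, hu'⟩ := Subtype.ext (eq_of_mem_interior t'.2.1 hu'.1 hy2 hyu)
    rwa [this]

open Classical in
theorem star_reachable_of_mem (hΩ : IsPolyhedralDomain Ω) (hz : z ∈ Ω)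
    (t t' : {t : Finset E3 // t ∈ M.elements ∧ z ∈ t}) : (M.starGraph z).Reachable t t' := by
  rcases star_dichotomy hΩ t with h | ⟨u, -, k, hk, hkz, huniq⟩
  · exact h.2 t'
  · refine absurd hz (cell_erase_inter_eq_empty hΩ u.2.1 hk huniq (mem_cell_of_mem ?_))
    exact Finset.mem_erase.2 ⟨hkz.symm, u.2.2⟩

-- Elements at a boundary vertex need not be linked through faces, as parts of the domain may touch
-- at `z` only. The boundary face is therefore sought in the component of the given element.
open Classical in
theorem star_exists_boundary_of_notMem (hΩ : IsPolyhedralDomain Ω) (hz : z ∉ Ω)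
    (t : {t : Finset E3 // t ∈ M.elements ∧ z ∈ t}) :
    ∃ t', (M.starGraph z).Reachable t t' ∧ ∃ k ∈ t'.1, Disjoint (cell (t'.1.erase k)) Ω := by
  rcases star_dichotomy hΩ t with h | ⟨u, hu, k, hk, hkz, huniq⟩
  · exact absurd h.1 hz
  · exact ⟨u, hu, k, hk, Set.disjoint_left.2 fun x hx =>
      cell_erase_inter_eq_empty hΩ u.2.1 hk huniq hx⟩

/-! ### Consequences of shape regularity -/

variable {γ : ℝ}

theorem ShapeRegular.diam_le (hM : M.ShapeRegular γ) (ht : t ∈ M.elements) :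
    diamCell t ≤ γ * inballDiam t := (div_le_iff₀ (inballDiam_pos (isTet ht))).1 (hM t ht)

theorem ShapeRegular.one_le (hM : M.ShapeRegular γ) (ht : t ∈ M.elements) : 1 ≤ γ := by
  have h1 := hM.diam_le ht
  have h2 := inballDiam_le_diamCell (isTet ht)
  have h3 := inballDiam_pos (isTet ht)
  by_contra! h
  nlinarith

/-- Every edge is at least as long as the inball diameter, hence at least `h_T / γ`. -/
theorem ShapeRegular.diam_le_of_edge (hM : M.ShapeRegular γ) (ht : t ∈ M.elements) {e : Finset E3}
    (he : e ⊆ t) (hec : 2 ≤ e.card) : diamCell t ≤ γ * diamCell e := by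
  obtain ⟨a, ha, b, hb, hab⟩ := Finset.one_lt_card.1 hec
  have h1 := hM.diam_le ht
  have h2 := inballDiam_le_dist (isTet ht) (he ha) (he hb) hab
  have h3 := dist_le_diamCell e (mem_cell_of_mem ha) (mem_cell_of_mem hb)
  have h4 := hM.one_le ht
  nlinarith

theorem diamCell_mono {e t : Finset E3} (he : e ⊆ t) : diamCell e ≤ diamCell t :=
  Metric.diam_mono (convexHull_mono (by exact_mod_cast he)) (isCompact_cell t).isBounded

theorem ShapeRegular.diam_le_of_adj (hM : M.ShapeRegular γ)
    {t t' : {t : Finset E3 // t ∈ M.elements ∧ z ∈ t}} (h : (M.starGraph z).Adj t t') :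
    diamCell t.1 ≤ γ * diamCell t'.1 := by
  obtain ⟨-, e, hec, -, het, het'⟩ := h
  have h1 := hM.diam_le_of_edge t.2.1 het (by rw [hec]; norm_num)
  exact h1.trans (mul_le_mul_of_nonneg_left (diamCell_mono het')
    (zero_le_one.trans (hM.one_le t.2.1)))

theorem volume_ball_toReal (x : E3) {r : ℝ} (hr : 0 ≤ r) :
    volume.real (Metric.ball x r) = r ^ 3 * volume.real (Metric.ball (0 : E3) 1) := by
  rw [Measure.real, Measure.addHaar_ball _ _ hr, ENNReal.toReal_mul, Measure.real]
  simp [hr]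

theorem volume_unitBall_pos : 0 < volume.real (Metric.ball (0 : E3) 1) :=
  ENNReal.toReal_pos (Metric.measure_ball_pos volume _ one_pos).ne' measure_ball_lt_top.ne

theorem le_volume_cell (ht : IsTet t) :
    (inballDiam t / 4) ^ 3 * volume.real (Metric.ball (0 : E3) 1) ≤ volume.real (cell t) := by
  obtain ⟨x, hx⟩ := exists_ball_subset_cell ht
  rw [← volume_ball_toReal x (by have := inballDiam_pos ht; positivity)]
  exact measureReal_mono hx (isCompact_cell t).measure_lt_top.ne

theorem volume_cell_pos (ht : IsTet t) : 0 < volume.real (cell t) :=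
  lt_of_lt_of_le (by have := inballDiam_pos ht; have := volume_unitBall_pos; positivity)
    (le_volume_cell ht)

theorem volume_cell_le (ht : IsTet t) :
    volume.real (cell t) ≤ diamCell t ^ 3 * volume.real (Metric.ball (0 : E3) 1) := by
  obtain ⟨a, ha, -⟩ := ht.exists_ne 0
  have hsub : cell t ⊆ Metric.closedBall a (diamCell t) := fun x hx =>
    dist_le_diamCell t hx (mem_cell_of_mem ha)
  have h := measureReal_mono (μ := volume) hsub measure_closedBall_lt_top.ne
  rwa [Measure.real, Measure.real, Measure.addHaar_closedBall_eq_addHaar_ball, ← Measure.real,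
    ← Measure.real, volume_ball_toReal a (diamCell_pos ht).le] at h

/-- A packing argument. Contract every element at `z` towards `z` to the smallest diameter `r` among
them. The copies overlap in null sets, lie in the ball of radius `r` around `z`, and each contains
at least the fraction `(4γ)⁻³` of its volume. -/
theorem ShapeRegular.card_star_le (hM : M.ShapeRegular γ) (ht : t ∈ M.elements) (hz : z ∈ t) :
    (Nat.card {t : Finset E3 // t ∈ M.elements ∧ z ∈ t} : ℝ) ≤ (4 * γ) ^ 3 := by
  classical
  set S := M.elements.filter fun t => z ∈ t with hS
  have hcard : Nat.card {t : Finset E3 // t ∈ M.elements ∧ z ∈ t} = S.card :=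
    Nat.subtype_card S fun x => by simp [hS]
  have hSm : ∀ u ∈ S, u ∈ M.elements ∧ z ∈ u := fun u hu => by simpa [hS] using hu
  rw [hcard]
  obtain ⟨t₀, ht₀, hmin⟩ := S.exists_min_image diamCell ⟨t, by simp [hS, ht, hz]⟩
  set r := diamCell t₀ with hr
  have hr0 : 0 < r := diamCell_pos (isTet (hSm t₀ ht₀).1)
  have hγ : 0 < γ := zero_lt_one.trans_le (hM.one_le ht)
  set β := volume.real (Metric.ball (0 : E3) 1) with hβ
  have hβ0 : 0 < β := volume_unitBall_pos
  set A : Finset E3 → Set E3 := fun u => AffineMap.homothety z (r / diamCell u) '' cell u with hA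
  have hpos : ∀ u ∈ S, 0 < diamCell u := fun u hu => diamCell_pos (isTet (hSm u hu).1)
  have hle1 : ∀ u ∈ S, r / diamCell u ≤ 1 := fun u hu => (div_le_one (hpos u hu)).2 (hmin u hu)
  have hAc : ∀ u, IsCompact (A u) := fun u =>
    (isCompact_cell u).image (AffineMap.homothety z _).continuous_of_finiteDimensional
  have hAsub : ∀ u ∈ S, A u ⊆ cell u := by
    rintro u hu _ ⟨x, hx, rfl⟩
    rw [AffineMap.homothety_eq_lineMap]
    exact (convex_cell u).lineMap_mem (mem_cell_of_mem (hSm u hu).2) hx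
      ⟨(div_pos hr0 (hpos u hu)).le, hle1 u hu⟩
  have hAball : ∀ u ∈ S, A u ⊆ Metric.closedBall z r := by
    rintro u hu _ ⟨x, hx, rfl⟩
    rw [Metric.mem_closedBall, AffineMap.homothety_eq_lineMap, dist_lineMap_left, Real.norm_eq_abs,
      abs_of_pos (div_pos hr0 (hpos u hu)), div_mul_eq_mul_div, div_le_iff₀ (hpos u hu)]
    exact mul_le_mul_of_nonneg_left
      (dist_le_diamCell u (mem_cell_of_mem (hSm u hu).2) hx) hr0.le
  have hAvol : ∀ u ∈ S, (r / (4 * γ)) ^ 3 * β ≤ volume.real (A u) := by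
    intro u hu
    have hT := isTet (hSm u hu).1
    have hp := hpos u hu
    rw [hA, Measure.real, Measure.addHaar_image_homothety, ENNReal.toReal_mul, ← Measure.real,
      ENNReal.toReal_ofReal (abs_nonneg _), abs_of_pos (by positivity)]
    simp only [finrank_euclideanSpace, Fintype.card_fin]
    refine le_trans ?_ (mul_le_mul_of_nonneg_left (le_volume_cell hT) (by positivity))
    rw [← mul_assoc, ← mul_pow]
    refine mul_le_mul_of_nonneg_right (pow_le_pow_left₀ (by positivity) ?_ 3) hβ0.le
    have h1 := hM.diam_le (hSm u hu).1
    rw [div_mul_div_comm, div_le_div_iff₀ (by positivity) (by positivity)]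
    nlinarith
  have hsum : volume.real (⋃ u ∈ S, A u) = ∑ u ∈ S, volume.real (A u) := by
    refine measureReal_biUnion_finset₀ (fun u hu v hv huv => ?_)
      (fun u _ => (hAc u).measurableSet.nullMeasurableSet) (fun u _ => (hAc u).measure_lt_top.ne)
    exact measure_mono_null (inter_subset_inter (hAsub u hu) (hAsub v hv))
      (volume_cell_inter (hSm u hu).1 (hSm v hv).1 huv)
  have h1 : (S.card : ℝ) * ((r / (4 * γ)) ^ 3 * β) ≤ r ^ 3 * β := by
    have e1 : (S.card : ℝ) * ((r / (4 * γ)) ^ 3 * β) ≤ ∑ u ∈ S, volume.real (A u) := by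
      rw [← nsmul_eq_mul]
      exact Finset.card_nsmul_le_sum S _ _ hAvol
    have e2 : volume.real (⋃ u ∈ S, A u) ≤ volume.real (Metric.closedBall z r) :=
      measureReal_mono (iUnion₂_subset hAball) measure_closedBall_lt_top.ne
    rw [Measure.real, Measure.real, Measure.addHaar_closedBall_eq_addHaar_ball, ← Measure.real,
      ← Measure.real, volume_ball_toReal z hr0.le] at e2
    linarith
  rw [div_pow, ← mul_assoc, mul_le_mul_iff_left₀ hβ0, mul_div_assoc', div_le_iff₀ (by positivity),
    mul_comm (r ^ 3)] at h1
  exact le_of_mul_le_mul_right h1 (by positivity)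

end TetMesh

/-! ### Local estimates on a tetrahedron -/

variable {t : Finset E3} {f : E3 → ℝ}

/-- The substitution `y ↦ (1 - s) x + s y` maps `K` into itself and has Jacobian `s³ ≥ 1 / 8`. -/
theorem integral_comp_lineMap_le {K : Set E3} (hK : IsCompact K) (hconv : Convex ℝ K) {G : E3 → ℝ}
    (hG : Continuous G) (hG0 : ∀ x, 0 ≤ G x) {x : E3} (hx : x ∈ K) {s : ℝ} (hs : s ∈ Icc (1 / 2 : ℝ) 1) :
    ∫ y in K, G (AffineMap.lineMap x y s) ≤ 8 * ∫ y in K, G y := by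
  have hs0 : 0 < s := by linarith [hs.1]
  have hKm := hK.measurableSet
  have hint : Integrable (K.indicator G) :=
    (integrable_indicator_iff hKm).2 (hG.continuousOn.integrableOn_compact hK)
  have hlm : ∀ y : E3, (AffineMap.lineMap x y s : E3) = (1 - s) • x + s • y := fun y =>
    AffineMap.lineMap_apply_module _ _ _
  have hint' : Integrable fun y : E3 => K.indicator G ((1 - s) • x + s • y) :=
    (hint.comp_add_left ((1 - s) • x)).comp_smul hs0.ne'
  have h1 : ∫ y in K, G (AffineMap.lineMap x y s) ≤ ∫ y, K.indicator G ((1 - s) • x + s • y) := by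
    rw [← integral_indicator hKm]
    refine integral_mono_of_nonneg (Filter.Eventually.of_forall fun y =>
      indicator_nonneg (fun y _ => hG0 _) y) hint' (Filter.Eventually.of_forall fun y => ?_)
    by_cases hy : y ∈ K
    · have hm : (AffineMap.lineMap x y s : E3) ∈ K := hconv.lineMap_mem hx hy ⟨hs0.le, hs.2⟩
      simp only [indicator_of_mem hy]
      rw [← hlm, indicator_of_mem hm]
    · simp only [indicator_of_notMem hy]
      exact indicator_nonneg (fun y _ => hG0 _) _
  have h2 : ∫ y, K.indicator G ((1 - s) • x + s • y) = (s ^ 3)⁻¹ * ∫ y in K, G y := by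
    rw [Measure.integral_comp_smul volume (fun y => K.indicator G ((1 - s) • x + y)) s,
      integral_add_left_eq_self (μ := volume) (fun y => K.indicator G y), integral_indicator hKm,
      finrank_euclideanSpace, Fintype.card_fin, abs_of_pos (by positivity), smul_eq_mul]
  rw [h2] at h1
  refine h1.trans (mul_le_mul_of_nonneg_right ?_ (integral_nonneg fun y => hG0 y))
  rw [inv_le_comm₀ (by positivity) (by norm_num)]
  calc (8 : ℝ)⁻¹ = (1 / 2) ^ 3 := by norm_num
    _ ≤ s ^ 3 := pow_le_pow_left₀ (by norm_num) hs.1 3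

/-- One of `s` and `1 - s` is at least `1 / 2`. Integrating first in the variable with that weight
avoids the degenerate Jacobian. -/
theorem integral_integral_comp_lineMap_le {K : Set E3} (hK : IsCompact K) (hconv : Convex ℝ K)
    {G : E3 → ℝ} (hG : Continuous G) (hG0 : ∀ x, 0 ≤ G x) {s : ℝ} (hs : s ∈ Icc (0 : ℝ) 1) :
    ∫ x in K, ∫ y in K, G (AffineMap.lineMap x y s) ≤ 8 * volume.real K * ∫ y in K, G y := by
  have : IsFiniteMeasure (volume.restrict K) := isFiniteMeasure_restrict.2 hK.measure_lt_top.ne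
  have hc : Continuous fun p : E3 × E3 => G (AffineMap.lineMap p.1 p.2 s) := by
    simp only [AffineMap.lineMap_apply_module]
    fun_prop
  have hint : Integrable (fun p : E3 × E3 => G (AffineMap.lineMap p.1 p.2 s))
      ((volume.restrict K).prod (volume.restrict K)) := by
    rw [Measure.prod_restrict]
    exact hc.continuousOn.integrableOn_compact (hK.prod hK)
  have hbound : ∀ F : E3 → ℝ, Integrable F (volume.restrict K) →
      (∀ x ∈ K, F x ≤ 8 * ∫ y in K, G y) →
      ∫ x in K, F x ≤ 8 * volume.real K * ∫ y in K, G y := by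
    intro F hF hle
    have h := setIntegral_mono_on hF (integrable_const _) hK.measurableSet hle
    refine h.trans_eq ?_
    rw [setIntegral_const, smul_eq_mul]
    ring
  rcases le_total (1 / 2) s with h | h
  · exact hbound _ hint.integral_prod_left fun x hx =>
      integral_comp_lineMap_le hK hconv hG hG0 hx ⟨h, hs.2⟩
  · rw [integral_integral_swap hint]
    refine hbound _ hint.integral_prod_right fun y hy => ?_
    have := integral_comp_lineMap_le hK hconv hG hG0 hy (s := 1 - s) ⟨by linarith, by linarith [hs.1]⟩
    simpa only [AffineMap.lineMap_apply_one_sub] using this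

/-- The fundamental theorem of calculus on the segment, then Cauchy-Schwarz in the form that the
variance of the directional derivative is nonnegative. -/
theorem sq_sub_le_integral_lineMap (hf : ContDiff ℝ 1 f) (x y : E3) :
    (f x - f y) ^ 2 ≤ dist x y ^ 2 *
      ∫ s in (0 : ℝ)..1, ‖fderiv ℝ f (AffineMap.lineMap x y s)‖ ^ 2 := by
  set g : ℝ → ℝ := fun s => fderiv ℝ f (AffineMap.lineMap x y s) (y - x) with hg
  have hlc : Continuous fun s : ℝ => (AffineMap.lineMap x y s : E3) := AffineMap.lineMap_continuous
  have hfc := hf.continuous_fderiv one_ne_zero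
  have hgc : Continuous g := (hfc.comp hlc).clm_apply continuous_const
  have h1 : ∫ s in (0 : ℝ)..1, g s = f y - f x := by
    have := intervalIntegral.integral_eq_sub_of_hasDerivAt (a := 0) (b := 1)
      (f := fun s : ℝ => f (AffineMap.lineMap x y s)) (f' := g) (fun s _ =>
        ((hf.differentiable one_ne_zero _).hasFDerivAt.comp_hasDerivAt s
          AffineMap.hasDerivAt_lineMap)) (hgc.intervalIntegrable _ _)
    simpa using this
  set m := f y - f x with hm
  have h2 : 0 ≤ ∫ s in (0 : ℝ)..1, (g s - m) ^ 2 :=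
    intervalIntegral.integral_nonneg zero_le_one fun s _ => sq_nonneg _
  have h3 : ∫ s in (0 : ℝ)..1, (g s - m) ^ 2 = (∫ s in (0 : ℝ)..1, g s ^ 2) - m ^ 2 := by
    have : ∀ s, (g s - m) ^ 2 = g s ^ 2 - (2 * m) * g s + m ^ 2 := fun s => by ring
    simp only [this]
    rw [intervalIntegral.integral_add, intervalIntegral.integral_sub,
      intervalIntegral.integral_const_mul, h1, intervalIntegral.integral_const]
    · simp; ring
    all_goals exact Continuous.intervalIntegrable (by fun_prop) _ _
  have h4 : ∫ s in (0 : ℝ)..1, g s ^ 2 ≤ ∫ s in (0 : ℝ)..1,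
      dist x y ^ 2 * ‖fderiv ℝ f (AffineMap.lineMap x y s)‖ ^ 2 := by
    refine intervalIntegral.integral_mono_on zero_le_one
      (Continuous.intervalIntegrable (by fun_prop) _ _)
      (Continuous.intervalIntegrable (by
        have := hfc.comp hlc
        exact continuous_const.mul (this.norm.pow 2)) _ _) fun s _ => ?_
    have := (fderiv ℝ f (AffineMap.lineMap x y s)).le_opNorm (y - x)
    rw [← dist_eq_norm, dist_comm, Real.norm_eq_abs] at this
    calc g s ^ 2 = |g s| ^ 2 := (sq_abs _).symm
      _ ≤ (‖fderiv ℝ f (AffineMap.lineMap x y s)‖ * dist x y) ^ 2 :=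
        pow_le_pow_left₀ (abs_nonneg _) this 2
      _ = _ := by ring
  rw [intervalIntegral.integral_const_mul] at h4
  have : (f x - f y) ^ 2 = m ^ 2 := by rw [hm]; ring
  linarith

/-- The mean value over a tetrahedron. -/
def cellMean (t : Finset E3) (f : E3 → ℝ) : ℝ := (volume.real (cell t))⁻¹ * ∫ x in cell t, f x

theorem cellMean_mul (ht : IsTet t) (f : E3 → ℝ) :
    volume.real (cell t) * cellMean t f = ∫ x in cell t, f x := by
  rw [cellMean, mul_inv_cancel_left₀ (TetMesh.volume_cell_pos ht).ne']

/-- The bias-variance identity. It serves the Poincaré inequality, Cauchy-Schwarz against constants,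
and the comparison of means. -/
theorem integral_sub_const_sq (ht : IsTet t) (hf : Continuous f) (c : ℝ) :
    ∫ x in cell t, (f x - c) ^ 2 =
      (∫ x in cell t, (f x - cellMean t f) ^ 2) + volume.real (cell t) * (cellMean t f - c) ^ 2 := by
  have h : ∀ c, ∫ x in cell t, (f x - c) ^ 2 = (∫ x in cell t, f x ^ 2) -
      2 * c * (volume.real (cell t) * cellMean t f) + volume.real (cell t) * c ^ 2 := by
    intro c
    have : ∀ x, (f x - c) ^ 2 = f x ^ 2 - (2 * c) * f x + c ^ 2 := fun s => by ring
    simp only [this]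
    rw [integral_add, integral_sub, integral_const_mul, setIntegral_const, cellMean_mul ht]
    · simp
    all_goals exact integrableOn_cell (by fun_prop) t
  rw [h c, h (cellMean t f)]
  ring

/-- The Poincaré inequality on a tetrahedron. -/
theorem poincare_cell (ht : IsTet t) (hf : ContDiff ℝ 1 f) :
    ∫ x in cell t, (f x - cellMean t f) ^ 2 ≤
      4 * diamCell t ^ 2 * ∫ x in cell t, ‖fderiv ℝ f x‖ ^ 2 := by
  set K := cell t with hKdef
  have hK : IsCompact K := isCompact_cell t
  have : IsFiniteMeasure (volume.restrict K) := isFiniteMeasure_restrict.2 hK.measure_lt_top.ne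
  set V := volume.real K with hV
  have hV0 : 0 < V := TetMesh.volume_cell_pos ht
  set G : E3 → ℝ := fun x => ‖fderiv ℝ f x‖ ^ 2 with hG
  have hGc : Continuous G := (hf.continuous_fderiv one_ne_zero).norm.pow 2
  have hG0 : ∀ x, 0 ≤ G x := fun x => sq_nonneg _
  have hFc : Continuous fun q : (E3 × E3) × ℝ => G (AffineMap.lineMap q.1.1 q.1.2 q.2) := by
    simp only [AffineMap.lineMap_apply_module]
    fun_prop
  have hFint : Integrable (fun q : (E3 × E3) × ℝ => G (AffineMap.lineMap q.1.1 q.1.2 q.2))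
      (((volume.restrict K).prod (volume.restrict K)).prod (volume.restrict (Icc (0 : ℝ) 1))) := by
    rw [Measure.prod_restrict, Measure.prod_restrict]
    exact hFc.continuousOn.integrableOn_compact ((hK.prod hK).prod isCompact_Icc)
  -- the double integral of `(f x - f y)²`
  have hsq : Continuous fun p : E3 × E3 => (f p.1 - f p.2) ^ 2 := by
    have := hf.continuous
    fun_prop
  have hsqint : Integrable (fun p : E3 × E3 => (f p.1 - f p.2) ^ 2)
      ((volume.restrict K).prod (volume.restrict K)) := by
    rw [Measure.prod_restrict]
    exact hsq.continuousOn.integrableOn_compact (hK.prod hK)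
  have h1 : ∫ p, (f p.1 - f p.2) ^ 2 ∂((volume.restrict K).prod (volume.restrict K)) ≤
      diamCell t ^ 2 * (8 * V * ∫ x in K, G x) := by
    have e1 : ∫ p, (f p.1 - f p.2) ^ 2 ∂((volume.restrict K).prod (volume.restrict K)) ≤
        ∫ p, (diamCell t ^ 2 * ∫ s in Icc (0 : ℝ) 1, G (AffineMap.lineMap p.1 p.2 s))
          ∂((volume.restrict K).prod (volume.restrict K)) := by
      refine integral_mono_ae hsqint (hFint.integral_prod_left.const_mul _) ?_
      rw [Measure.prod_restrict]
      refine (ae_restrict_iff' (hK.measurableSet.prod hK.measurableSet)).2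
        (Filter.Eventually.of_forall fun p hp => ?_)
      have h := sq_sub_le_integral_lineMap hf p.1 p.2
      rw [intervalIntegral.integral_of_le zero_le_one, ← integral_Icc_eq_integral_Ioc] at h
      refine h.trans (mul_le_mul_of_nonneg_right ?_ (integral_nonneg fun s => hG0 _))
      exact pow_le_pow_left₀ dist_nonneg (dist_le_diamCell t hp.1 hp.2) 2
    refine e1.trans ?_
    rw [integral_const_mul]
    refine mul_le_mul_of_nonneg_left ?_ (sq_nonneg _)
    rw [integral_integral_swap hFint]
    have e2 : ∀ s ∈ Icc (0 : ℝ) 1, ∫ p, G (AffineMap.lineMap p.1 p.2 s)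
        ∂((volume.restrict K).prod (volume.restrict K)) ≤ 8 * V * ∫ x in K, G x := by
      intro s hs
      rw [integral_prod]
      · exact integral_integral_comp_lineMap_le hK (convex_cell t) hGc hG0 hs
      · rw [Measure.prod_restrict]
        have : Continuous fun p : E3 × E3 => G (AffineMap.lineMap p.1 p.2 s) := by
          simp only [AffineMap.lineMap_apply_module]
          fun_prop
        exact this.continuousOn.integrableOn_compact (hK.prod hK)
    have e3 := setIntegral_mono_on hFint.integral_prod_right
      (integrable_const (8 * V * ∫ x in K, G x)) measurableSet_Icc e2
    rw [setIntegral_const] at e3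
    simpa using e3
  -- The double integral is twice the volume times the integrated variance; with the `8` of the
  -- upper bound this gives the constant `4`.
  have h2 : ∫ p, (f p.1 - f p.2) ^ 2 ∂((volume.restrict K).prod (volume.restrict K)) =
      2 * V * ∫ x in K, (f x - cellMean t f) ^ 2 := by
    rw [integral_prod _ hsqint]
    have e1 : ∀ x, ∫ y in K, (f x - f y) ^ 2 =
        (∫ y in K, (f y - cellMean t f) ^ 2) + V * (f x - cellMean t f) ^ 2 := fun x => by
      rw [show V * (f x - cellMean t f) ^ 2 = V * (cellMean t f - f x) ^ 2 by ring,
        ← integral_sub_const_sq ht hf.continuous (f x)]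
      exact integral_congr_ae (Filter.Eventually.of_forall fun y => by simp only; ring)
    simp only [e1]
    rw [integral_add (integrable_const _) ((integrableOn_cell (by
      have := hf.continuous
      fun_prop) t).const_mul _), setIntegral_const, integral_const_mul, smul_eq_mul]
    ring
  rw [h2] at h1
  have : 2 * V * ∫ x in K, (f x - cellMean t f) ^ 2 ≤
      2 * V * (4 * diamCell t ^ 2 * ∫ x in K, G x) := by linarith
  exact le_of_mul_le_mul_left this (by positivity)

theorem euclideanHausdorffMeasure_cell_lt_top {e : Finset E3} (he : e.card = 3) :
    Measure.euclideanHausdorffMeasure 2 (cell e) < ⊤ := by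
  classical
  obtain ⟨p, q, r, -, -, -, rfl⟩ := Finset.card_eq_three.1 he
  rw [cell_triple, euclideanHausdorff_param_image]
  exact ENNReal.mul_lt_top ENNReal.ofReal_lt_top (isCompact_stdCorner 2).measure_lt_top

theorem integrableOn_face {e : Finset E3} (he : e.card = 3) (hf : ContinuousOn f (cell e)) :
    IntegrableOn f (cell e) (Measure.euclideanHausdorffMeasure 2) := by
  have : IsFiniteMeasure ((Measure.euclideanHausdorffMeasure 2).restrict (cell e)) :=
    isFiniteMeasure_restrict.2 (euclideanHausdorffMeasure_cell_lt_top he).ne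
  obtain ⟨C, hC⟩ := (isCompact_cell e).exists_bound_of_continuousOn hf
  refine Integrable.of_bound (hf.aestronglyMeasurable (isCompact_cell e).measurableSet) C ?_
  exact (ae_restrict_iff' (isCompact_cell e).measurableSet).2 (Filter.Eventually.of_forall hC)

theorem IsOutwardNormal.inner_sub_eq_zero {e : Finset E3} {ν b x : E3} (h : IsOutwardNormal t e ν)
    (hx : x ∈ cell e) (hb : b ∈ e) : ⟪x - b, ν⟫_ℝ = 0 := by
  obtain ⟨w, -, h1, rfl⟩ := mem_cell_iff_exists.1 hx
  have : ∑ a ∈ e, w a • a - b = ∑ a ∈ e, w a • (a - b) := by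
    simp only [smul_sub, Finset.sum_sub_distrib, ← Finset.sum_smul, h1, one_smul]
  rw [this, sum_inner]
  refine Finset.sum_eq_zero fun a ha => ?_
  rw [real_inner_smul_left, real_inner_comm, h.orthogonal a ha b hb, mul_zero]

open Classical in
/-- The distance of the vertex `a` from the opposite face, and the divergence theorem for radial
fields centred at `a`. -/
theorem IsTet.exists_height (ht : IsTet t) {a : E3} (ha : a ∈ t) :
    ∃ H : ℝ, inballDiam t ≤ H ∧
      ∀ f : E3 → ℝ, ContDiff ℝ 1 f → ∫ x in cell t, (3 * f x + fderiv ℝ f x (x - a)) =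
        H * ∫ x in cell (t.erase a), f x ∂Measure.euclideanHausdorffMeasure 2 := by
  have hN := fun k (hk : k ∈ t) => ht.outwardNormal_erase hk
  set ν := fun k => outwardNormal t (t.erase k) with hν
  obtain ⟨b₀, hb₀, hba⟩ := ht.exists_ne a
  have hb₀e : b₀ ∈ t.erase a := Finset.mem_erase.2 ⟨hba, hb₀⟩
  -- The height over the face opposite `a`. The coordinate at `a` falls from `1` to `0` across it,
  -- so its slope along `ν a` is `1 / H` in absolute value; the slope bound `1 / ρ_T` gives `ρ_T ≤
  -- H`.
  set H := ⟪b₀ - a, ν a⟫_ℝ with hH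
  have hHpos : 0 < H := by
    have := (hN a ha).outward b₀ hb₀e a ha (Finset.notMem_erase a t)
    rw [hH, real_inner_comm, ← neg_sub, inner_neg_right]
    linarith
  refine ⟨H, ?_, fun f hf => ?_⟩
  · have h1 : ν a = ∑ b ∈ t, baryLin t b (ν a) • (b - b₀) := by
      simp only [smul_sub, Finset.sum_sub_distrib, ht.sum_baryLin_smul, ← Finset.sum_smul,
        ht.sum_baryLin, zero_smul, sub_zero]
    have h2 : (1 : ℝ) = baryLin t a (ν a) * -H := by
      have e1 : ⟪ν a, ν a⟫_ℝ = 1 := by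
        rw [real_inner_self_eq_norm_sq, (hN a ha).norm_eq]; norm_num
      have e2 : ⟪∑ b ∈ t, baryLin t b (ν a) • (b - b₀), ν a⟫_ℝ = 1 := by rw [← h1, e1]
      rw [sum_inner, ← Finset.add_sum_erase t _ ha, Finset.sum_eq_zero, add_zero,
        real_inner_smul_left] at e2
      · rw [← e2, hH, ← inner_neg_left, neg_sub]
      · intro b hb
        rw [real_inner_smul_left, real_inner_comm, (hN a ha).orthogonal b hb b₀ hb₀e, mul_zero]
    have h3 := abs_baryLin_mul_inballDiam_le ht ha (ν a)
    rw [(hN a ha).norm_eq] at h3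
    have h4 : |baryLin t a (ν a)| * H = 1 := by
      have := congrArg abs h2
      rw [abs_one, abs_mul, abs_neg, abs_of_pos hHpos] at this
      exact this.symm
    have h5 : 0 < |baryLin t a (ν a)| := by
      by_contra h
      have : |baryLin t a (ν a)| = 0 := le_antisymm (not_lt.1 h) (abs_nonneg _)
      rw [this, zero_mul] at h4
      exact zero_ne_one h4
    rw [← h4] at h3
    exact le_of_mul_le_mul_left h3 h5
  -- The radial field `f x • (x - a)` is tangent to the faces through `a`, and on the opposite face
  -- its normal component is `H * f x`. The divergence theorem is applied to each of its coordinates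
  -- `F i`.
  · set c : Fin 3 → E3 := fun i => EuclideanSpace.single i 1 with hc
    set F : Fin 3 → E3 → ℝ := fun i x => f x * (x i - a i) with hF
    have hproj : ∀ i : Fin 3, ContDiff ℝ 1 fun x : E3 => x i - a i := fun i => by fun_prop
    have hFc : ∀ i, ContDiff ℝ 1 (F i) := fun i => hf.mul (hproj i)
    have hFd : ∀ i x, fderiv ℝ (F i) x (c i) = f x + (x i - a i) * fderiv ℝ f x (c i) := by
      intro i x
      have h1 : HasFDerivAt (fun x : E3 => x i - a i) (EuclideanSpace.proj i : E3 →L[ℝ] ℝ) x :=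
        (EuclideanSpace.proj i : E3 →L[ℝ] ℝ).hasFDerivAt.sub_const _
      have h2 := ((hf.differentiable one_ne_zero x).hasFDerivAt).mul h1
      have h3 : fderiv ℝ (F i) x = f x • (EuclideanSpace.proj i : E3 →L[ℝ] ℝ) +
          (x i - a i) • fderiv ℝ f x := h2.fderiv
      rw [h3]
      simp [hc]
    have hcoord : ∀ x : E3, x - a = ∑ i, (x i - a i) • c i := fun x => by
      ext j
      simp [hc, Finset.sum_apply, Pi.single_apply]
    have hL : ∀ x, 3 * f x + fderiv ℝ f x (x - a) = ∑ i, fderiv ℝ (F i) x (c i) := by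
      intro x
      simp only [hFd, Finset.sum_add_distrib]
      conv_lhs => rw [hcoord x, map_sum]
      simp
    have hIc : ∀ i, IntegrableOn (fun x => fderiv ℝ (F i) x (c i)) (cell t) := fun i =>
      integrableOn_cell (((hFc i).continuous_fderiv one_ne_zero).clm_apply continuous_const) t
    simp only [hL]
    rw [integral_finsetSum _ fun i _ => hIc i]
    simp only [fun i => ht.integral_fderiv (hFc i) (c i)]
    rw [Finset.sum_comm]
    have hface : ∀ k ∈ t, ∑ i, ⟪c i, ν k⟫_ℝ *
        ∫ x in cell (t.erase k), F i x ∂Measure.euclideanHausdorffMeasure 2 =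
        ∫ x in cell (t.erase k), f x * ⟪x - a, ν k⟫_ℝ ∂Measure.euclideanHausdorffMeasure 2 := by
      intro k hk
      simp only [← integral_const_mul]
      rw [← integral_finsetSum]
      · refine integral_congr_ae (Filter.Eventually.of_forall fun x => ?_)
        simp only [hF]
        conv_rhs => rw [hcoord x, sum_inner, Finset.mul_sum]
        refine Finset.sum_congr rfl fun i _ => ?_
        rw [real_inner_smul_left]
        ring
      · intro i _
        refine (integrableOn_face ?_ (hFc i).continuous.continuousOn).const_mul _
        rw [Finset.card_erase_of_mem hk, ht.card]
    rw [Finset.sum_congr rfl hface, ← Finset.add_sum_erase t _ ha, Finset.sum_eq_zero, add_zero,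
      ← integral_const_mul]
    · refine setIntegral_congr_fun (isCompact_cell _).measurableSet fun x hx => ?_
      have h := (hN a ha).inner_sub_eq_zero hx hb₀e
      have : x - a = (x - b₀) + (b₀ - a) := by abel
      rw [this, inner_add_left, h, zero_add, ← hH, mul_comm]
    · intro k hk
      have hk' := Finset.mem_erase.1 hk
      refine setIntegral_eq_zero_of_forall_eq_zero fun x hx => ?_
      rw [(hN k hk'.2).inner_sub_eq_zero hx (Finset.mem_erase.2 ⟨hk'.1.symm, ha⟩), mul_zero]

theorem sq_integral_le (ht : IsTet t) {g : E3 → ℝ} (hg : Continuous g) :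
    (∫ x in cell t, g x) ^ 2 ≤ volume.real (cell t) * ∫ x in cell t, g x ^ 2 := by
  have h := integral_sub_const_sq ht hg 0
  simp only [sub_zero] at h
  have h1 : 0 ≤ ∫ x in cell t, (g x - cellMean t g) ^ 2 := integral_nonneg fun x => sq_nonneg _
  have h2 : volume.real (cell t) * cellMean t g ^ 2 ≤ ∫ x in cell t, g x ^ 2 := by linarith
  have hV := TetMesh.volume_cell_pos ht
  rw [← cellMean_mul ht g]
  calc _ = volume.real (cell t) * (volume.real (cell t) * cellMean t g ^ 2) := by ring
    _ ≤ _ := mul_le_mul_of_nonneg_left h2 hV.le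

/-- The mean value over a face. -/
def faceMean (e : Finset E3) (f : E3 → ℝ) : ℝ :=
  ((Measure.euclideanHausdorffMeasure 2).real (cell e))⁻¹ *
    ∫ x in cell e, f x ∂Measure.euclideanHausdorffMeasure 2

theorem abs_integral_fderiv_radial_le (hf : ContDiff ℝ 1 f) {a : E3} (ha : a ∈ t) :
    |∫ x in cell t, fderiv ℝ f x (x - a)| ≤ diamCell t * ∫ x in cell t, ‖fderiv ℝ f x‖ := by
  have hfc := hf.continuous_fderiv one_ne_zero
  rw [← integral_const_mul, ← Real.norm_eq_abs]
  refine norm_integral_le_of_norm_le (integrableOn_cell (by fun_prop) t) ?_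
  refine (ae_restrict_iff' (isCompact_cell t).measurableSet).2 (Filter.Eventually.of_forall
    fun x hx => ?_)
  refine ((fderiv ℝ f x).le_opNorm _).trans ?_
  rw [mul_comm, ← dist_eq_norm]
  exact mul_le_mul_of_nonneg_right (dist_le_diamCell t hx (mem_cell_of_mem ha)) (norm_nonneg _)

open Classical in
/-- Comparison of the mean values over a tetrahedron and over one of its faces. -/
theorem sq_faceMean_sub_cellMean_le (ht : IsTet t) (hf : ContDiff ℝ 1 f) {a : E3} (ha : a ∈ t) :
    volume.real (cell t) * (faceMean (t.erase a) f - cellMean t f) ^ 2 ≤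
      diamCell t ^ 2 * ∫ x in cell t, ‖fderiv ℝ f x‖ ^ 2 := by
  obtain ⟨H, hH, hdiv⟩ := ht.exists_height ha
  have hHpos : 0 < H := (inballDiam_pos ht).trans_le hH
  set V := volume.real (cell t) with hV
  have hVpos : 0 < V := TetMesh.volume_cell_pos ht
  have hfc := hf.continuous_fderiv one_ne_zero
  have hcont := hf.continuous
  have hint : IntegrableOn (fun x => fderiv ℝ f x (x - a)) (cell t) :=
    integrableOn_cell (by fun_prop) t
  -- The radial identity for `f = 1` gives the area of the face. Its general case then exhibits the
  -- difference of the two means as a multiple of the integrated radial derivative.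
  have h1 : 3 * V = H * (Measure.euclideanHausdorffMeasure 2).real (cell (t.erase a)) := by
    have := hdiv (fun _ => 1) contDiff_const
    simpa [fderiv_const, mul_comm] using this
  have h2 := hdiv f hf
  rw [integral_add (integrableOn_cell (by fun_prop) t) hint, integral_const_mul,
    ← cellMean_mul ht] at h2
  have h3 : faceMean (t.erase a) f - cellMean t f =
      (3 * V)⁻¹ * ∫ x in cell t, fderiv ℝ f x (x - a) := by
    have e1 : (Measure.euclideanHausdorffMeasure 2).real (cell (t.erase a)) = 3 * V / H := by
      rw [h1]; field_simp
    have e2 : ∫ x in cell (t.erase a), f x ∂Measure.euclideanHausdorffMeasure 2 =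
        (3 * (V * cellMean t f) + ∫ x in cell t, fderiv ℝ f x (x - a)) / H := by
      rw [h2]; field_simp
    rw [faceMean, e1, e2]
    field_simp
    ring
  have h4 := abs_integral_fderiv_radial_le hf ha
  have h5 := sq_integral_le ht hfc.norm
  rw [h3, mul_pow]
  have h6 : (∫ x in cell t, fderiv ℝ f x (x - a)) ^ 2 ≤
      diamCell t ^ 2 * (V * ∫ x in cell t, ‖fderiv ℝ f x‖ ^ 2) := by
    rw [← sq_abs]
    refine (pow_le_pow_left₀ (abs_nonneg _) h4 2).trans ?_
    rw [mul_pow]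
    exact mul_le_mul_of_nonneg_left h5 (sq_nonneg _)
  have hI : 0 ≤ ∫ x in cell t, ‖fderiv ℝ f x‖ ^ 2 := integral_nonneg fun x => sq_nonneg _
  calc V * ((3 * V)⁻¹ ^ 2 * (∫ x in cell t, fderiv ℝ f x (x - a)) ^ 2)
      ≤ V * ((3 * V)⁻¹ ^ 2 * (diamCell t ^ 2 * (V * ∫ x in cell t, ‖fderiv ℝ f x‖ ^ 2))) := by gcongr
    _ = 9⁻¹ * (diamCell t ^ 2 * ∫ x in cell t, ‖fderiv ℝ f x‖ ^ 2) := by field_simp; ring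
    _ ≤ diamCell t ^ 2 * ∫ x in cell t, ‖fderiv ℝ f x‖ ^ 2 := by
      have : 0 ≤ diamCell t ^ 2 * ∫ x in cell t, ‖fderiv ℝ f x‖ ^ 2 := by positivity
      linarith

open Classical in
/-- A trace inequality. -/
theorem trace_cell (ht : IsTet t) (hf : ContDiff ℝ 1 f) {a : E3} (ha : a ∈ t) :
    inballDiam t * ∫ x in cell (t.erase a), f x ^ 2 ∂Measure.euclideanHausdorffMeasure 2 ≤
      4 * (∫ x in cell t, f x ^ 2) + diamCell t ^ 2 * ∫ x in cell t, ‖fderiv ℝ f x‖ ^ 2 := by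
  obtain ⟨H, hH, hdiv⟩ := ht.exists_height ha
  have hfc := hf.continuous_fderiv one_ne_zero
  have hcont := hf.continuous
  have h0 : 0 ≤ ∫ x in cell (t.erase a), f x ^ 2 ∂Measure.euclideanHausdorffMeasure 2 :=
    integral_nonneg fun x => sq_nonneg _
  refine (mul_le_mul_of_nonneg_right hH h0).trans ?_
  rw [← hdiv _ (hf.pow 2), ← integral_const_mul, ← integral_const_mul, ← integral_add
    (integrableOn_cell (by fun_prop) t) (integrableOn_cell (by fun_prop) t)]
  have hd : ∀ x v, fderiv ℝ (fun x => f x ^ 2) x v = 2 * f x * fderiv ℝ f x v := fun x v => by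
    have := ((hf.differentiable one_ne_zero x).hasFDerivAt).pow 2
    rw [this.fderiv]
    simp
  refine setIntegral_mono_on (integrableOn_cell ?_ t) (integrableOn_cell (by fun_prop) t)
    (isCompact_cell t).measurableSet fun x hx => ?_
  · simp only [hd]; fun_prop
  · rw [hd]
    have h1 : |fderiv ℝ f x (x - a)| ≤ ‖fderiv ℝ f x‖ * diamCell t := by
      refine ((fderiv ℝ f x).le_opNorm _).trans ?_
      rw [← dist_eq_norm]
      exact mul_le_mul_of_nonneg_left (dist_le_diamCell t hx (mem_cell_of_mem ha)) (norm_nonneg _)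
    have h2 : (fderiv ℝ f x (x - a)) ^ 2 ≤ (‖fderiv ℝ f x‖ * diamCell t) ^ 2 := by
      rw [← sq_abs]; exact pow_le_pow_left₀ (abs_nonneg _) h1 2
    -- Writing `d` for the radial derivative, `2 f d ≤ f² + d²` turns the coefficient `3` into `4`.
    nlinarith [sq_nonneg (f x - fderiv ℝ f x (x - a))]

/-! ### Square integrable functions -/

section SquareIntegrable

variable {X : Type*} [MeasurableSpace X] {μ : Measure X} {F : Type*} [NormedAddCommGroup F]
  [InnerProductSpace ℝ F] {f g : X → F}

theorem integral_inner_eq_inner_toLp (hf : MemLp f 2 μ) (hg : MemLp g 2 μ) :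
    ∫ x, ⟪f x, g x⟫_ℝ ∂μ = ⟪hf.toLp f, hg.toLp g⟫_ℝ := by
  rw [L2.inner_def]
  refine integral_congr_ae ?_
  filter_upwards [hf.coeFn_toLp, hg.coeFn_toLp] with x h1 h2
  rw [h1, h2]

theorem norm_toLp_eq_sqrt (hf : MemLp f 2 μ) : ‖hf.toLp f‖ = √(∫ x, ‖f x‖ ^ 2 ∂μ) := by
  have h := integral_inner_eq_inner_toLp hf hf
  simp only [real_inner_self_eq_norm_sq] at h
  rw [h, Real.sqrt_sq (norm_nonneg _)]

theorem eLpNorm_two_eq (hf : MemLp f 2 μ) :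
    eLpNorm f 2 μ = ENNReal.ofReal √(∫ x, ‖f x‖ ^ 2 ∂μ) := by
  rw [← norm_toLp_eq_sqrt hf, Lp.norm_toLp, ENNReal.ofReal_toReal hf.eLpNorm_ne_top]

theorem integrable_inner_of_memLp (hf : MemLp f 2 μ) (hg : MemLp g 2 μ) :
    Integrable (fun x => ⟪f x, g x⟫_ℝ) μ := by
  refine (L2.integrable_inner (𝕜 := ℝ) (hf.toLp f) (hg.toLp g)).congr ?_
  filter_upwards [hf.coeFn_toLp, hg.coeFn_toLp] with x h1 h2
  rw [h1, h2]

theorem abs_integral_inner_le (hf : MemLp f 2 μ) (hg : MemLp g 2 μ) :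
    |∫ x, ⟪f x, g x⟫_ℝ ∂μ| ≤ √(∫ x, ‖f x‖ ^ 2 ∂μ) * √(∫ x, ‖g x‖ ^ 2 ∂μ) := by
  rw [integral_inner_eq_inner_toLp hf hg, ← norm_toLp_eq_sqrt hf, ← norm_toLp_eq_sqrt hg]
  exact abs_real_inner_le_norm _ _

theorem abs_integral_mul_le {f g : X → ℝ} (hf : MemLp f 2 μ) (hg : MemLp g 2 μ) :
    |∫ x, f x * g x ∂μ| ≤ √(∫ x, f x ^ 2 ∂μ) * √(∫ x, g x ^ 2 ∂μ) := by
  have := abs_integral_inner_le hg hf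
  simpa [mul_comm] using this

theorem sqrt_integral_norm_sub_le (hf : MemLp f 2 μ) (hg : MemLp g 2 μ) :
    √(∫ x, ‖f x‖ ^ 2 ∂μ) ≤ √(∫ x, ‖g x‖ ^ 2 ∂μ) + √(∫ x, ‖f x - g x‖ ^ 2 ∂μ) := by
  have h := norm_toLp_eq_sqrt (hf.sub hg)
  simp only [Pi.sub_apply] at h
  rw [← norm_toLp_eq_sqrt hf, ← norm_toLp_eq_sqrt hg, ← h, MemLp.toLp_sub, add_comm]
  exact norm_le_norm_sub_add _ _

theorem integrable_mul_of_memLp {f g : X → ℝ} (hf : MemLp f 2 μ) (hg : MemLp g 2 μ) :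
    Integrable (fun x => f x * g x) μ := by
  have := integrable_inner_of_memLp hg hf
  simpa [mul_comm] using this

end SquareIntegrable

/-! ### Weak gradients -/

variable {Ω U : Set E3} {v : E3 → ℝ} {g : E3 → E3}

theorem IsTestFunction.mono (hU : U ⊆ Ω) {φ : E3 → ℝ} (h : IsTestFunction U φ) :
    IsTestFunction Ω φ := ⟨h.smooth, h.compact, h.support.trans hU⟩

theorem IsTestFunction.fderiv_eq_zero {φ : E3 → ℝ} (h : IsTestFunction Ω φ) {x : E3} (hx : x ∉ Ω) :
    fderiv ℝ φ x = 0 := by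
  have : x ∉ tsupport (fderiv ℝ φ) := fun h' => hx (h.support (tsupport_fderiv_subset ℝ h'))
  exact image_eq_zero_of_notMem_tsupport this

theorem IsTestFunction.eq_zero {φ : E3 → ℝ} (h : IsTestFunction Ω φ) {x : E3} (hx : x ∉ Ω) :
    φ x = 0 := image_eq_zero_of_notMem_tsupport fun h' => hx (h.support h')

theorem IsTestFunction.memLp {φ : E3 → ℝ} (h : IsTestFunction Ω φ) (μ : Measure E3)
    [IsFiniteMeasureOnCompacts μ] : MemLp φ 2 μ :=
  h.smooth.continuous.memLp_of_hasCompactSupport h.compact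

theorem IsTestFunction.continuous_fderiv {φ : E3 → ℝ} (h : IsTestFunction Ω φ) :
    Continuous (fderiv ℝ φ) := h.smooth.continuous_fderiv (by simp)

theorem IsTestFunction.memLp_fderiv {φ : E3 → ℝ} (h : IsTestFunction Ω φ) (μ : Measure E3)
    [IsFiniteMeasureOnCompacts μ] (y : E3) : MemLp (fun x => fderiv ℝ φ x y) 2 μ := by
  refine Continuous.memLp_of_hasCompactSupport (h.continuous_fderiv.clm_apply continuous_const) ?_
  exact (h.compact.fderiv ℝ).comp_left (g := fun L : E3 →L[ℝ] ℝ => L y) (by simp)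

theorem continuous_gradient {p : E3 → ℝ} (hp : ContDiff ℝ 1 p) : Continuous (gradient p) := by
  unfold gradient
  exact (LinearIsometryEquiv.continuous _).comp (hp.continuous_fderiv one_ne_zero)

theorem inner_gradient {p : E3 → ℝ} (x y : E3) : ⟪gradient p x, y⟫_ℝ = fderiv ℝ p x y :=
  inner_gradient_left ..

theorem norm_gradient {p : E3 → ℝ} (x : E3) : ‖gradient p x‖ = ‖fderiv ℝ p x‖ := by
  unfold gradient
  exact LinearIsometryEquiv.norm_map _ _

theorem IsTestFunction.memLp_gradient {φ : E3 → ℝ} (h : IsTestFunction Ω φ) (μ : Measure E3)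
    [IsFiniteMeasureOnCompacts μ] : MemLp (gradient φ) 2 μ := by
  refine Continuous.memLp_of_hasCompactSupport
    (continuous_gradient (h.smooth.of_le (by simp))) ?_
  unfold gradient
  exact (h.compact.fderiv ℝ).comp_left (map_zero _)

/-- The fundamental lemma of the calculus of variations for the vector-valued difference, read
through inner products with constant vectors, which is how weak gradients are tested. -/
theorem ae_eq_of_inner_test {g₁ g₂ : E3 → E3} (hU : IsOpen U) (h₁ : LocallyIntegrableOn g₁ U)
    (h₂ : LocallyIntegrableOn g₂ U) (h : ∀ φ, IsTestFunction U φ → ∀ y : E3,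
      ∫ x in U, ⟪g₁ x, y⟫_ℝ * φ x = ∫ x in U, ⟪g₂ x, y⟫_ℝ * φ x) :
    g₁ =ᵐ[volume.restrict U] g₂ := by
  have hli : LocallyIntegrableOn (fun x => g₁ x - g₂ x) U := h₁.sub h₂
  have key : ∀ᵐ x, x ∈ U → g₁ x - g₂ x = 0 := by
    refine hU.ae_eq_zero_of_integral_contDiff_smul_eq_zero hli fun φ hφ1 hφ2 hφ3 => ?_
    have hφ : IsTestFunction U φ := ⟨hφ1, hφ2, hφ3⟩
    have hcs : ∀ {g : E3 → E3}, LocallyIntegrableOn g U → IntegrableOn (fun x => φ x • g x) U :=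
      fun {g} hg => by
        have h1 : IntegrableOn (fun x => φ x • g x) (tsupport φ) :=
          (hg.integrableOn_compact_subset hφ3 hφ2).continuousOn_smul
            hφ1.continuous.continuousOn hφ2
        refine (integrableOn_iff_integrable_of_support_subset ?_).1 h1 |>.integrableOn
        exact (Function.support_smul_subset_left _ _).trans (subset_tsupport φ)
    have hsupp : ∫ x, φ x • (g₁ x - g₂ x) = ∫ x in U, φ x • (g₁ x - g₂ x) := by
      refine (setIntegral_eq_integral_of_forall_compl_eq_zero fun x hx => ?_).symm
      rw [hφ.eq_zero hx, zero_smul]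
    rw [hsupp]
    refine ext_inner_right ℝ fun y => ?_
    rw [inner_zero_left, real_inner_comm, ← integral_inner
      ((hcs h₁).sub (hcs h₂) |>.congr (Filter.Eventually.of_forall fun x => by
        simp [smul_sub]))]
    have e : ∀ x, ⟪y, φ x • (g₁ x - g₂ x)⟫_ℝ = ⟪g₁ x, y⟫_ℝ * φ x - ⟪g₂ x, y⟫_ℝ * φ x := fun x => by
      rw [real_inner_smul_right, inner_sub_right, real_inner_comm y, real_inner_comm y]; ring
    have hin : ∀ {g : E3 → E3}, LocallyIntegrableOn g U →
        IntegrableOn (fun x => ⟪g x, y⟫_ℝ * φ x) U := fun {g} hg => by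
      refine ((hcs hg).inner_const y).congr (Filter.Eventually.of_forall fun x => ?_)
      simp only [real_inner_smul_left]; ring
    simp only [e]
    rw [integral_sub (hin h₁) (hin h₂), h φ hφ y, sub_self]
  filter_upwards [(ae_restrict_iff' hU.measurableSet).2 key] with x hx
  exact sub_eq_zero.1 hx

theorem MemLp.locallyIntegrableOn_of_subset (hg : MemLp g 2 (volume.restrict Ω)) (hU : U ⊆ Ω) :
    LocallyIntegrableOn g U := by
  have h1 : LocallyIntegrable g (volume.restrict Ω) := hg.locallyIntegrable (by norm_num)
  intro x hx
  obtain ⟨s, hs, hi⟩ := h1 x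
  refine ⟨s ∩ U, Filter.inter_mem (mem_nhdsWithin_of_mem_nhds hs) self_mem_nhdsWithin, ?_⟩
  rw [IntegrableOn] at hi ⊢
  refine hi.mono_measure ?_
  rw [← Measure.restrict_restrict_of_subset (μ := volume) (s := s ∩ U) (t := Ω)
    (inter_subset_right.trans hU)]
  exact Measure.restrict_mono inter_subset_left le_rfl

theorem IsWeakGradient.ae_unique (hΩ : IsOpen Ω) {g₁ g₂ : E3 → E3} (h₁ : IsWeakGradient Ω v g₁)
    (h₂ : IsWeakGradient Ω v g₂) : g₁ =ᵐ[volume.restrict Ω] g₂ := by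
  refine ae_eq_of_inner_test hΩ (MemLp.locallyIntegrableOn_of_subset h₁.memLp_grad subset_rfl)
    (MemLp.locallyIntegrableOn_of_subset h₂.memLp_grad subset_rfl) fun φ hφ y => ?_
  have e1 := h₁.integral_eq φ hφ y
  have e2 := h₂.integral_eq φ hφ y
  linarith

/-- A weak gradient is the classical gradient where the function is smooth. -/
theorem IsWeakGradient.ae_eq_gradient (hU : IsOpen U) (hUΩ : U ⊆ Ω) (h : IsWeakGradient Ω v g)
    {p : E3 → ℝ} (hp : ContDiff ℝ 1 p) (hv : ∀ x ∈ U, v x = p x) :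
    g =ᵐ[volume.restrict U] gradient p := by
  have hpg := continuous_gradient hp
  refine ae_eq_of_inner_test hU (MemLp.locallyIntegrableOn_of_subset h.memLp_grad hUΩ)
    (hpg.locallyIntegrable.locallyIntegrableOn U) fun φ hφ y => ?_
  have hext : ∀ q : E3 → E3, ∫ x in U, ⟪q x, y⟫_ℝ * φ x = ∫ x in Ω, ⟪q x, y⟫_ℝ * φ x := fun q => by
    rw [setIntegral_eq_integral_of_forall_compl_eq_zero (s := U) fun x hx => by
      rw [hφ.eq_zero hx, mul_zero], setIntegral_eq_integral_of_forall_compl_eq_zero (s := Ω)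
        fun x hx => by rw [(hφ.mono hUΩ).eq_zero hx, mul_zero]]
  have e1 := h.integral_eq φ (hφ.mono hUΩ) y
  have e2 : ∫ x in Ω, v x * fderiv ℝ φ x y = ∫ x, p x * fderiv ℝ φ x y := by
    rw [← setIntegral_eq_integral_of_forall_compl_eq_zero (s := Ω) (f := fun x => p x * fderiv ℝ φ x y)
      fun x hx => by rw [(hφ.mono hUΩ).fderiv_eq_zero hx]; simp]
    refine integral_congr_ae (Filter.Eventually.of_forall fun x => ?_)
    by_cases hx : x ∈ U
    · simp only [hv x hx]
    · simp [hφ.fderiv_eq_zero hx]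
  have hdφ : HasCompactSupport fun x => fderiv ℝ φ x y :=
    (hφ.compact.fderiv ℝ).comp_left (g := fun L : E3 →L[ℝ] ℝ => L y) (by simp)
  have hφc := hφ.smooth.continuous
  have hφd := hφ.continuous_fderiv
  have hpc := hp.continuous
  have hpd := hp.continuous_fderiv one_ne_zero
  have e3 := integral_mul_fderiv_eq_neg_fderiv_mul_of_integrable (μ := (volume : Measure E3))
    (f := p) (g := φ) (v := y)
    (Continuous.integrable_of_hasCompactSupport (by fun_prop) (hφ.compact.mul_left))
    (Continuous.integrable_of_hasCompactSupport (by fun_prop) (hdφ.mul_left))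
    (Continuous.integrable_of_hasCompactSupport (by fun_prop) (hφ.compact.mul_left))
    (fun x _ => hp.differentiable one_ne_zero x) (fun x _ => hφ.smooth.differentiable (by simp) x)
  have e4 : ∫ x in U, ⟪gradient p x, y⟫_ℝ * φ x = ∫ x, fderiv ℝ p x y * φ x := by
    rw [setIntegral_eq_integral_of_forall_compl_eq_zero (s := U) fun x hx => by
      rw [hφ.eq_zero hx, mul_zero]]
    simp only [inner_gradient]
  rw [hext g, e4]
  linarith

theorem IsTestFunction.isWeakGradient {φ : E3 → ℝ} (h : IsTestFunction Ω φ) :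
    IsWeakGradient Ω φ (gradient φ) := by
  refine ⟨h.memLp _, h.memLp_gradient _, fun ψ hψ y => ?_⟩
  rw [setIntegral_eq_integral_of_forall_compl_eq_zero (s := Ω) fun x hx => by
      rw [h.eq_zero hx, zero_mul], setIntegral_eq_integral_of_forall_compl_eq_zero (s := Ω)
        fun x hx => by rw [hψ.eq_zero hx, mul_zero]]
  simp only [inner_gradient]
  have hdψ : HasCompactSupport fun x => fderiv ℝ ψ x y :=
    (hψ.compact.fderiv ℝ).comp_left (g := fun L : E3 →L[ℝ] ℝ => L y) (by simp)
  have := h.smooth.continuous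
  have := hψ.smooth.continuous
  have := h.continuous_fderiv
  have := hψ.continuous_fderiv
  exact integral_mul_fderiv_eq_neg_fderiv_mul_of_integrable (μ := (volume : Measure E3))
    (Continuous.integrable_of_hasCompactSupport (by fun_prop) (hψ.compact.mul_left))
    (Continuous.integrable_of_hasCompactSupport (by fun_prop) (hdψ.mul_left))
    (Continuous.integrable_of_hasCompactSupport (by fun_prop) (hψ.compact.mul_left))
    (fun x _ => h.smooth.differentiable (by simp) x) (fun x _ => hψ.smooth.differentiable (by simp) x)

/-- Limits of test functions have weak gradients. -/
theorem isWeakGradient_of_approx (hv : MemLp v 2 (volume.restrict Ω))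
    (hg : MemLp g 2 (volume.restrict Ω)) (happ : ∀ ε : ℝ, 0 < ε → ∃ φ, IsTestFunction Ω φ ∧
      eLpNorm (fun x => v x - φ x) 2 (volume.restrict Ω) ≤ ENNReal.ofReal ε ∧
      eLpNorm (fun x => g x - gradient φ x) 2 (volume.restrict Ω) ≤ ENNReal.ofReal ε) :
    IsWeakGradient Ω v g := by
  refine ⟨hv, hg, fun ψ hψ y => ?_⟩
  have hψ1 := hψ.memLp_fderiv (volume.restrict Ω) y
  have hψ2 : MemLp (fun x => ψ x • y) 2 (volume.restrict Ω) := by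
    refine Continuous.memLp_of_hasCompactSupport (hψ.smooth.continuous.smul continuous_const) ?_
    exact hψ.compact.smul_right
  set A := √(∫ x in Ω, (fderiv ℝ ψ x y) ^ 2) with hA
  set B := √(∫ x in Ω, ‖ψ x • y‖ ^ 2) with hB
  have hin : ∀ (q : E3 → E3) x, ⟪q x, y⟫_ℝ * ψ x = ⟪q x, ψ x • y⟫_ℝ := fun q x => by
    rw [real_inner_smul_right, mul_comm]
  have key : ∀ ε : ℝ, 0 < ε →
      |(∫ x in Ω, v x * fderiv ℝ ψ x y) + ∫ x in Ω, ⟪g x, y⟫_ℝ * ψ x| ≤ ε * (A + B) := by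
    intro ε hε
    obtain ⟨φ, hφ, h1, h2⟩ := happ ε hε
    have hφL := hφ.memLp (volume.restrict Ω)
    have hφG := hφ.memLp_gradient (volume.restrict Ω)
    have hs1 : MemLp (fun x => v x - φ x) 2 (volume.restrict Ω) := hv.sub hφL
    have hs2 : MemLp (fun x => g x - gradient φ x) 2 (volume.restrict Ω) := hg.sub hφG
    rw [eLpNorm_two_eq hs1, ENNReal.ofReal_le_ofReal_iff hε.le] at h1
    rw [eLpNorm_two_eq hs2, ENNReal.ofReal_le_ofReal_iff hε.le] at h2
    have h0 := hφ.isWeakGradient.integral_eq ψ hψ y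
    have e1 : ∫ x in Ω, (v x - φ x) * fderiv ℝ ψ x y =
        (∫ x in Ω, v x * fderiv ℝ ψ x y) - ∫ x in Ω, φ x * fderiv ℝ ψ x y := by
      rw [← integral_sub (integrable_mul_of_memLp hv hψ1) (integrable_mul_of_memLp hφL hψ1)]
      simp only [sub_mul]
    have e2 : ∫ x in Ω, ⟪g x - gradient φ x, ψ x • y⟫_ℝ =
        (∫ x in Ω, ⟪g x, y⟫_ℝ * ψ x) - ∫ x in Ω, ⟪gradient φ x, y⟫_ℝ * ψ x := by
      simp only [hin, inner_sub_left]
      exact integral_sub (integrable_inner_of_memLp hg hψ2) (integrable_inner_of_memLp hφG hψ2)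
    have e3 := abs_integral_mul_le hs1 hψ1
    have e4 := abs_integral_inner_le hs2 hψ2
    rw [e1, ← hA] at e3
    rw [e2, ← hB] at e4
    simp only [Real.norm_eq_abs, sq_abs] at h1
    have hA0 : 0 ≤ A := Real.sqrt_nonneg _
    have hB0 : 0 ≤ B := Real.sqrt_nonneg _
    have e5 := e3.trans (mul_le_mul_of_nonneg_right h1 hA0)
    have e6 := e4.trans (mul_le_mul_of_nonneg_right h2 hB0)
    rw [h0] at e5
    have := abs_add_le ((∫ x in Ω, v x * fderiv ℝ ψ x y) - -∫ x in Ω, ⟪gradient φ x, y⟫_ℝ * ψ x)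
      ((∫ x in Ω, ⟪g x, y⟫_ℝ * ψ x) - ∫ x in Ω, ⟪gradient φ x, y⟫_ℝ * ψ x)
    refine le_trans (le_of_eq ?_) (this.trans (by linarith))
    congr 1; ring
  have h0 : (∫ x in Ω, v x * fderiv ℝ ψ x y) + ∫ x in Ω, ⟪g x, y⟫_ℝ * ψ x = 0 := by
    rw [← abs_nonpos_iff]
    have hlim : Filter.Tendsto (fun ε : ℝ => ε * (A + B)) (𝓝[>] 0) (𝓝 0) := by
      have : Continuous fun ε : ℝ => ε * (A + B) := by fun_prop
      simpa using (this.tendsto 0).mono_left (nhdsWithin_le_nhds (s := Ioi 0))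
    refine ge_of_tendsto hlim ?_
    filter_upwards [self_mem_nhdsWithin] with ε hε using key ε hε
  linarith

theorem weakGrad_ae_eq (hΩ : IsOpen Ω) (h : IsWeakGradient Ω v g) :
    weakGrad Ω v =ᵐ[volume.restrict Ω] g :=
  (weakGrad_spec ⟨g, h⟩).ae_unique hΩ h

/-- `MemH10` speaks of the chosen `weakGrad`. Limits of gradients of test functions are weak
gradients, and these are unique almost everywhere, so any candidate `g` will do. -/
theorem memH10_of_approx (hΩ : IsOpen Ω) (hv : MemLp v 2 (volume.restrict Ω))
    (hg : MemLp g 2 (volume.restrict Ω)) (happ : ∀ ε : ℝ, 0 < ε → ∃ φ, IsTestFunction Ω φ ∧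
      eLpNorm (fun x => v x - φ x) 2 (volume.restrict Ω) ≤ ENNReal.ofReal ε ∧
      eLpNorm (fun x => g x - gradient φ x) 2 (volume.restrict Ω) ≤ ENNReal.ofReal ε) :
    MemH10 Ω v := by
  have hw := isWeakGradient_of_approx hv hg happ
  refine ⟨⟨g, hw⟩, fun ε hε => ?_⟩
  obtain ⟨φ, hφ, h1, h2⟩ := happ ε hε
  refine ⟨φ, hφ, h1, le_of_eq_of_le (eLpNorm_congr_ae ?_) h2⟩
  filter_upwards [weakGrad_ae_eq hΩ hw] with x hx
  rw [hx]

theorem MemH10.isWeakGradient (h : MemH10 Ω v) : IsWeakGradient Ω v (weakGrad Ω v) :=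
  weakGrad_spec h.1

theorem IsTestFunction.memH10 (hΩ : IsOpen Ω) {φ : E3 → ℝ} (h : IsTestFunction Ω φ) :
    MemH10 Ω φ :=
  memH10_of_approx hΩ (h.memLp _) (h.memLp_gradient _) fun _ _ =>
    ⟨φ, h, by simp, by simp⟩

/-! ### Linear combinations in `H¹₀` -/

theorem gradient_add_const_mul {φ ψ : E3 → ℝ} (hφ : Differentiable ℝ φ) (hψ : Differentiable ℝ ψ)
    (c : ℝ) (x : E3) :
    gradient (fun x => φ x + c * ψ x) x = gradient φ x + c • gradient ψ x := by
  refine ext_inner_right ℝ fun y => ?_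
  rw [inner_add_left, real_inner_smul_left, inner_gradient, inner_gradient, inner_gradient,
    ((hφ x).hasFDerivAt.fun_add ((hψ x).hasFDerivAt.const_mul c)).fderiv]
  simp

theorem IsTestFunction.add_const_mul {φ ψ : E3 → ℝ} (hφ : IsTestFunction Ω φ)
    (hψ : IsTestFunction Ω ψ) (c : ℝ) : IsTestFunction Ω fun x => φ x + c * ψ x := by
  refine ⟨hφ.smooth.add (contDiff_const.mul hψ.smooth), hφ.compact.add hψ.compact.mul_left, ?_⟩
  refine (tsupport_add φ fun x => c * ψ x).trans (union_subset hφ.support ?_)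
  exact (closure_mono (Function.support_mul_subset_right _ _)).trans hψ.support

theorem MemH10.add_const_mul (hΩ : IsOpen Ω) {u v : E3 → ℝ} (hu : MemH10 Ω u) (hv : MemH10 Ω v)
    (c : ℝ) : MemH10 Ω fun x => u x + c * v x := by
  have hu' := hu.isWeakGradient
  have hv' := hv.isWeakGradient
  refine memH10_of_approx hΩ (g := fun x => weakGrad Ω u x + c • weakGrad Ω v x)
    (hu'.memLp.add (hv'.memLp.const_mul c)) (hu'.memLp_grad.add (hv'.memLp_grad.const_smul c))
    fun ε hε => ?_
  obtain ⟨φ, hφ, h1, h2⟩ := hu.2 (ε / 2) (by positivity)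
  obtain ⟨ψ, hψ, h3, h4⟩ := hv.2 (ε / (2 * (|c| + 1))) (by positivity)
  have hc : ‖c‖ₑ * ENNReal.ofReal (ε / (2 * (|c| + 1))) ≤ ENNReal.ofReal (ε / 2) := by
    rw [← ofReal_norm, ← ENNReal.ofReal_mul (norm_nonneg _), Real.norm_eq_abs]
    refine ENNReal.ofReal_le_ofReal ?_
    rw [← mul_div_assoc, div_le_div_iff₀ (by positivity) (by positivity)]
    nlinarith [abs_nonneg c]
  have hsum : ENNReal.ofReal (ε / 2) + ENNReal.ofReal (ε / 2) = ENNReal.ofReal ε := by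
    rw [← ENNReal.ofReal_add (by positivity) (by positivity), add_halves]
  refine ⟨_, hφ.add_const_mul hψ c, ?_, ?_⟩
  · have e : (fun x => u x + c * v x - (φ x + c * ψ x)) =
        (fun x => u x - φ x) + c • fun x => v x - ψ x := by
      funext x; simp; ring
    rw [e, ← hsum]
    refine (eLpNorm_add_le (hu'.memLp.sub (hφ.memLp _)).1
      ((hv'.memLp.sub (hψ.memLp _)).const_smul c).1 (by norm_num)).trans (add_le_add h1 ?_)
    rw [eLpNorm_const_smul]
    exact (mul_le_mul_right h3 _).trans hc
  · have e : (fun x => weakGrad Ω u x + c • weakGrad Ω v x - gradient (fun x => φ x + c * ψ x) x) =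
        (fun x => weakGrad Ω u x - gradient φ x) + c • fun x => weakGrad Ω v x - gradient ψ x := by
      funext x
      rw [gradient_add_const_mul (hφ.smooth.differentiable (by simp))
        (hψ.smooth.differentiable (by simp))]
      simp [smul_sub]
      abel
    rw [e, ← hsum]
    refine (eLpNorm_add_le (hu'.memLp_grad.sub (hφ.memLp_gradient _)).1
      ((hv'.memLp_grad.sub (hψ.memLp_gradient _)).const_smul c).1 (by norm_num)).trans
      (add_le_add h2 ?_)
    rw [eLpNorm_const_smul]
    exact (mul_le_mul_right h4 _).trans hc

theorem memH10_zero (hΩ : IsOpen Ω) : MemH10 Ω fun _ => (0 : ℝ) :=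
  IsTestFunction.memH10 hΩ ⟨contDiff_const, HasCompactSupport.zero, by simp [tsupport]⟩

theorem memH10_sum (hΩ : IsOpen Ω) {ι : Type*} (s : Finset ι) (c : ι → ℝ) (f : ι → E3 → ℝ)
    (hf : ∀ i ∈ s, MemH10 Ω (f i)) : MemH10 Ω fun x => ∑ i ∈ s, c i * f i x := by
  classical
  induction s using Finset.induction_on with
  | empty => simpa using memH10_zero hΩ
  | insert i s hi ih =>
    have h1 := (ih fun j hj => hf j (Finset.mem_insert_of_mem hj)).add_const_mul hΩ
      (hf i (Finset.mem_insert_self i s)) (c i)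
    convert h1 using 2 with x
    rw [Finset.sum_insert hi, add_comm]

/-! ### Mollification -/

/-- Continuous induction along the segment. Just beyond each parameter, one of the finitely many
pieces occurs arbitrarily close; being closed, it also contains the current point, and the bound
extends with the same constant. -/
theorem dist_le_of_finite_closed_cover {ι : Type*} [Finite ι] {C : ι → Set E3} {g : E3 → ℝ} {L : ℝ}
    (hg : Continuous g) (hC : ∀ i, IsClosed (C i)) (hcov : ∀ x, ∃ i, x ∈ C i)
    (hL : ∀ i, ∀ x ∈ C i, ∀ y ∈ C i, |g x - g y| ≤ L * dist x y) (x y : E3) :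
    |g x - g y| ≤ L * dist x y := by
  have hlc : Continuous fun s : ℝ => (AffineMap.lineMap x y s : E3) := AffineMap.lineMap_continuous
  set h : ℝ → ℝ := fun r => g (AffineMap.lineMap x y r) with hh
  have hhc : Continuous h := hg.comp hlc
  have h1 : (1 : ℝ) ∈ {r : ℝ | |h r - h 0| ≤ L * dist x y * r} := by
    refine IsClosed.mem_of_ge_of_forall_exists_gt (a := (0 : ℝ))
      ((isClosed_le (by fun_prop) (by fun_prop)).inter isClosed_Icc) ?_ zero_le_one ?_
    · change |h 0 - h 0| ≤ L * dist x y * 0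
      simp
    · rintro r ⟨hr, hr0, hr1⟩
      have hr' : |h r - h 0| ≤ L * dist x y * r := hr
      obtain ⟨i, hi⟩ : ∃ i, ∃ᶠ s in 𝓝[>] r, (AffineMap.lineMap x y s : E3) ∈ C i := by
        by_contra hcon
        push Not at hcon
        have := Filter.eventually_all.2 hcon
        obtain ⟨s, hs⟩ := this.exists
        obtain ⟨i, hi⟩ := hcov (AffineMap.lineMap x y s)
        exact hs i hi
      have hri : (AffineMap.lineMap x y r : E3) ∈ C i := by
        by_contra hcon
        have hev : ∀ᶠ s in 𝓝[>] r, (AffineMap.lineMap x y s : E3) ∉ C i :=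
          ((hlc.tendsto r).mono_left nhdsWithin_le_nhds).eventually
            ((hC i).isOpen_compl.mem_nhds hcon)
        exact hi hev
      obtain ⟨s, hs1, hs2⟩ := (hi.and_eventually (Ioc_mem_nhdsGT hr1)).exists
      refine ⟨s, ?_, hs2⟩
      change |h s - h 0| ≤ L * dist x y * s
      have e1 := hL i _ hs1 _ hri
      have e2 : dist (AffineMap.lineMap x y s : E3) (AffineMap.lineMap x y r) = (s - r) * dist x y := by
        rw [dist_lineMap_lineMap, Real.dist_eq, abs_of_pos (by linarith [hs2.1])]
      rw [e2] at e1
      have e3 : |h s - h 0| ≤ |h s - h r| + |h r - h 0| := abs_sub_le _ _ _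
      have e4 : |h s - h r| ≤ L * ((s - r) * dist x y) := e1
      nlinarith
  have h1' : |h 1 - h 0| ≤ L * dist x y * 1 := h1
  rw [hh] at h1'
  simp only [AffineMap.lineMap_apply_one, AffineMap.lineMap_apply_zero, mul_one] at h1'
  rwa [abs_sub_comm]

/-- Mollification of `g` at scale `δ`. -/
def mollify (δ : ℝ) (g : E3 → ℝ) : E3 → ℝ :=
  if h : 0 < δ then
    convolution ((⟨δ / 2, δ, by positivity, by linarith⟩ : ContDiffBump (0 : E3)).normed volume) g
      (ContinuousLinearMap.lsmul ℝ ℝ) volume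
  else g

/-- All that is used of the kernel, so that the bump function stays hidden from here on. -/
theorem mollify_spec {δ : ℝ} (hδ : 0 < δ) : ∃ η : E3 → ℝ, ContDiff ℝ ∞ η ∧ HasCompactSupport η ∧
    (∀ x, 0 ≤ η x) ∧ ∫ x, η x = 1 ∧ (∀ x, δ ≤ ‖x‖ → η x = 0) ∧
    ∀ g : E3 → ℝ, mollify δ g = convolution η g (ContinuousLinearMap.lsmul ℝ ℝ) volume := by
  set B : ContDiffBump (0 : E3) := ⟨δ / 2, δ, by positivity, by linarith⟩ with hB
  refine ⟨B.normed volume, B.contDiff_normed, B.hasCompactSupport_normed, B.nonneg_normed,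
    B.integral_normed, fun x hx => ?_, fun g => by rw [mollify, dif_pos hδ]⟩
  have : x ∉ Function.support (B.normed volume) := by
    rw [B.support_normed_eq]
    simpa [hB] using hx
  simpa using this

theorem contDiff_mollify {δ : ℝ} (hδ : 0 < δ) {g : E3 → ℝ} (hg : Continuous g) :
    ContDiff ℝ ∞ (mollify δ g) := by
  obtain ⟨η, h1, h2, -, -, -, h6⟩ := mollify_spec hδ
  rw [h6]
  exact h2.contDiff_convolution_left _ h1 hg.locallyIntegrable

theorem integrable_bump_mul {η g : E3 → ℝ} (hη : Continuous η) (hηc : HasCompactSupport η)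
    (hg : Continuous g) : Integrable fun t => η t * g t :=
  Continuous.integrable_of_hasCompactSupport (by fun_prop) hηc.mul_right

/-- The mollified value is an average of `g` over a ball of radius `δ`. With `c = C = 0` this also
locates the support of the mollification. -/
theorem abs_mollify_sub_le {δ : ℝ} (hδ : 0 < δ) {g : E3 → ℝ} (hg : Continuous g) {x : E3} {c C : ℝ}
    (h : ∀ y, dist y x < δ → |g y - c| ≤ C) : |mollify δ g x - c| ≤ C := by
  obtain ⟨η, h1, h2, h3, h4, h5, h6⟩ := mollify_spec hδ
  have hηc := h1.continuous
  have e1 : mollify δ g x - c = ∫ t, η t * (g (x - t) - c) := by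
    simp only [mul_sub]
    rw [integral_sub (integrable_bump_mul hηc h2 (by fun_prop))
      (integrable_bump_mul hηc h2 continuous_const), integral_mul_const, h4, one_mul, h6, convolution]
    simp
  rw [e1, ← Real.norm_eq_abs]
  calc ‖∫ t, η t * (g (x - t) - c)‖ ≤ ∫ t, η t * C := by
        refine norm_integral_le_of_norm_le (integrable_bump_mul hηc h2 continuous_const)
          (Filter.Eventually.of_forall fun t => ?_)
        rcases lt_or_ge ‖t‖ δ with ht | ht
        · rw [norm_mul, Real.norm_of_nonneg (h3 t)]
          refine mul_le_mul_of_nonneg_left (h _ ?_) (h3 t)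
          rw [dist_eq_norm, sub_sub_cancel_left, norm_neg]
          exact ht
        · simp [h5 t ht]
    _ = C := by rw [integral_mul_const, h4, one_mul]

theorem abs_mollify_sub_mollify_le {δ : ℝ} (hδ : 0 < δ) {g : E3 → ℝ} (hg : Continuous g) {L : ℝ}
    (hL : ∀ x y, |g x - g y| ≤ L * dist x y) (x y : E3) :
    |mollify δ g x - mollify δ g y| ≤ L * dist x y := by
  obtain ⟨η, h1, h2, h3, h4, h5, h6⟩ := mollify_spec hδ
  have hηc := h1.continuous
  have e1 : mollify δ g x - mollify δ g y = ∫ t, η t * (g (x - t) - g (y - t)) := by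
    simp only [mul_sub]
    rw [integral_sub (integrable_bump_mul hηc h2 (by fun_prop))
      (integrable_bump_mul hηc h2 (by fun_prop)), h6, convolution, convolution]
    simp
  rw [e1, ← Real.norm_eq_abs]
  calc ‖∫ t, η t * (g (x - t) - g (y - t))‖ ≤ ∫ t, η t * (L * dist x y) := by
        refine norm_integral_le_of_norm_le (integrable_bump_mul hηc h2 continuous_const)
          (Filter.Eventually.of_forall fun t => ?_)
        rw [norm_mul, Real.norm_of_nonneg (h3 t)]
        refine mul_le_mul_of_nonneg_left ((hL _ _).trans_eq ?_) (h3 t)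
        rw [dist_sub_right]
    _ = _ := by rw [integral_mul_const, h4, one_mul]

/-- Mollification reproduces affine functions up to a constant. -/
theorem fderiv_mollify_of_affine {δ : ℝ} (hδ : 0 < δ) {g : E3 → ℝ} (A : E3 →L[ℝ] ℝ) {c : ℝ} {x : E3}
    {r : ℝ} (hr : δ < r) (h : ∀ y ∈ Metric.ball x (2 * r), g y = A y + c) :
    fderiv ℝ (mollify δ g) x = A := by
  obtain ⟨η, h1, h2, h3, h4, h5, h6⟩ := mollify_spec hδ
  have hηc := h1.continuous
  have hev : mollify δ g =ᶠ[𝓝 x] fun y => A y + ∫ t, η t * (c - A t) := by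
    filter_upwards [Metric.ball_mem_nhds x (hδ.trans hr)] with y hy
    have e1 : ∀ t, η t * g (y - t) = η t * A y + η t * (c - A t) := fun t => by
      rcases lt_or_ge ‖t‖ δ with ht | ht
      · rw [h (y - t) ?_, map_sub]
        · ring
        · rw [Metric.mem_ball] at hy ⊢
          calc dist (y - t) x ≤ dist (y - t) y + dist y x := dist_triangle _ _ _
            _ = ‖t‖ + dist y x := by rw [dist_eq_norm (y - t), sub_sub_cancel_left, norm_neg]
            _ < 2 * r := by linarith
      · simp [h5 t ht]
    have hA : Continuous A := A.continuous
    calc mollify δ g y = ∫ t, η t * g (y - t) := by rw [h6, convolution]; simp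
      _ = ∫ t, (η t * A y + η t * (c - A t)) := by simp only [e1]
      _ = _ := by
        rw [integral_add (integrable_bump_mul hηc h2 continuous_const)
          (integrable_bump_mul hηc h2 (by fun_prop)), integral_mul_const, h4, one_mul]
  rw [hev.fderiv_eq]
  exact (A.hasFDerivAt.add_const _).fderiv

/-! ### Nodal basis functions -/

namespace TetMesh

variable {Ω : Set E3} (M : TetMesh Ω) {t : Finset E3} {x a : E3}

open Classical in
/-- The nodal basis function of the vertex `a`, extended by zero outside of the mesh. -/
def hat (a x : E3) : ℝ :=
  if h : ∃ t ∈ M.elements, x ∈ cell t then bary h.choose a x else 0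

variable {M}

theorem hat_eq (ht : t ∈ M.elements) (hx : x ∈ cell t) : M.hat a x = bary t a x := by
  have h : ∃ t ∈ M.elements, x ∈ cell t := ⟨t, ht, hx⟩
  rw [hat, dif_pos h]
  exact bary_eq_of_mem h.choose_spec.1 ht h.choose_spec.2 hx a

theorem hat_of_notMem_closure (hx : x ∉ closure Ω) : M.hat a x = 0 := by
  rw [hat, dif_neg fun h => hx (M.mem_closure_iff.2 h)]

theorem hat_nonneg (a x : E3) : 0 ≤ M.hat a x := by
  by_cases hx : x ∈ closure Ω
  · obtain ⟨t, ht, hxt⟩ := M.mem_closure_iff.1 hx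
    rw [hat_eq ht hxt]
    exact (isTet ht).bary_nonneg hxt a
  · rw [hat_of_notMem_closure hx]

theorem mem_of_hat_pos (hΩ : IsPolyhedralDomain Ω) (ha : a ∈ Ω) (hx : 0 < M.hat a x) : x ∈ Ω := by
  by_cases hxc : x ∈ closure Ω
  · obtain ⟨t, ht, hxt⟩ := M.mem_closure_iff.1 hxc
    rw [hat_eq ht hxt] at hx
    exact mem_of_bary_pos_of_mem hΩ ht ha hxt hx
  · rw [hat_of_notMem_closure hxc] at hx
    exact absurd hx (lt_irrefl _)

theorem hat_of_notMem (hΩ : IsPolyhedralDomain Ω) (ha : a ∈ Ω) (hx : x ∉ Ω) : M.hat a x = 0 :=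
  le_antisymm (not_lt.1 fun h => hx (mem_of_hat_pos hΩ ha h)) (hat_nonneg a x)

variable (M) in
/-- The closed cover of space by the elements and the complement of the domain. -/
def cover (i : Option M.elements) : Set E3 := i.elim Ωᶜ fun t => cell t.1

theorem isClosed_cover (hΩ : IsPolyhedralDomain Ω) (i : Option M.elements) : IsClosed (M.cover i) := by
  rcases i with _ | t
  · exact hΩ.isOpen.isClosed_compl
  · exact (isCompact_cell t.1).isClosed

variable (M) in
theorem exists_mem_cover (x : E3) : ∃ i, x ∈ M.cover i := by
  by_cases hx : x ∈ Ω
  · obtain ⟨t, ht, hxt⟩ := M.mem_closure_iff.1 (subset_closure hx)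
    exact ⟨some ⟨t, ht⟩, hxt⟩
  · exact ⟨none, hx⟩

theorem continuous_hat (hΩ : IsPolyhedralDomain Ω) (ha : a ∈ Ω) : Continuous (M.hat a) := by
  refine (locallyFinite_of_finite M.cover).continuous (iUnion_eq_univ_iff.2 M.exists_mem_cover)
    (isClosed_cover hΩ) fun i => ?_
  rcases i with _ | t
  · exact continuousOn_const.congr fun x hx => hat_of_notMem hΩ ha hx
  · exact (continuous_bary t.1 a).continuousOn.congr fun x hx => hat_eq t.2 hx

theorem exists_hat_lipschitz (hΩ : IsPolyhedralDomain Ω) (ha : a ∈ Ω) :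
    ∃ L : ℝ, 0 < L ∧ ∀ x y, |M.hat a x - M.hat a y| ≤ L * dist x y := by
  refine ⟨1 + ∑ t ∈ M.elements, ‖baryLin t a‖, by positivity, ?_⟩
  refine dist_le_of_finite_closed_cover (continuous_hat hΩ ha) (isClosed_cover hΩ)
    M.exists_mem_cover fun i x hx y hy => ?_
  rcases i with _ | t
  · rw [hat_of_notMem hΩ ha hx, hat_of_notMem hΩ ha hy, sub_self, abs_zero]
    positivity
  · rw [hat_eq t.2 hx, hat_eq t.2 hy, bary_sub]
    refine ((baryLin t.1 a).le_opNorm _).trans ?_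
    rw [← dist_eq_norm]
    refine mul_le_mul_of_nonneg_right ?_ dist_nonneg
    have := Finset.single_le_sum (f := fun t => ‖baryLin t a‖) (fun _ _ => norm_nonneg _) t.2
    linarith

theorem volume_diff_interior_cells (hΩ : IsPolyhedralDomain Ω) :
    ∀ᵐ x ∂volume.restrict Ω, ∃ t ∈ M.elements, x ∈ interior (cell t) := by
  rw [ae_restrict_iff' hΩ.isOpen.measurableSet]
  have h : volume (⋃ t ∈ M.elements, cell t \ interior (cell t)) = 0 :=
    (measure_biUnion_null_iff M.elements.countable_toSet).2 fun t _ => volume_cell_diff_interior t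
  filter_upwards [compl_mem_ae_iff.2 h] with x hx hxΩ
  obtain ⟨t, ht, hxt⟩ := M.mem_closure_iff.1 (subset_closure hxΩ)
  refine ⟨t, ht, ?_⟩
  by_contra hcon
  exact hx (mem_biUnion (s := {t | t ∈ M.elements}) ht ⟨hxt, hcon⟩)

theorem baryLin_of_notMem {t : Finset E3} {a : E3} (h : a ∉ t) : baryLin t a = 0 := by
  ext y
  have := bary_sub t a y 0
  rw [bary_of_notMem h, bary_of_notMem h, sub_zero, sub_zero] at this
  rw [← this]; rfl

theorem hasFDerivAt_hat (ht : t ∈ M.elements) (hx : x ∈ interior (cell t)) :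
    HasFDerivAt (M.hat a) (baryLin t a) x := by
  refine (hasFDerivAt_bary t a x).congr_of_eventuallyEq ?_
  filter_upwards [isOpen_interior.mem_nhds hx] with y hy
  exact hat_eq ht (interior_subset hy)

/-- The function `max (hat - ε) 0` lives where the hat is at least `ε`. By the Lipschitz bound `L`,
mollification at scale `ε / (2 L)` keeps the support in the set where the hat is at least `ε / 2`, a
compact part of `Ω`. As `ε → 0` these test functions converge uniformly, their gradients are bounded
by `L`, and inside a cell they eventually equal the gradient of the hat, the truncated function
being affine nearby. Dominated convergence concludes. -/
theorem memH10_hat (hΩ : IsPolyhedralDomain Ω) (ha : a ∈ Ω) : MemH10 Ω (M.hat a) := by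
  obtain ⟨L, hL0, hL⟩ := exists_hat_lipschitz (M := M) hΩ ha
  have hgc := continuous_hat (M := M) hΩ ha
  have hfin : IsFiniteMeasure (volume.restrict Ω) := isFiniteMeasure_restrict.2
    ((measure_mono subset_closure).trans_lt hΩ.isCompact_closure.measure_lt_top).ne
  set g := M.hat a with hg
  -- the approximations
  set ge : ℝ → E3 → ℝ := fun ε x => max (g x - ε) 0 with hge
  have hgec : ∀ ε, Continuous (ge ε) := fun ε => by rw [hge]; fun_prop
  have hgeL : ∀ ε x y, |ge ε x - ge ε y| ≤ L * dist x y := fun ε x y => by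
    refine (abs_max_sub_max_le_abs _ _ _).trans ?_
    rw [sub_sub_sub_cancel_right]
    exact hL x y
  set δ : ℝ → ℝ := fun ε => ε / (2 * L) with hδ
  have hδ0 : ∀ ε, 0 < ε → 0 < δ ε := fun ε hε => by rw [hδ]; positivity
  set Φ : ℝ → E3 → ℝ := fun ε => mollify (δ ε) (ge ε) with hΦ
  have hΦs : ∀ ε, 0 < ε → ContDiff ℝ ∞ (Φ ε) := fun ε hε => contDiff_mollify (hδ0 ε hε) (hgec ε)
  have hLδ : ∀ ε, L * δ ε = ε / 2 := fun ε => by rw [hδ]; field_simp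
  have hΦsupp : ∀ ε, 0 < ε → ∀ x, g x < ε / 2 → Φ ε x = 0 := by
    intro ε hε x hx
    have := abs_mollify_sub_le (hδ0 ε hε) (hgec ε) (x := x) (c := 0) (C := 0) (fun y hy => by
      have h1 := hL y x
      have h2 : L * dist y x < ε / 2 := by
        rw [← hLδ ε]; exact mul_lt_mul_of_pos_left hy hL0
      have h3 := le_abs_self (g y - g x)
      have : ge ε y = 0 := max_eq_right (by linarith)
      rw [this]; simp)
    rw [sub_zero] at this
    exact abs_eq_zero.1 (le_antisymm this (abs_nonneg _))
  have htest : ∀ ε, 0 < ε → IsTestFunction Ω (Φ ε) := by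
    intro ε hε
    have hcl : IsClosed {x | ε / 2 ≤ g x} := isClosed_le continuous_const hgc
    have hsub : tsupport (Φ ε) ⊆ {x | ε / 2 ≤ g x} := by
      refine closure_minimal (fun x hx => ?_) hcl
      by_contra hcon
      exact hx (hΦsupp ε hε x (not_le.1 hcon))
    have hsub2 : {x | ε / 2 ≤ g x} ⊆ Ω := fun x hx => by
      have hx' : ε / 2 ≤ g x := hx
      exact mem_of_hat_pos hΩ ha (lt_of_lt_of_le (by positivity) hx')
    refine ⟨hΦs ε hε, ?_, hsub.trans hsub2⟩
    exact (hΩ.isCompact_closure.of_isClosed_subset hcl (hsub2.trans subset_closure)).of_isClosed_subset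
      (isClosed_tsupport _) hsub
  have hΦg : ∀ ε, 0 < ε → ∀ x, |g x - Φ ε x| ≤ 2 * ε := by
    intro ε hε x
    rw [abs_sub_comm]
    refine abs_mollify_sub_le (hδ0 ε hε) (hgec ε) fun y hy => ?_
    have h1 := hgeL ε y x
    have h2 : L * dist y x ≤ ε / 2 := by
      rw [← hLδ ε]; exact mul_le_mul_of_nonneg_left hy.le hL0.le
    have h3 : |ge ε x - g x| ≤ ε := by
      have h0 := hat_nonneg (M := M) a x
      rw [← hg] at h0
      have h5 : ge ε x = max (g x - ε) 0 := rfl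
      rw [h5, abs_le]
      constructor
      · have := le_max_left (g x - ε) 0; linarith
      · have := max_le (a := g x - ε) (b := 0) (c := g x) (by linarith) h0; linarith
    have h4 := abs_sub_le (ge ε y) (ge ε x) (g x)
    linarith
  have hΦd : ∀ ε, 0 < ε → ∀ x, ‖gradient (Φ ε) x‖ ≤ L := by
    intro ε hε x
    rw [norm_gradient]
    refine norm_fderiv_le_of_lip' ℝ hL0.le (Filter.Eventually.of_forall fun y => ?_)
    rw [Real.norm_eq_abs, ← dist_eq_norm]
    exact abs_mollify_sub_mollify_le (hδ0 ε hε) (hgec ε) (hgeL ε) y x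
  have hgd : ∀ x, ‖gradient g x‖ ≤ L := fun x => by
    rw [norm_gradient]
    refine norm_fderiv_le_of_lip' ℝ hL0.le (Filter.Eventually.of_forall fun y => ?_)
    rw [Real.norm_eq_abs, ← dist_eq_norm]
    exact hL y x
  have hmeas : Measurable (gradient g) := by
    unfold gradient
    exact (LinearIsometryEquiv.continuous _).measurable.comp (measurable_fderiv ℝ g)
  -- pointwise convergence of the gradients
  have hpt : ∀ᵐ x ∂volume.restrict Ω, ∀ᶠ ε in 𝓝[>] (0 : ℝ), gradient (Φ ε) x = gradient g x := by
    filter_upwards [volume_diff_interior_cells (M := M) hΩ] with x hx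
    obtain ⟨t, ht, hxt⟩ := hx
    have hfd : fderiv ℝ g x = baryLin t a := (hasFDerivAt_hat ht hxt).fderiv
    suffices h : ∀ᶠ ε in 𝓝[>] (0 : ℝ), fderiv ℝ (Φ ε) x = baryLin t a by
      filter_upwards [h] with ε hε
      unfold gradient
      rw [hε, hfd]
    obtain ⟨ρ, hρ, hb⟩ := Metric.isOpen_iff.1 isOpen_interior x hxt
    have hδt : Filter.Tendsto δ (𝓝[>] 0) (𝓝 0) := by
      have : Continuous δ := by rw [hδ]; fun_prop
      have h := this.tendsto 0
      simp only [hδ, zero_div] at h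
      exact h.mono_left nhdsWithin_le_nhds
    by_cases hat : a ∈ t
    · have hpos : 0 < bary t a x := (isTet ht).mem_interior_iff.1 hxt a hat
      obtain ⟨ρ', hρ', hb'⟩ := Metric.mem_nhds_iff.1
        ((continuous_bary t a).tendsto x (Ioi_mem_nhds (half_lt_self hpos)))
      filter_upwards [self_mem_nhdsWithin, hδt.eventually_lt_const
        (lt_min (half_pos hρ) (half_pos hρ')), Ioo_mem_nhdsGT (half_pos hpos)] with ε hε0 hεδ hε
      have hεδ' : δ ε < min (ρ / 2) (ρ' / 2) := hεδ
      refine fderiv_mollify_of_affine (hδ0 ε hε0) (baryLin t a) (c := bary t a 0 - ε) hεδ'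
        fun y hy => ?_
      rw [Metric.mem_ball] at hy
      have hy1 : dist y x < ρ := by linarith [min_le_left (ρ / 2) (ρ' / 2)]
      have hy2 : dist y x < ρ' := by linarith [min_le_right (ρ / 2) (ρ' / 2)]
      have e1 : g y = bary t a y := hat_eq ht (interior_subset (hb hy1))
      have e2 : bary t a x / 2 < bary t a y := hb' hy2
      have e3 : ge ε y = g y - ε := max_eq_left (by rw [e1]; linarith [hε.2])
      rw [e3, e1, bary_eq_add t a y]
      ring
    · filter_upwards [self_mem_nhdsWithin, hδt.eventually_lt_const (half_pos hρ)]
        with ε hε0 hεδ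
      have hεδ' : δ ε < ρ / 2 := hεδ
      refine fderiv_mollify_of_affine (hδ0 ε hε0) (baryLin t a) (c := 0) hεδ' fun y hy => ?_
      rw [Metric.mem_ball] at hy
      have e1 : g y = bary t a y := hat_eq ht (interior_subset (hb (by
        rw [Metric.mem_ball]; linarith)))
      have hε0' : (0 : ℝ) < ε := hε0
      have e3 : ge ε y = 0 := max_eq_right (by rw [e1, bary_of_notMem hat]; linarith)
      rw [e3, baryLin_of_notMem hat]; simp
  have hgL : MemLp g 2 (volume.restrict Ω) := by
    refine MemLp.of_bound hgc.aestronglyMeasurable 1 (Filter.Eventually.of_forall fun x => ?_)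
    rw [Real.norm_eq_abs, abs_of_nonneg (hat_nonneg a x)]
    by_cases hx : x ∈ closure Ω
    · obtain ⟨t, ht, hxt⟩ := M.mem_closure_iff.1 hx
      rw [hat_eq ht hxt]
      exact (isTet ht).bary_le_one hxt a
    · rw [hat_of_notMem_closure hx]; norm_num
  have hGL : MemLp (gradient g) 2 (volume.restrict Ω) :=
    MemLp.of_bound hmeas.aestronglyMeasurable L (Filter.Eventually.of_forall hgd)
  have hev : ∀ᶠ ε : ℝ in 𝓝[>] 0, 0 < ε := self_mem_nhdsWithin
  have hz : 𝓝 (0 : ℝ) = 𝓝 (∫ x in Ω, (0 : ℝ)) := by simp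
  have hlim1 : Filter.Tendsto (fun ε => ∫ x in Ω, ‖g x - Φ ε x‖ ^ 2) (𝓝[>] 0) (𝓝 0) := by
    rw [hz]
    refine tendsto_integral_filter_of_dominated_convergence (fun _ => 4) ?_ ?_ (integrable_const _) ?_
    · filter_upwards [hev] with ε hε
      have := (hΦs ε hε).continuous
      exact Continuous.aestronglyMeasurable (by fun_prop)
    · filter_upwards [Ioo_mem_nhdsGT one_pos] with ε hε
      refine Filter.Eventually.of_forall fun x => ?_
      have h1 := hΦg ε hε.1 x
      have h2 := abs_nonneg (g x - Φ ε x)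
      rw [Real.norm_of_nonneg (sq_nonneg _), Real.norm_eq_abs]
      nlinarith [hε.1, hε.2]
    · refine Filter.Eventually.of_forall fun x => ?_
      have hlim : Filter.Tendsto (fun ε : ℝ => (2 * ε) ^ 2) (𝓝[>] 0) (𝓝 0) := by
        have : Continuous fun ε : ℝ => (2 * ε) ^ 2 := by fun_prop
        simpa using (this.tendsto 0).mono_left (nhdsWithin_le_nhds (s := Ioi 0))
      refine squeeze_zero' (Filter.Eventually.of_forall fun ε => sq_nonneg _) ?_ hlim
      filter_upwards [hev] with ε hε
      exact pow_le_pow_left₀ (norm_nonneg _) (hΦg ε hε x) 2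
  have hlim2 : Filter.Tendsto (fun ε => ∫ x in Ω, ‖gradient g x - gradient (Φ ε) x‖ ^ 2)
      (𝓝[>] 0) (𝓝 0) := by
    rw [hz]
    refine tendsto_integral_filter_of_dominated_convergence (fun _ => (2 * L) ^ 2) ?_ ?_
      (integrable_const _) ?_
    · filter_upwards [hev] with ε hε
      have h1 := continuous_gradient ((hΦs ε hε).of_le (m := 1) (by simp))
      exact ((hmeas.sub h1.measurable).norm.pow_const 2).aestronglyMeasurable
    · filter_upwards [hev] with ε hε
      refine Filter.Eventually.of_forall fun x => ?_
      rw [Real.norm_of_nonneg (sq_nonneg _)]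
      refine pow_le_pow_left₀ (norm_nonneg _) ((norm_sub_le _ _).trans ?_) 2
      linarith [hgd x, hΦd ε hε x]
    · filter_upwards [hpt] with x hx
      refine tendsto_const_nhds.congr' ?_
      filter_upwards [hx] with ε hε
      rw [hε]; simp
  refine memH10_of_approx hΩ.isOpen hgL hGL fun ε hε => ?_
  have hε2 : 0 < ε ^ 2 := by positivity
  obtain ⟨κ, hκ0, hκ1, hκ2⟩ := (hev.and ((hlim1.eventually_lt_const hε2).and
    (hlim2.eventually_lt_const hε2))).exists
  have ht := htest κ hκ0
  refine ⟨Φ κ, ht, ?_, ?_⟩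
  · have e := eLpNorm_two_eq (hgL.sub (ht.memLp (volume.restrict Ω)))
    refine le_of_eq_of_le e (ENNReal.ofReal_le_ofReal ?_)
    rw [Real.sqrt_le_left hε.le]
    exact hκ1.le
  · have e := eLpNorm_two_eq (hGL.sub (ht.memLp_gradient (volume.restrict Ω)))
    refine le_of_eq_of_le e (ENNReal.ofReal_le_ofReal ?_)
    rw [Real.sqrt_le_left hε.le]
    exact hκ2.le

end TetMesh

/-! ### Quasi-interpolation by mean values -/

/-- The Dirichlet energy of `φ` on the cell `t`. -/
def cellEnergy (φ : E3 → ℝ) (t : Finset E3) : ℝ := ∫ x in cell t, ‖fderiv ℝ φ x‖ ^ 2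

theorem cellEnergy_nonneg (φ : E3 → ℝ) (t : Finset E3) : 0 ≤ cellEnergy φ t :=
  integral_nonneg fun _ => sq_nonneg _

theorem cellMean_sub_sq_bound {φ : E3 → ℝ} {t : Finset E3} (ht : IsTet t) (hφ : ContDiff ℝ 1 φ)
    (c : ℝ) :
    ∫ x in cell t, (φ x - c) ^ 2 ≤ 4 * diamCell t ^ 2 * cellEnergy φ t +
      volume.real (cell t) * (cellMean t φ - c) ^ 2 := by
  rw [integral_sub_const_sq ht hφ.continuous]
  exact add_le_add (poincare_cell ht hφ) le_rfl

namespace TetMesh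

variable {Ω : Set E3} {M : TetMesh Ω} {t : Finset E3} {z : E3} {γ : ℝ} {φ : E3 → ℝ}

open Classical in
/-- The Dirichlet energy of `φ` on the elements which contain the vertex `z`. -/
def starEnergy (M : TetMesh Ω) (φ : E3 → ℝ) (z : E3) : ℝ :=
  ∑ u ∈ M.elements with z ∈ u, cellEnergy φ u

open Classical in
/-- The Dirichlet energy of `φ` on the elements which share a vertex with `t`. -/
def patchEnergy (M : TetMesh Ω) (φ : E3 → ℝ) (t : Finset E3) : ℝ :=
  ∑ u ∈ M.elements with ∃ z, z ∈ t ∧ z ∈ u, cellEnergy φ u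

theorem starEnergy_nonneg (M : TetMesh Ω) (φ : E3 → ℝ) (z : E3) : 0 ≤ M.starEnergy φ z :=
  Finset.sum_nonneg fun _ _ => cellEnergy_nonneg _ _

theorem cellEnergy_le_starEnergy (ht : t ∈ M.elements) (hz : z ∈ t) :
    cellEnergy φ t ≤ M.starEnergy φ z := by
  classical
  exact Finset.single_le_sum (f := cellEnergy φ) (fun _ _ => cellEnergy_nonneg _ _)
    (Finset.mem_filter.2 ⟨ht, hz⟩)

theorem starEnergy_le_patchEnergy (hz : z ∈ t) : M.starEnergy φ z ≤ M.patchEnergy φ t := by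
  classical
  refine Finset.sum_le_sum_of_subset_of_nonneg (fun u hu => ?_) fun _ _ _ => cellEnergy_nonneg _ _
  rw [Finset.mem_filter] at hu ⊢
  exact ⟨hu.1, z, hz, hu.2⟩

theorem cellEnergy_le_patchEnergy (ht : t ∈ M.elements) : cellEnergy φ t ≤ M.patchEnergy φ t := by
  obtain ⟨z, hz⟩ : t.Nonempty := Finset.card_pos.1 (by rw [(isTet ht).card]; norm_num)
  exact (cellEnergy_le_starEnergy ht hz).trans (starEnergy_le_patchEnergy hz)

theorem patchEnergy_nonneg (M : TetMesh Ω) (φ : E3 → ℝ) (t : Finset E3) : 0 ≤ M.patchEnergy φ t :=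
  Finset.sum_nonneg fun _ _ => cellEnergy_nonneg _ _

/-- The volume of the unit ball. -/
def ballVol : ℝ := volume.real (Metric.ball (0 : E3) 1)

/-- The constant which compares mean values over a cell and over its faces. -/
def faceConst (γ : ℝ) : ℝ := 64 * γ ^ 3 / ballVol

theorem ballVol_pos : 0 < ballVol := volume_unitBall_pos

/-- The volume in `sq_faceMean_sub_cellMean_le` is at least `ballVol * (h_T / (4γ))³` by shape
regularity; cancelling `h_T²` leaves the weight `h_T`. -/
theorem ShapeRegular.diam_mul_sq_faceMean_sub_le (hM : M.ShapeRegular γ) (ht : t ∈ M.elements)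
    (hφ : ContDiff ℝ 1 φ) {e : Finset E3} (he : e ⊆ t) (hec : e.card = 3) :
    diamCell t * (faceMean e φ - cellMean t φ) ^ 2 ≤ faceConst γ * cellEnergy φ t := by
  classical
  have hT := isTet ht
  obtain ⟨a, ha⟩ : ∃ a, t \ e = {a} := by
    rw [← Finset.card_eq_one, Finset.card_sdiff_of_subset he, hT.card, hec]
  have hat : a ∈ t := (Finset.mem_sdiff.1 (ha ▸ Finset.mem_singleton_self a)).1
  have hea : e = t.erase a := by
    rw [← Finset.sdiff_singleton_eq_erase, ← ha, Finset.sdiff_sdiff_eq_self he]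
  subst hea
  have h1 := sq_faceMean_sub_cellMean_le hT hφ hat
  have h2 := le_volume_cell hT
  have h3 := hM.diam_le ht
  have h4 := diamCell_pos hT
  have h5 := inballDiam_pos hT
  have h6 := hM.one_le ht
  have h7 := ballVol_pos
  set X := (faceMean (t.erase a) φ - cellMean t φ) ^ 2 with hX
  have hX0 : 0 ≤ X := sq_nonneg _
  set h := diamCell t
  set ρ := inballDiam t
  change volume.real (cell t) * X ≤ h ^ 2 * cellEnergy φ t at h1
  change (ρ / 4) ^ 3 * ballVol ≤ volume.real (cell t) at h2
  have h8 : (h / (4 * γ)) ^ 3 ≤ (ρ / 4) ^ 3 := by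
    refine pow_le_pow_left₀ (by positivity) ?_ 3
    rw [div_le_div_iff₀ (by positivity) (by norm_num)]
    nlinarith
  have h9 : (h / (4 * γ)) ^ 3 * ballVol * X ≤ h ^ 2 * cellEnergy φ t :=
    (mul_le_mul_of_nonneg_right ((mul_le_mul_of_nonneg_right h8 h7.le).trans h2) hX0).trans h1
  have h10 : (h / (4 * γ)) ^ 3 * ballVol * X = h ^ 2 * (h * X / faceConst γ) := by
    rw [faceConst]
    have : γ ≠ 0 := by positivity
    field_simp
    ring
  rw [h10] at h9
  have h11 := le_of_mul_le_mul_left h9 (by positivity)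
  have h12 : 0 < faceConst γ := by rw [faceConst]; positivity
  rw [div_le_iff₀ h12] at h11
  linarith

theorem ShapeRegular.diam_le_of_walk (hM : M.ShapeRegular γ)
    {t t' : {t : Finset E3 // t ∈ M.elements ∧ z ∈ t}} (p : (M.starGraph z).Walk t t') :
    diamCell t.1 ≤ γ ^ p.length * diamCell t'.1 := by
  induction p with
  | nil => simp
  | @cons u v w h p ih =>
    have h1 := hM.diam_le_of_adj h
    have h0 := hM.one_le u.2.1
    rw [SimpleGraph.Walk.length_cons, pow_succ']
    calc _ ≤ γ * diamCell v.1 := h1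
      _ ≤ γ * (γ ^ p.length * diamCell w.1) := by gcongr
      _ = _ := by ring

/-- Consecutive elements share a face, and both means are compared with the mean over it, which
costs two terms per step. A common lower bound `η` for the diameters makes all terms equal. -/
theorem abs_cellMean_sub_le_of_walk (hM : M.ShapeRegular γ) (hφ : ContDiff ℝ 1 φ) {η : ℝ}
    (hη : 0 < η) {t t' : {t : Finset E3 // t ∈ M.elements ∧ z ∈ t}}
    (p : (M.starGraph z).Walk t t') (h : ∀ u, (M.starGraph z).Reachable t u → η ≤ diamCell u.1) :
    |cellMean t.1 φ - cellMean t'.1 φ| ≤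
      2 * p.length * √(faceConst γ * M.starEnergy φ z / η) := by
  induction p with
  | nil => simp
  | @cons u v w huv p ih =>
    have ih' := ih fun x hx => h x (huv.reachable.trans hx)
    have hadj := huv
    obtain ⟨-, e, hec, -, heu, hev⟩ := hadj
    have key : ∀ x : {t : Finset E3 // t ∈ M.elements ∧ z ∈ t}, e ⊆ x.1 → η ≤ diamCell x.1 →
        |faceMean e φ - cellMean x.1 φ| ≤ √(faceConst γ * M.starEnergy φ z / η) := by
      intro x hex hx
      refine Real.abs_le_sqrt ?_
      rw [le_div_iff₀ hη]
      have h1 := hM.diam_mul_sq_faceMean_sub_le x.2.1 hφ hex hec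
      have h2 := cellEnergy_le_starEnergy (φ := φ) x.2.1 x.2.2
      have h3 : 0 ≤ faceConst γ := by
        have := hM.one_le x.2.1; have := ballVol_pos; rw [faceConst]; positivity
      calc _ = η * (faceMean e φ - cellMean x.1 φ) ^ 2 := by ring
        _ ≤ diamCell x.1 * (faceMean e φ - cellMean x.1 φ) ^ 2 := by gcongr
        _ ≤ _ := h1.trans (by gcongr)
    have k1 := key u heu (h u (SimpleGraph.Reachable.refl _))
    have k2 := key v hev (h v huv.reachable)
    rw [SimpleGraph.Walk.length_cons]
    push_cast
    rw [abs_le] at *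
    constructor <;> linarith [k1.1, k1.2, k2.1, k2.2, ih'.1, ih'.2]

/-- A bound for the number of elements which share a vertex. -/
def starBound (γ : ℝ) : ℕ := ⌈(4 * γ) ^ 3⌉₊

/-- The constant in the local estimates for nodal mean values. -/
def nodalConst (γ : ℝ) : ℝ := (2 * starBound γ + 1) ^ 2 * (faceConst γ * γ ^ starBound γ)

/-- Removing loops leaves a path, shorter than the number of elements at `z`, which `card_star_le`
bounds. -/
theorem ShapeRegular.exists_walk (hM : M.ShapeRegular γ)
    {t t' : {t : Finset E3 // t ∈ M.elements ∧ z ∈ t}} (h : (M.starGraph z).Reachable t t') :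
    ∃ p : (M.starGraph z).Walk t t', p.length ≤ starBound γ := by
  classical
  obtain ⟨p⟩ := h
  have : Fintype {t : Finset E3 // t ∈ M.elements ∧ z ∈ t} := Fintype.ofFinite _
  refine ⟨p.toPath, ?_⟩
  have h1 := p.toPath.2.length_lt
  have h2 := hM.card_star_le t.2.1 t.2.2
  rw [Nat.card_eq_fintype_card] at h2
  have h3 := h2.trans (Nat.le_ceil _)
  have h4 : Fintype.card {t : Finset E3 // t ∈ M.elements ∧ z ∈ t} ≤ starBound γ := by
    exact_mod_cast h3
  omega

theorem ShapeRegular.diam_le_of_reachable (hM : M.ShapeRegular γ)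
    {t t' : {t : Finset E3 // t ∈ M.elements ∧ z ∈ t}} (h : (M.starGraph z).Reachable t t') :
    diamCell t.1 / γ ^ starBound γ ≤ diamCell t'.1 := by
  obtain ⟨p, hp⟩ := hM.exists_walk h
  have h1 := hM.one_le t.2.1
  rw [div_le_iff₀' (by positivity)]
  refine (hM.diam_le_of_walk p).trans ?_
  have := (diamCell_pos (isTet t'.2.1)).le
  gcongr

open Classical in
/-- A nodal value of `φ`: the mean over an element at `z` for an interior vertex `z`, and zero on
the boundary. -/
def nodalMean (M : TetMesh Ω) (φ : E3 → ℝ) (z : E3) : ℝ :=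
  if h : z ∈ Ω ∧ ∃ t, t ∈ M.elements ∧ z ∈ t then cellMean h.2.choose φ else 0

theorem nodalMean_of_notMem (hz : z ∉ Ω) : M.nodalMean φ z = 0 := dif_neg fun h => hz h.1

theorem faceMean_eq_zero {e : Finset E3} (he : Disjoint (cell e) Ω) (hφ : IsTestFunction Ω φ) :
    faceMean e φ = 0 := by
  rw [faceMean, setIntegral_eq_zero_of_forall_eq_zero, mul_zero]
  exact fun x hx => hφ.eq_zero (Set.disjoint_left.1 he hx)

/-- For an interior vertex the nodal value is another mean in the same connected star. Otherwise it
is zero, and so is the mean of `φ` over a face of the same component that misses `Ω`. Both are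
reached by a chain of bounded length. -/
theorem ShapeRegular.diam_mul_sq_cellMean_sub_nodalMean_le (hΩ : IsPolyhedralDomain Ω)
    (hM : M.ShapeRegular γ) (hφ : IsTestFunction Ω φ) (ht : t ∈ M.elements) (hz : z ∈ t) :
    diamCell t * (cellMean t φ - M.nodalMean φ z) ^ 2 ≤ nodalConst γ * M.starEnergy φ z := by
  have hφ1 : ContDiff ℝ 1 φ := hφ.smooth.of_le (by simp)
  have h0 := diamCell_pos (isTet ht)
  have hγ := hM.one_le ht
  have hb := ballVol_pos
  have hfc : 0 < faceConst γ := by rw [faceConst]; positivity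
  have hE := starEnergy_nonneg M φ z
  obtain ⟨N, hN⟩ : ∃ N, N = starBound γ := ⟨_, rfl⟩
  set η := diamCell t / γ ^ N with hη
  have hη0 : 0 < η := by positivity
  set s := √(faceConst γ * M.starEnergy φ z / η) with hs
  have hs0 : 0 ≤ s := Real.sqrt_nonneg _
  obtain ⟨T, hT⟩ : ∃ T : {t : Finset E3 // t ∈ M.elements ∧ z ∈ t}, T.1 = t := ⟨⟨t, ht, hz⟩, rfl⟩
  have hd : ∀ u, (M.starGraph z).Reachable T u → η ≤ diamCell u.1 :=
    fun u hu => by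
    rw [hη, hN, ← hT]; exact hM.diam_le_of_reachable hu
  have hw : ∀ u, (M.starGraph z).Reachable T u → |cellMean t φ - cellMean u.1 φ| ≤ 2 * N * s := by
    intro u hu
    obtain ⟨p, hp⟩ := hM.exists_walk hu
    rw [← hT]
    refine (abs_cellMean_sub_le_of_walk hM hφ1 hη0 p hd).trans ?_
    have : (p.length : ℝ) ≤ N := by rw [hN]; exact_mod_cast hp
    gcongr
  -- A walk of at most `N` steps costs `2 N`; the extra `1` is the comparison with the boundary
  -- face.
  have key : |cellMean t φ - M.nodalMean φ z| ≤ (2 * N + 1) * s := by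
    by_cases hzΩ : z ∈ Ω
    · have hex : z ∈ Ω ∧ ∃ t, t ∈ M.elements ∧ z ∈ t := ⟨hzΩ, t, ht, hz⟩
      rw [nodalMean, dif_pos hex]
      have := hw ⟨hex.2.choose, hex.2.choose_spec⟩ (star_reachable_of_mem hΩ hzΩ _ _)
      change |cellMean t φ - cellMean hex.2.choose φ| ≤ _ at this
      linarith
    · rw [nodalMean_of_notMem hzΩ, sub_zero]
      obtain ⟨u, hu, k, hk, hdis⟩ := star_exists_boundary_of_notMem hΩ hzΩ T
      have h1 := hw u hu
      have h2 := hM.diam_mul_sq_faceMean_sub_le u.2.1 hφ1 (Finset.erase_subset k u.1)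
        (by rw [Finset.card_erase_of_mem hk, (isTet u.2.1).card])
      have h2' := faceMean_eq_zero hdis hφ
      have h3 : |cellMean u.1 φ| ≤ s := by
        refine Real.abs_le_sqrt ?_
        rw [le_div_iff₀ hη0]
        have h4 := cellEnergy_le_starEnergy (φ := φ) u.2.1 u.2.2
        have h5 := hd u hu
        have h6 : diamCell u.1 * cellMean u.1 φ ^ 2 ≤ faceConst γ * cellEnergy φ u.1 := by
          refine le_trans (le_of_eq ?_) h2
          rw [h2']; ring
        calc _ = η * cellMean u.1 φ ^ 2 := by ring
          _ ≤ diamCell u.1 * cellMean u.1 φ ^ 2 := by gcongr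
          _ ≤ _ := h6.trans (by gcongr)
      have h7 := abs_sub_abs_le_abs_sub (cellMean t φ) (cellMean u.1 φ)
      linarith
  have h1 := pow_le_pow_left₀ (abs_nonneg _) key 2
  rw [sq_abs, mul_pow, hs, Real.sq_sqrt (by positivity)] at h1
  calc _ ≤ diamCell t * ((2 * N + 1) ^ 2 * (faceConst γ * M.starEnergy φ z / η)) := by gcongr
    _ = _ := by rw [nodalConst, hη, ← hN]; field_simp

open Classical in
/-- The interpolation error of `φ` on `t`. -/
def interpError (M : TetMesh Ω) (φ : E3 → ℝ) (t : Finset E3) (x : E3) : ℝ :=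
  φ x - ∑ a ∈ t, M.nodalMean φ a * bary t a x

theorem contDiff_interpError (hφ : ContDiff ℝ 1 φ) : ContDiff ℝ 1 (M.interpError φ t) :=
  hφ.sub (ContDiff.sum fun a _ => contDiff_const.mul (contDiff_bary t a))

/-- The coordinates sum to one, so the error is a weighted sum of `φ x - M.nodalMean φ a`;
Cauchy-Schwarz applies, with the squared weights summing to at most `4`. -/
theorem sq_interpError_le (ht : IsTet t) {x : E3} (hx : x ∈ cell t) :
    M.interpError φ t x ^ 2 ≤ 4 * ∑ a ∈ t, (φ x - M.nodalMean φ a) ^ 2 := by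
  have h1 : M.interpError φ t x = ∑ a ∈ t, bary t a x * (φ x - M.nodalMean φ a) := by
    rw [interpError]
    simp only [mul_sub, Finset.sum_sub_distrib]
    rw [← Finset.sum_mul, ht.sum_bary, one_mul]
    simp only [mul_comm]
  rw [h1]
  refine (Finset.sum_mul_sq_le_sq_mul_sq _ _ _).trans ?_
  refine mul_le_mul_of_nonneg_right ?_ (Finset.sum_nonneg fun _ _ => sq_nonneg _)
  calc ∑ a ∈ t, bary t a x ^ 2 ≤ ∑ a ∈ t, (1 : ℝ) := Finset.sum_le_sum fun a ha =>
        pow_le_one₀ (ht.bary_nonneg hx a) (ht.bary_le_one hx a)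
    _ = 4 := by simp [ht.card]

/-- The gradients of the barycentric coordinates sum to zero, so a constant `c` may be subtracted
from the nodal values. Taking the cell mean leaves differences that are already controlled. -/
theorem fderiv_interpError (ht : IsTet t) (hφ : Differentiable ℝ φ) (c : ℝ) (x : E3) :
    fderiv ℝ (M.interpError φ t) x =
      fderiv ℝ φ x - ∑ a ∈ t, (M.nodalMean φ a - c) • baryLin t a := by
  have h1 : HasFDerivAt (M.interpError φ t)
      (fderiv ℝ φ x - ∑ a ∈ t, M.nodalMean φ a • baryLin t a) x :=
    (hφ x).hasFDerivAt.sub (HasFDerivAt.fun_sum fun a _ => (hasFDerivAt_bary t a x).const_mul _)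
  rw [h1.fderiv]
  have h0 : ∑ a ∈ t, baryLin t a = 0 := by ext v; simpa using ht.sum_baryLin v
  have h2 : ∑ a ∈ t, (M.nodalMean φ a - c) • baryLin t a =
      ∑ a ∈ t, M.nodalMean φ a • baryLin t a := by
    rw [Finset.sum_congr rfl fun a _ => sub_smul (M.nodalMean φ a) c (baryLin t a),
      Finset.sum_sub_distrib, ← Finset.smul_sum, h0, smul_zero, sub_zero]
  rw [h2]

theorem norm_baryLin_mul_inballDiam_le {a : E3} (ht : IsTet t) (ha : a ∈ t) :
    ‖baryLin t a‖ * inballDiam t ≤ 1 := by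
  have h := inballDiam_pos ht
  rw [← le_div_iff₀ h]
  refine ContinuousLinearMap.opNorm_le_bound _ (by positivity) fun v => ?_
  rw [Real.norm_eq_abs, div_mul_eq_mul_div, one_mul, le_div_iff₀ h]
  exact abs_baryLin_mul_inballDiam_le ht ha v

/-- The constant in the local interpolation estimates. -/
def interpConst (γ : ℝ) : ℝ := 64 + 16 * ballVol * nodalConst γ

/-- The constant in the stability estimate of the interpolation. -/
def stabConst (γ : ℝ) : ℝ := 2 + 32 * γ ^ 2 * ballVol * nodalConst γ

/-- The constant in the trace estimate for the interpolation error. -/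
def interpTraceConst (γ : ℝ) : ℝ := γ ^ 2 * (4 * interpConst γ + stabConst γ)

theorem nodalConst_nonneg (hγ : 1 ≤ γ) : 0 ≤ nodalConst γ := by
  have := ballVol_pos
  rw [nodalConst, faceConst]; positivity

/-- The volume is at most `ballVol * h_T³`: one factor `h_T` is the weight of the nodal estimate,
the other two remain. -/
theorem ShapeRegular.volume_mul_sq_le (hΩ : IsPolyhedralDomain Ω)
    (hM : M.ShapeRegular γ) (hφ : IsTestFunction Ω φ) (ht : t ∈ M.elements) (hz : z ∈ t) :
    volume.real (cell t) * (cellMean t φ - M.nodalMean φ z) ^ 2 ≤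
      diamCell t ^ 2 * (ballVol * nodalConst γ * M.patchEnergy φ t) := by
  have h1 := hM.diam_mul_sq_cellMean_sub_nodalMean_le hΩ hφ ht hz
  have h2 := volume_cell_le (isTet ht)
  change _ ≤ diamCell t ^ 3 * ballVol at h2
  have h3 := starEnergy_le_patchEnergy (M := M) (φ := φ) hz
  have h4 := nodalConst_nonneg (hM.one_le ht)
  have h5 := ballVol_pos
  calc _ ≤ diamCell t ^ 3 * ballVol * (cellMean t φ - M.nodalMean φ z) ^ 2 := by gcongr
    _ = diamCell t ^ 2 * (ballVol * (diamCell t * (cellMean t φ - M.nodalMean φ z) ^ 2)) := by ring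
    _ ≤ diamCell t ^ 2 * (ballVol * (nodalConst γ * M.patchEnergy φ t)) := by
        refine mul_le_mul_of_nonneg_left (mul_le_mul_of_nonneg_left ?_ h5.le) (sq_nonneg _)
        exact h1.trans (mul_le_mul_of_nonneg_left h3 h4)
    _ = _ := by ring

theorem ShapeRegular.integral_sq_interpError_le (hΩ : IsPolyhedralDomain Ω)
    (hM : M.ShapeRegular γ) (hφ : IsTestFunction Ω φ) (ht : t ∈ M.elements) :
    ∫ x in cell t, M.interpError φ t x ^ 2 ≤
      interpConst γ * diamCell t ^ 2 * M.patchEnergy φ t := by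
  have hT := isTet ht
  have hφ1 : ContDiff ℝ 1 φ := hφ.smooth.of_le (by simp)
  have hc := hφ1.continuous
  have hw := (contDiff_interpError (M := M) (t := t) hφ1).continuous
  calc ∫ x in cell t, M.interpError φ t x ^ 2
      ≤ ∫ x in cell t, 4 * ∑ a ∈ t, (φ x - M.nodalMean φ a) ^ 2 := by
        refine setIntegral_mono_on (integrableOn_cell (by fun_prop) t)
          (integrableOn_cell (by fun_prop) t) (isCompact_cell t).measurableSet fun x hx =>
            sq_interpError_le hT hx
    _ = 4 * ∑ a ∈ t, ∫ x in cell t, (φ x - M.nodalMean φ a) ^ 2 := by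
        rw [integral_const_mul, integral_finsetSum]
        exact fun a _ => integrableOn_cell (by fun_prop) t
    -- Distance to the mean by Poincaré, distance of the mean to the nodal value by
    -- `volume_mul_sq_le`. The four vertices then produce the `64` and `16` of `interpConst`.
    _ ≤ 4 * ∑ a ∈ t, (4 * diamCell t ^ 2 * M.patchEnergy φ t +
          diamCell t ^ 2 * (ballVol * nodalConst γ * M.patchEnergy φ t)) := by
        gcongr with a ha
        refine (cellMean_sub_sq_bound hT hφ1 _).trans (add_le_add ?_
          (hM.volume_mul_sq_le hΩ hφ ht ha))
        have := cellEnergy_le_patchEnergy (φ := φ) ht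
        gcongr
    _ = _ := by
        rw [Finset.sum_const, hT.card, interpConst, nsmul_eq_mul]
        push_cast
        ring

theorem ShapeRegular.integral_sq_fderiv_interpError_le (hΩ : IsPolyhedralDomain Ω)
    (hM : M.ShapeRegular γ) (hφ : IsTestFunction Ω φ) (ht : t ∈ M.elements) :
    ∫ x in cell t, ‖fderiv ℝ (M.interpError φ t) x‖ ^ 2 ≤ stabConst γ * M.patchEnergy φ t := by
  have hT := isTet ht
  have hφ1 : ContDiff ℝ 1 φ := hφ.smooth.of_le (by simp)
  have hc := hφ1.continuous_fderiv one_ne_zero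
  have hw := (contDiff_interpError (M := M) (t := t) hφ1).continuous_fderiv one_ne_zero
  have h0 := diamCell_pos hT
  have hγ := hM.one_le ht
  set m := cellMean t φ with hm
  set k : ℝ := 8 * (γ ^ 2 / diamCell t ^ 2) * ∑ a ∈ t, (m - M.nodalMean φ a) ^ 2 with hk
  have hpt : ∀ x, ‖fderiv ℝ (M.interpError φ t) x‖ ^ 2 ≤ 2 * ‖fderiv ℝ φ x‖ ^ 2 + k := by
    intro x
    rw [fderiv_interpError hT (hφ1.differentiable one_ne_zero) m]
    set S := ∑ a ∈ t, (M.nodalMean φ a - m) • baryLin t a with hS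
    have h1 : ‖S‖ ≤ ∑ a ∈ t, |m - M.nodalMean φ a| * (γ / diamCell t) := by
      refine (norm_sum_le _ _).trans (Finset.sum_le_sum fun a ha => ?_)
      rw [norm_smul, Real.norm_eq_abs, abs_sub_comm]
      refine mul_le_mul_of_nonneg_left ?_ (abs_nonneg _)
      rw [le_div_iff₀ h0]
      have h2 := norm_baryLin_mul_inballDiam_le hT ha
      have h3 := hM.diam_le ht
      calc ‖baryLin t a‖ * diamCell t ≤ ‖baryLin t a‖ * (γ * inballDiam t) := by gcongr
        _ = γ * (‖baryLin t a‖ * inballDiam t) := by ring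
        _ ≤ γ * 1 := by gcongr
        _ = γ := mul_one _
    have h2 : ‖S‖ ^ 2 ≤ 4 * (∑ a ∈ t, (m - M.nodalMean φ a) ^ 2) * (γ ^ 2 / diamCell t ^ 2) := by
      refine (pow_le_pow_left₀ (norm_nonneg _) h1 2).trans ?_
      rw [← Finset.sum_mul, mul_pow, div_pow]
      refine mul_le_mul_of_nonneg_right ?_ (by positivity)
      have := sq_sum_le_card_mul_sum_sq (s := t) (f := fun a => |m - M.nodalMean φ a|)
      simpa [hT.card] using this
    have h3 := norm_sub_le (fderiv ℝ φ x) S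
    have h4 := pow_le_pow_left₀ (norm_nonneg _) h3 2
    have h5 := sq_nonneg (‖fderiv ℝ φ x‖ - ‖S‖)
    rw [hk]
    nlinarith
  have hV : volume.real (cell t) * k ≤ 32 * γ ^ 2 * (ballVol * nodalConst γ * M.patchEnergy φ t) := by
    calc volume.real (cell t) * k = 8 * (γ ^ 2 / diamCell t ^ 2) *
          ∑ a ∈ t, volume.real (cell t) * (m - M.nodalMean φ a) ^ 2 := by
            rw [hk, ← Finset.mul_sum]; ring
      _ ≤ 8 * (γ ^ 2 / diamCell t ^ 2) *
          ∑ a ∈ t, diamCell t ^ 2 * (ballVol * nodalConst γ * M.patchEnergy φ t) := by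
            refine mul_le_mul_of_nonneg_left (Finset.sum_le_sum fun a ha => ?_) (by positivity)
            exact hM.volume_mul_sq_le hΩ hφ ht ha
      _ = _ := by
            rw [Finset.sum_const, hT.card, nsmul_eq_mul]
            push_cast
            field_simp
            ring
  calc ∫ x in cell t, ‖fderiv ℝ (M.interpError φ t) x‖ ^ 2
      ≤ ∫ x in cell t, (2 * ‖fderiv ℝ φ x‖ ^ 2 + k) :=
        setIntegral_mono (integrableOn_cell (by fun_prop) t) (integrableOn_cell (by fun_prop) t) hpt
    _ = 2 * cellEnergy φ t + volume.real (cell t) * k := by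
        rw [integral_add (integrableOn_cell (by fun_prop) t) (integrableOn_cell (by fun_prop) t),
          integral_const_mul, setIntegral_const, smul_eq_mul, cellEnergy]
    _ ≤ 2 * M.patchEnergy φ t + 32 * γ ^ 2 * (ballVol * nodalConst γ * M.patchEnergy φ t) := by
        have := cellEnergy_le_patchEnergy (φ := φ) ht
        gcongr
    _ = _ := by rw [stabConst]; ring

-- The trace inequality for the interpolation error. One factor `γ` comes from `h_T ≤ γ ρ_T`, the
-- other from `h_T ≤ γ h_e`, which brings in the face diameter used by the error indicator.
open Classical in
theorem ShapeRegular.integral_face_sq_interpError_le (hΩ : IsPolyhedralDomain Ω)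
    (hM : M.ShapeRegular γ) (hφ : IsTestFunction Ω φ) (ht : t ∈ M.elements) {a : E3} (ha : a ∈ t) :
    ∫ x in cell (t.erase a), M.interpError φ t x ^ 2 ∂Measure.euclideanHausdorffMeasure 2 ≤
      interpTraceConst γ * diamCell (t.erase a) * M.patchEnergy φ t := by
  have hT := isTet ht
  have hφ1 : ContDiff ℝ 1 φ := hφ.smooth.of_le (by simp)
  have h1 := trace_cell hT (contDiff_interpError (M := M) (t := t) hφ1) ha
  have h2 := hM.integral_sq_interpError_le hΩ hφ ht
  have h3 := hM.integral_sq_fderiv_interpError_le hΩ hφ ht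
  have h0 := diamCell_pos hT
  have hγ := hM.one_le ht
  have h4 := hM.diam_le ht
  have h5 := hM.diam_le_of_edge ht (Finset.erase_subset a t)
    (by rw [Finset.card_erase_of_mem ha, hT.card]; norm_num)
  have hn := nodalConst_nonneg hγ
  have hE := patchEnergy_nonneg M φ t
  have hb := ballVol_pos
  set I := ∫ x in cell (t.erase a), M.interpError φ t x ^ 2 ∂Measure.euclideanHausdorffMeasure 2
    with hI
  have hI0 : 0 ≤ I := integral_nonneg fun x => sq_nonneg _
  set E := M.patchEnergy φ t
  set h := diamCell t
  set ρ := inballDiam t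
  set c := 4 * interpConst γ + stabConst γ with hc
  have hc0 : 0 ≤ c := by rw [hc, interpConst, stabConst]; positivity
  have h6 : ρ * I ≤ c * h ^ 2 * E := by
    have : h ^ 2 * ∫ x in cell t, ‖fderiv ℝ (M.interpError φ t) x‖ ^ 2 ≤
        h ^ 2 * (stabConst γ * E) := by gcongr
    rw [hc]; linarith
  have h7 : h * I ≤ h * (γ * c * h * E) := by
    calc h * I ≤ γ * ρ * I := by gcongr
      _ = γ * (ρ * I) := by ring
      _ ≤ γ * (c * h ^ 2 * E) := by gcongr
      _ = _ := by ring
  refine (le_of_mul_le_mul_left h7 h0).trans ?_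
  calc γ * c * h * E ≤ γ * c * (γ * diamCell (t.erase a)) * E := by gcongr
    _ = _ := by rw [interpTraceConst]; ring

end TetMesh

/-! ### Integration by parts on an element -/

theorem restrict_interior_cell (t : Finset E3) :
    volume.restrict (interior (cell t)) = volume.restrict (cell t) := by
  refine Measure.restrict_congr_set ?_
  refine interior_subset.eventuallyLE.antisymm ?_
  rw [ae_le_set]
  exact volume_cell_diff_interior t

/-- The polynomial function on `ℝ³` given by `p`. -/
def polyFun (p : MvPolynomial (Fin 3) ℝ) (x : E3) : ℝ := MvPolynomial.eval (fun i => x i) p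

theorem contDiff_polyFun (p : MvPolynomial (Fin 3) ℝ) {n : WithTop ℕ∞} :
    ContDiff ℝ n (polyFun p) := by
  induction p using MvPolynomial.induction_on with
  | C a =>
    have h : polyFun (MvPolynomial.C a) = fun _ => a := by ext; simp [polyFun]
    rw [h]; exact contDiff_const
  | add p q hp hq =>
    have h : polyFun (p + q) = fun x => polyFun p x + polyFun q x := by ext; simp [polyFun]
    rw [h]; exact hp.add hq
  | mul_X p i hp =>
    have h : polyFun (p * MvPolynomial.X i) = fun x => polyFun p x * x i := by ext; simp [polyFun]
    rw [h]; exact hp.mul (by fun_prop)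

theorem exists_polynomial_bary (t : Finset E3) (a : E3) :
    ∃ p : MvPolynomial (Fin 3) ℝ, p.totalDegree ≤ 1 ∧ ∀ x, bary t a x = polyFun p x := by
  refine ⟨MvPolynomial.C (bary t a 0) +
    ∑ i, MvPolynomial.C (baryLin t a (EuclideanSpace.single i 1)) * MvPolynomial.X i, ?_, fun x => ?_⟩
  · refine (MvPolynomial.totalDegree_add _ _).trans (max_le (by simp) ?_)
    refine MvPolynomial.totalDegree_finsetSum_le fun i _ => ?_
    refine (MvPolynomial.totalDegree_mul _ _).trans ?_
    simp
  · have hx : x = ∑ i, x i • EuclideanSpace.single i (1 : ℝ) := by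
      ext j; simp [Finset.sum_apply, Pi.single_apply]
    have h1 : baryLin t a x = ∑ i, x i * baryLin t a (EuclideanSpace.single i 1) := by
      conv_lhs => rw [hx]
      rw [map_sum]
      simp only [map_smul, smul_eq_mul]
    have h2 := bary_sub t a x 0
    rw [sub_zero] at h2
    simp only [polyFun, map_add, map_sum, map_mul, MvPolynomial.eval_C, MvPolynomial.eval_X]
    rw [h1] at h2
    simp only [mul_comm (baryLin t a _)]
    linarith

/-- On the cell `u` agrees with the smooth `p`, and cells have unique derivatives up to the
boundary, so derivatives within the cell are those of `p`. -/
theorem laplacianWithin_cell_eq {t : Finset E3} (ht : IsTet t) {u p : E3 → ℝ}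
    (hp : ContDiff ℝ 2 p) (hu : ∀ x ∈ cell t, u x = p x) {x : E3} (hx : x ∈ cell t) :
    InnerProductSpace.laplacianWithin u (cell t) x =
      ∑ i, fderiv ℝ (fderiv ℝ p) x (EuclideanSpace.basisFun (Fin 3) ℝ i)
        (EuclideanSpace.basisFun (Fin 3) ℝ i) := by
  have hs := uniqueDiffOn_cell ht
  have h1 : u =ᶠ[𝓝[cell t] x] p := Filter.eventually_of_mem self_mem_nhdsWithin hu
  have h2 := (InnerProductSpace.laplacianWithin_congr_nhdsWithin h1 hs).self_of_nhdsWithin hx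
  rw [h2, InnerProductSpace.laplacianWithin_eq_iteratedFDerivWithin_orthonormalBasis p hs hx
    (EuclideanSpace.basisFun (Fin 3) ℝ)]
  refine Finset.sum_congr rfl fun i _ => ?_
  rw [iteratedFDerivWithin_eq_iteratedFDeriv hs hp.contDiffAt hx, iteratedFDeriv_two_apply]
  simp

theorem gradientWithin_cell_eq {t : Finset E3} (ht : IsTet t) {u p : E3 → ℝ}
    (hp : ContDiff ℝ 1 p) (hu : ∀ x ∈ cell t, u x = p x) {x : E3} (hx : x ∈ cell t) :
    gradientWithin u (cell t) x = gradient p x := by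
  unfold gradientWithin gradient
  rw [fderivWithin_congr hu (hu x hx),
    ((hp.differentiable one_ne_zero) x).fderivWithin (uniqueDiffOn_cell ht x hx)]

open Classical in
/-- Green's formula on a tetrahedron. -/
theorem IsTet.integral_inner_gradient {t : Finset E3} (ht : IsTet t) {u p w : E3 → ℝ}
    (hp : ContDiff ℝ 2 p) (hu : ∀ x ∈ cell t, u x = p x) (hw : ContDiff ℝ 1 w) :
    ∫ x in cell t, ⟪gradient p x, gradient w x⟫_ℝ =
      (∑ k ∈ t, ∫ x in cell (t.erase k),
        ⟪gradientWithin u (cell t) x, outwardNormal t (t.erase k)⟫_ℝ * w x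
          ∂Measure.euclideanHausdorffMeasure 2) -
      ∫ x in cell t, InnerProductSpace.laplacianWithin u (cell t) x * w x := by
  set b := EuclideanSpace.basisFun (Fin 3) ℝ with hb
  have hp1 : ContDiff ℝ 1 p := hp.of_le (by norm_num)
  have hd : ContDiff ℝ 1 (fderiv ℝ p) := hp.fderiv_right (by norm_num)
  have hdc := hd.continuous
  have hddc := hd.continuous_fderiv one_ne_zero
  have hwc := hw.continuous
  have hwd := hw.continuous_fderiv one_ne_zero
  -- The divergence theorem is applied to `∂ᵢp * w` in the direction `b i` and summed over `i`.
  have hf : ∀ i, ContDiff ℝ 1 fun x => fderiv ℝ p x (b i) * w x := fun i =>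
    (hd.clm_apply contDiff_const).mul hw
  have hfd : ∀ i x, fderiv ℝ (fun x => fderiv ℝ p x (b i) * w x) x (b i) =
      fderiv ℝ (fderiv ℝ p) x (b i) (b i) * w x + fderiv ℝ p x (b i) * fderiv ℝ w x (b i) := by
    intro i x
    have h1 : HasFDerivAt (fun x => fderiv ℝ p x (b i)) _ x :=
      ((hd.differentiable one_ne_zero) x).hasFDerivAt.clm_apply (hasFDerivAt_const (b i) x)
    have h2 := h1.fun_mul ((hw.differentiable one_ne_zero) x).hasFDerivAt
    rw [h2.fderiv]
    simp
    ring
  have key := Finset.sum_congr rfl fun i (_ : i ∈ Finset.univ) => ht.integral_fderiv (hf i) (b i)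
  have hL : ∑ i, ∫ x in cell t, fderiv ℝ (fun x => fderiv ℝ p x (b i) * w x) x (b i) =
      (∫ x in cell t, InnerProductSpace.laplacianWithin u (cell t) x * w x) +
      ∫ x in cell t, ⟪gradient p x, gradient w x⟫_ℝ := by
    have e1 : ∀ x ∈ cell t, InnerProductSpace.laplacianWithin u (cell t) x * w x =
        ∑ i, fderiv ℝ (fderiv ℝ p) x (b i) (b i) * w x := fun x hx => by
      rw [laplacianWithin_cell_eq ht hp hu hx, Finset.sum_mul]
    have e2 : ∀ x, ⟪gradient p x, gradient w x⟫_ℝ = ∑ i, fderiv ℝ p x (b i) * fderiv ℝ w x (b i) := by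
      intro x
      rw [← b.sum_inner_mul_inner]
      refine Finset.sum_congr rfl fun i _ => ?_
      rw [inner_gradient, real_inner_comm, inner_gradient]
    rw [setIntegral_congr_fun (isCompact_cell t).measurableSet e1]
    simp only [e2, hfd]
    rw [integral_finsetSum, integral_finsetSum, ← Finset.sum_add_distrib]
    · refine Finset.sum_congr rfl fun i _ => ?_
      exact integral_add (integrableOn_cell (by fun_prop) t) (integrableOn_cell (by fun_prop) t)
    · exact fun i _ => integrableOn_cell (by fun_prop) t
    · exact fun i _ => integrableOn_cell (by fun_prop) t
  have hR : ∑ i, ∑ k ∈ t, ⟪b i, outwardNormal t (t.erase k)⟫_ℝ *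
        ∫ x in cell (t.erase k), fderiv ℝ p x (b i) * w x ∂Measure.euclideanHausdorffMeasure 2 =
      ∑ k ∈ t, ∫ x in cell (t.erase k),
        ⟪gradientWithin u (cell t) x, outwardNormal t (t.erase k)⟫_ℝ * w x
          ∂Measure.euclideanHausdorffMeasure 2 := by
    rw [Finset.sum_comm]
    refine Finset.sum_congr rfl fun k hk => ?_
    have hsub : cell (t.erase k) ⊆ cell t := convexHull_mono (by
      exact_mod_cast Finset.erase_subset k t)
    have hcard : (t.erase k).card = 3 := by rw [Finset.card_erase_of_mem hk, ht.card]
    rw [setIntegral_congr_fun (isCompact_cell _).measurableSet (g := fun x =>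
      ∑ i, ⟪b i, outwardNormal t (t.erase k)⟫_ℝ * (fderiv ℝ p x (b i) * w x)) fun x hx => ?_]
    · rw [integral_finsetSum]
      · exact Finset.sum_congr rfl fun i _ => (integral_const_mul _ _).symm
      · exact fun i _ => integrableOn_face hcard (by fun_prop)
    · rw [gradientWithin_cell_eq ht hp1 hu (hsub hx), ← b.sum_inner_mul_inner, Finset.sum_mul]
      refine Finset.sum_congr rfl fun i _ => ?_
      rw [inner_gradient]
      ring
  rw [hL, hR] at key
  linarith

namespace TetMesh

variable {Ω : Set E3} {M : TetMesh Ω} {t : Finset E3} {z : E3} {γ : ℝ} {φ : E3 → ℝ}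

/-- The cells cover the closure and their interiors lie in `Ω`, so the boundary of `Ω` lies in the
boundaries of finitely many convex sets, which are null. -/
theorem restrict_closure (M : TetMesh Ω) (hΩ : IsPolyhedralDomain Ω) :
    volume.restrict (closure Ω) = volume.restrict Ω := by
  refine Measure.restrict_congr_set ?_
  refine Filter.EventuallyLE.antisymm ?_ subset_closure.eventuallyLE
  rw [ae_le_set]
  refine measure_mono_null (t := ⋃ t ∈ M.elements, cell t \ interior (cell t)) (fun x hx => ?_)
    ((measure_biUnion_null_iff M.elements.countable_toSet).2 fun t _ => volume_cell_diff_interior t)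
  obtain ⟨t, ht, hxt⟩ := M.mem_closure_iff.1 hx.1
  exact mem_biUnion (s := {t | t ∈ M.elements}) ht
    ⟨hxt, fun h => hx.2 (interior_cell_subset hΩ ht h)⟩

theorem integral_biUnion_cell {S : Finset (Finset E3)} (hS : S ⊆ M.elements) {f : E3 → ℝ}
    (hf : IntegrableOn f (⋃ t ∈ S, cell t)) :
    ∫ x in ⋃ t ∈ S, cell t, f x = ∑ t ∈ S, ∫ x in cell t, f x := by
  have e : (⋃ t ∈ S, cell t) = ⋃ t : S, cell t.1 := by
    ext x; simp
  rw [e] at hf ⊢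
  have hd : Pairwise (Function.onFun (AEDisjoint volume) fun t : S => cell t.1) := by
    intro s t hst
    exact volume_cell_inter (hS s.2) (hS t.2) fun h => hst (Subtype.ext h)
  have hm : ∀ t : S, NullMeasurableSet (cell t.1) volume :=
    fun t => (isCompact_cell t.1).measurableSet.nullMeasurableSet
  rw [integral_iUnion_ae hm hd hf, tsum_fintype, Finset.sum_coe_sort S fun t => ∫ x in cell t, f x]

theorem integral_eq_sum_cell (M : TetMesh Ω) (hΩ : IsPolyhedralDomain Ω) {f : E3 → ℝ} (hf : IntegrableOn f Ω) :
    ∫ x in Ω, f x = ∑ t ∈ M.elements, ∫ x in cell t, f x := by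
  have e : closure Ω = ⋃ t ∈ M.elements, cell t := by
    ext x; rw [M.mem_closure_iff]; simp
  have hf' : IntegrableOn f (closure Ω) := by
    rw [IntegrableOn, M.restrict_closure hΩ]; exact hf
  rw [← M.restrict_closure hΩ, e]
  rw [e] at hf'
  exact integral_biUnion_cell subset_rfl hf'

theorem restrict_cell_le (hΩ : IsPolyhedralDomain Ω) (ht : t ∈ M.elements) :
    volume.restrict (cell t) ≤ volume.restrict Ω := by
  rw [← restrict_interior_cell]
  exact Measure.restrict_mono_set _ (interior_cell_subset hΩ ht)

theorem restrict_patch_le (M : TetMesh Ω) (hΩ : IsPolyhedralDomain Ω) (t : Finset E3) :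
    volume.restrict (M.patch t) ≤ volume.restrict Ω := by
  rw [← M.restrict_closure hΩ]
  refine Measure.restrict_mono_set _ ?_
  exact iUnion₂_subset fun u hu => iUnion_subset fun _ => cell_subset_closure hu

theorem patchEnergy_eq (hφ : ContDiff ℝ 1 φ) (t : Finset E3) :
    M.patchEnergy φ t = ∫ x in M.patch t, ‖fderiv ℝ φ x‖ ^ 2 := by
  classical
  have hc := hφ.continuous_fderiv one_ne_zero
  set S := M.elements.filter fun u => ∃ z, z ∈ t ∧ z ∈ u with hS
  have e : M.patch t = ⋃ u ∈ S, cell u := by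
    ext x
    simp only [patch, hS, mem_iUnion, Finset.mem_filter, exists_prop, and_assoc]
  have hK : IsCompact (⋃ u ∈ S, cell u) := S.isCompact_biUnion fun u _ => isCompact_cell u
  rw [e, integral_biUnion_cell (Finset.filter_subset _ _)]
  · unfold patchEnergy cellEnergy
    refine Finset.sum_congr ?_ fun _ _ => rfl
    ext u; simp
  · exact ContinuousOn.integrableOn_compact hK (by fun_prop)

theorem sqrt_patchEnergy_le_h1Norm (hΩ : IsPolyhedralDomain Ω) (hφ : IsTestFunction Ω φ)
    (t : Finset E3) : √(M.patchEnergy φ t) ≤ h1Norm Ω (M.patch t) φ := by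
  have hφ1 : ContDiff ℝ 1 φ := hφ.smooth.of_le (by simp)
  rw [patchEnergy_eq hφ1, h1Norm]
  refine Real.sqrt_le_sqrt ?_
  have h1 : weakGrad Ω φ =ᵐ[volume.restrict (M.patch t)] gradient φ :=
    ae_mono (M.restrict_patch_le hΩ t) (weakGrad_ae_eq hΩ.isOpen hφ.isWeakGradient)
  have h2 : ∫ x in M.patch t, ‖weakGrad Ω φ x‖ ^ 2 = ∫ x in M.patch t, ‖fderiv ℝ φ x‖ ^ 2 := by
    refine integral_congr_ae ?_
    filter_upwards [h1] with x hx
    rw [hx, norm_gradient]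
  rw [h2]
  have : 0 ≤ ∫ x in M.patch t, φ x ^ 2 := integral_nonneg fun x => sq_nonneg _
  linarith

end TetMesh

/-! ### Square integrability of the residual -/

theorem IsPolyhedralDomain.volume_lt_top {Ω : Set E3} (hΩ : IsPolyhedralDomain Ω) :
    volume Ω < ⊤ :=
  (measure_mono subset_closure).trans_lt hΩ.isCompact_closure.measure_lt_top

theorem exists_bound_of_continuousOn {Ω : Set E3} (hΩ : IsPolyhedralDomain Ω) {f : E3 → ℝ}
    (hf : ContinuousOn f (closure Ω)) :
    AEStronglyMeasurable f (volume.restrict Ω) ∧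
      ∃ C, 0 ≤ C ∧ ∀ᵐ x ∂volume.restrict Ω, ‖f x‖ ≤ C := by
  refine ⟨(hf.mono subset_closure).aestronglyMeasurable hΩ.isOpen.measurableSet, ?_⟩
  obtain ⟨C, hC⟩ := hΩ.isCompact_closure.exists_bound_of_continuousOn hf
  refine ⟨max C 0, le_max_right _ _, ?_⟩
  filter_upwards [ae_restrict_mem hΩ.isOpen.measurableSet] with x hx
  exact (hC x (subset_closure hx)).trans (le_max_left _ _)

theorem memLp_two_mul_of_bound {X : Type*} [MeasurableSpace X] {μ : Measure X} {f g : X → ℝ} {C : ℝ}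
    (hg : MemLp g 2 μ) (hf : AEStronglyMeasurable f μ) (hC : ∀ᵐ x ∂μ, ‖f x‖ ≤ C) :
    MemLp (fun x => g x * f x) 2 μ := by
  refine hg.of_le_mul (c := C) (hg.1.mul hf) ?_
  filter_upwards [hC] with x hx
  rw [norm_mul, mul_comm]
  exact mul_le_mul_of_nonneg_right hx (norm_nonneg _)

-- Extended by zero, `g` and `K` are integrable and square integrable on the whole space.
-- Measurability then comes from the convolution of integrable functions, and the bound from
-- Cauchy-Schwarz, uniformly in `x` by translation invariance.
open scoped Convolution in
theorem memLp_convolution_kernel {Ω : Set E3} (hΩ : IsPolyhedralDomain Ω) {K g : E3 → ℝ}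
    (hK : MemLp K 2 (volume.restrict {z | ∃ x ∈ Ω, ∃ y ∈ Ω, z = x - y}))
    (hg : ContinuousOn g (closure Ω)) :
    AEStronglyMeasurable (fun x => ∫ y in Ω, g y * K (x - y)) (volume.restrict Ω) ∧
      ∃ C, ∀ x ∈ Ω, ‖∫ y in Ω, g y * K (x - y)‖ ≤ C := by
  have hΩm := hΩ.isOpen.measurableSet
  have hfin : IsFiniteMeasure (volume.restrict Ω) := isFiniteMeasure_restrict.2 hΩ.volume_lt_top.ne
  set D : Set E3 := {z | ∃ x ∈ Ω, ∃ y ∈ Ω, z = x - y} with hD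
  have hDeq : D = ⋃ y ∈ Ω, (fun z => z + y) ⁻¹' Ω := by
    ext z
    rw [mem_iUnion₂]
    constructor
    · rintro ⟨x, hx, y, hy, rfl⟩
      exact ⟨y, hy, by simpa using hx⟩
    · rintro ⟨y, hy, hz⟩
      exact ⟨z + y, hz, y, hy, by simp⟩
  have hDo : IsOpen D := by
    rw [hDeq]
    exact isOpen_biUnion fun y _ => hΩ.isOpen.preimage (by fun_prop)
  have hDfin : volume D < ⊤ := by
    have hc : IsCompact ((fun p : E3 × E3 => p.1 - p.2) '' (closure Ω ×ˢ closure Ω)) :=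
      (hΩ.isCompact_closure.prod hΩ.isCompact_closure).image (by fun_prop)
    refine (measure_mono ?_).trans_lt hc.measure_lt_top
    rintro z ⟨x, hx, y, hy, rfl⟩
    exact ⟨(x, y), ⟨subset_closure hx, subset_closure hy⟩, rfl⟩
  set K' := D.indicator K with hK'
  set g' := Ω.indicator g with hg'
  have hK2 : MemLp K' 2 volume := (memLp_indicator_iff_restrict hDo.measurableSet).2 hK
  obtain ⟨hgm, Cg, -, hgC⟩ := exists_bound_of_continuousOn hΩ hg
  have hg2 : MemLp g' 2 volume :=
    (memLp_indicator_iff_restrict hΩm).2 (MemLp.of_bound hgm Cg hgC)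
  have hg1 : Integrable g' volume :=
    (integrable_indicator_iff hΩm).2 (Integrable.of_bound hgm Cg hgC)
  have hK1 : Integrable K' volume := by
    have : IsFiniteMeasure (volume.restrict D) := isFiniteMeasure_restrict.2 hDfin.ne
    exact (integrable_indicator_iff hDo.measurableSet).2 (hK.integrable (by norm_num))
  have heq : ∀ x ∈ Ω, ∫ y in Ω, g y * K (x - y) = ∫ y, g' y * K' (x - y) := by
    intro x hx
    rw [← integral_indicator hΩm]
    refine integral_congr_ae (Filter.Eventually.of_forall fun y => ?_)
    by_cases hy : y ∈ Ω
    · have hxy : x - y ∈ D := ⟨x, hx, y, hy, rfl⟩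
      simp only [hg', hK', indicator_of_mem hy, indicator_of_mem hxy]
    · simp only [hg', indicator_of_notMem hy, zero_mul]
  constructor
  · have h1 := (hg1.integrable_convolution (ContinuousLinearMap.mul ℝ ℝ) hK1).1
    refine (h1.restrict (s := Ω)).congr ?_
    filter_upwards [ae_restrict_mem hΩm] with x hx
    rw [heq x hx]
    rfl
  · refine ⟨√(∫ y, g' y ^ 2) * √(∫ y, K' y ^ 2), fun x hx => ?_⟩
    rw [heq x hx, Real.norm_eq_abs]
    have h2 : MemLp (fun y => K' (x - y)) 2 volume :=
      hK2.comp_measurePreserving (Measure.measurePreserving_sub_left volume x)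
    refine (abs_integral_mul_le hg2 h2).trans (le_of_eq ?_)
    rw [integral_sub_left_eq_self (fun y => K' y ^ 2) volume x]

namespace ProblemData

variable {P : ProblemData} {u v : E3 → ℝ} {l : ℝ}

/-- The zeroth-order part `l u - V u - 𝒩(u²) u` of the residual. -/
def forcing (P : ProblemData) (l : ℝ) (u : E3 → ℝ) (x : E3) : ℝ :=
  l * u x - P.V x * u x - P.N (fun y => u y ^ 2) x * u x

theorem memLp_of_continuousOn (hΩ : IsPolyhedralDomain P.Ω) (hu : ContinuousOn u (closure P.Ω)) :
    MemLp u 2 (volume.restrict P.Ω) := by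
  have hfin : IsFiniteMeasure (volume.restrict P.Ω) :=
    isFiniteMeasure_restrict.2 hΩ.volume_lt_top.ne
  obtain ⟨h1, C, -, h2⟩ := exists_bound_of_continuousOn hΩ hu
  exact MemLp.of_bound h1 C h2

theorem Admissible.memLp_potential_mul (hP : P.Admissible) (hu : ContinuousOn u (closure P.Ω)) :
    MemLp (fun x => P.V x * u x) 2 (volume.restrict P.Ω) := by
  obtain ⟨h1, C, -, h2⟩ := exists_bound_of_continuousOn hP.domain hu
  exact memLp_two_mul_of_bound hP.potential h1 h2

/-- The local factors are continuous on the compact closure, hence bounded, and the nonlocal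
integral is bounded by `memLp_convolution_kernel`. -/
theorem Admissible.memLp_nonlinear (hP : P.Admissible) (hu : ContinuousOn u (closure P.Ω)) :
    MemLp (fun x => P.N (fun y => u y ^ 2) x * u x) 2 (volume.restrict P.Ω) := by
  have hΩ := hP.domain
  have hfin : IsFiniteMeasure (volume.restrict P.Ω) :=
    isFiniteMeasure_restrict.2 hΩ.volume_lt_top.ne
  have hu2 : ContinuousOn (fun x => u x ^ 2) (closure P.Ω) := hu.pow 2
  obtain ⟨hm, C, -, hC⟩ := exists_bound_of_continuousOn hΩ hu
  have h1 : ContinuousOn (fun x => P.N₁ (u x ^ 2)) (closure P.Ω) :=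
    hP.local_diff.continuousOn.comp hu2 fun x _ => mem_Ici.2 (sq_nonneg _)
  have h2 : ContinuousOn (fun x => (u x ^ 2) ^ (P.q - 1)) (closure P.Ω) :=
    hu2.rpow_const fun x _ => Or.inr (by linarith [hP.q_mem.1])
  have h3 : ContinuousOn (fun x => (u x ^ 2) ^ P.q) (closure P.Ω) :=
    hu2.rpow_const fun x _ => Or.inr (by linarith [hP.q_mem.1])
  obtain ⟨hGm, CG, hG⟩ := memLp_convolution_kernel hΩ hP.kernel h3
  have h4 : MemLp (fun x => (u x ^ 2) ^ (P.q - 1) *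
      ∫ y in P.Ω, (u y ^ 2) ^ P.q * P.K (x - y)) 2 (volume.restrict P.Ω) := by
    refine memLp_two_mul_of_bound (C := CG) (memLp_of_continuousOn hΩ h2) hGm ?_
    filter_upwards [ae_restrict_mem hΩ.isOpen.measurableSet] with x hx
    exact hG x hx
  exact memLp_two_mul_of_bound ((memLp_of_continuousOn hΩ h1).add h4) hm hC

theorem Admissible.memLp_forcing (hP : P.Admissible) (hu : ContinuousOn u (closure P.Ω)) :
    MemLp (P.forcing l u) 2 (volume.restrict P.Ω) :=
  (((memLp_of_continuousOn hP.domain hu).const_mul l).sub (hP.memLp_potential_mul hu)).sub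
    (hP.memLp_nonlinear hu)

theorem Admissible.globalResidual_eq (hP : P.Admissible) (hu : ContinuousOn u (closure P.Ω))
    (hv : MemLp v 2 (volume.restrict P.Ω)) :
    P.globalResidual l u v = (∫ x in P.Ω, P.forcing l u x * v x) -
      P.α * ∫ x in P.Ω, ⟪weakGrad P.Ω u x, weakGrad P.Ω v x⟫_ℝ := by
  have h1 := integrable_mul_of_memLp ((memLp_of_continuousOn hP.domain hu).const_mul l) hv
  have h2 := integrable_mul_of_memLp (hP.memLp_potential_mul hu) hv
  have h3 := integrable_mul_of_memLp (hP.memLp_nonlinear hu) hv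
  have e : ∫ x in P.Ω, P.forcing l u x * v x = l * (∫ x in P.Ω, u x * v x) -
      (∫ x in P.Ω, P.V x * u x * v x) - ∫ x in P.Ω, P.N (fun y => u y ^ 2) x * u x * v x := by
    have e1 : ∀ x, P.forcing l u x * v x = l * u x * v x - P.V x * u x * v x -
        P.N (fun y => u y ^ 2) x * u x * v x := fun x => by rw [forcing]; ring
    simp only [e1]
    have h12 : Integrable (fun x => l * u x * v x - P.V x * u x * v x) (volume.restrict P.Ω) :=
      h1.sub h2
    rw [integral_sub h12 h3, integral_sub h1 h2, ← integral_const_mul]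
    simp only [mul_assoc]
  rw [globalResidual, e]
  simp only [real_inner_smul_left]
  rw [integral_const_mul]
  ring

theorem IsDiscreteSolution.continuousOn {M : TetMesh P.Ω} {n : ℕ}
    (h : P.IsDiscreteSolution M n l u) : ContinuousOn u (closure P.Ω) := h.mem_feSpace₀.1.1

/-- Galerkin orthogonality. -/
theorem IsDiscreteSolution.globalResidual_eq_zero (hP : P.Admissible) {M : TetMesh P.Ω} {n : ℕ}
    (h : P.IsDiscreteSolution M n l u) (hv : v ∈ M.feSpace₀ n) : P.globalResidual l u v = 0 := by
  have hu := h.continuousOn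
  have hvm := hv.2.isWeakGradient.memLp
  have h2 := integrable_mul_of_memLp (hP.memLp_potential_mul hu) hvm
  have h3 := integrable_mul_of_memLp (hP.memLp_nonlinear hu) hvm
  have e := h.equation v hv
  have e1 : ∫ x in P.Ω, (P.V x * u x + P.N (fun y => u y ^ 2) x * u x) * v x =
      (∫ x in P.Ω, P.V x * u x * v x) + ∫ x in P.Ω, P.N (fun y => u y ^ 2) x * u x * v x := by
    rw [← integral_add h2 h3]
    simp only [add_mul]
  rw [e1] at e
  rw [globalResidual]
  simp only [real_inner_smul_left]
  rw [integral_const_mul]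
  linarith

end ProblemData

namespace TetMesh

variable {Ω : Set E3} {M : TetMesh Ω} {t : Finset E3} {φ : E3 → ℝ}

open Classical in
/-- The piecewise linear quasi-interpolant of `φ`. -/
def interp (M : TetMesh Ω) (φ : E3 → ℝ) (x : E3) : ℝ :=
  ∑ a ∈ (M.elements.biUnion id).filter (· ∈ Ω), M.nodalMean φ a * M.hat a x

/-- Nodal values outside `Ω` are zero, so the restriction to vertices in `Ω` in `interp` is
invisible here. It is made because `memH10_hat` covers only hats of vertices in `Ω`. -/
theorem interp_eq (ht : t ∈ M.elements) {x : E3} (hx : x ∈ cell t) :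
    M.interp φ x = ∑ a ∈ t, M.nodalMean φ a * bary t a x := by
  classical
  have h1 : ∀ a, M.hat a x = bary t a x := fun a => hat_eq ht hx
  simp only [interp, h1]
  rw [Finset.sum_filter, ← Finset.sum_subset (s₁ := t) (Finset.subset_biUnion_of_mem id ht)
    fun a _ ha => by rw [bary_of_notMem ha]; simp]
  refine Finset.sum_congr rfl fun a _ => ?_
  split_ifs with ha
  · rfl
  · rw [nodalMean_of_notMem ha, zero_mul]

theorem sub_interp_eq (ht : t ∈ M.elements) {x : E3} (hx : x ∈ cell t) :
    φ x - M.interp φ x = M.interpError φ t x := by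
  rw [interp_eq ht hx, interpError]

theorem interp_of_notMem (hΩ : IsPolyhedralDomain Ω) {x : E3} (hx : x ∉ Ω) :
    M.interp φ x = 0 := by
  classical
  refine Finset.sum_eq_zero fun a ha => ?_
  rw [hat_of_notMem hΩ (Finset.mem_filter.1 ha).2 hx, mul_zero]

theorem interp_mem_feSpace₀ (hΩ : IsPolyhedralDomain Ω) {n : ℕ} (hn : 1 ≤ n) :
    M.interp φ ∈ M.feSpace₀ n := by
  classical
  refine ⟨⟨?_, fun t ht => ?_⟩, ?_⟩
  · refine Continuous.continuousOn ?_
    refine continuous_finsetSum _ fun a ha => ?_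
    exact continuous_const.mul (continuous_hat hΩ (Finset.mem_filter.1 ha).2)
  · choose p hp hpe using exists_polynomial_bary t
    refine ⟨∑ a ∈ t, MvPolynomial.C (M.nodalMean φ a) * p a, ?_, fun x hx => ?_⟩
    · refine MvPolynomial.totalDegree_finsetSum_le fun a _ => ?_
      refine (MvPolynomial.totalDegree_mul _ _).trans ?_
      rw [MvPolynomial.totalDegree_C, zero_add]
      exact (hp a).trans hn
    · rw [interp_eq ht hx]
      simp only [map_sum, map_mul, MvPolynomial.eval_C, hpe, polyFun]
  · exact memH10_sum hΩ.isOpen _ _ _ fun a ha => memH10_hat hΩ (Finset.mem_filter.1 ha).2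

end TetMesh

/-! ### The residual on test functions -/

theorem memLp_cell_of_continuousOn {t : Finset E3} {f : E3 → ℝ} (hf : ContinuousOn f (cell t)) :
    MemLp f 2 (volume.restrict (cell t)) := by
  have hK := isCompact_cell t
  have hfin : IsFiniteMeasure (volume.restrict (cell t)) :=
    isFiniteMeasure_restrict.2 hK.measure_lt_top.ne
  obtain ⟨C, hC⟩ := hK.exists_bound_of_continuousOn hf
  refine MemLp.of_bound (hf.aestronglyMeasurable hK.measurableSet) C ?_
  filter_upwards [ae_restrict_mem hK.measurableSet] with x hx using hC x hx

theorem memLp_face_of_continuousOn {e : Finset E3} (he : e.card = 3) {f : E3 → ℝ}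
    (hf : ContinuousOn f (cell e)) :
    MemLp f 2 ((Measure.euclideanHausdorffMeasure 2).restrict (cell e)) := by
  have hK := isCompact_cell e
  have hfin : IsFiniteMeasure ((Measure.euclideanHausdorffMeasure 2).restrict (cell e)) :=
    isFiniteMeasure_restrict.2 (euclideanHausdorffMeasure_cell_lt_top he).ne
  obtain ⟨C, hC⟩ := hK.exists_bound_of_continuousOn hf
  refine MemLp.of_bound (hf.aestronglyMeasurable hK.measurableSet) C ?_
  filter_upwards [ae_restrict_mem hK.measurableSet] with x hx using hC x hx

theorem cell_mono {e t : Finset E3} (h : e ⊆ t) : cell e ⊆ cell t :=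
  convexHull_mono (by exact_mod_cast h)

namespace TetMesh

variable {Ω : Set E3} {M : TetMesh Ω} {t e : Finset E3}

theorem mem_interiorFaces :
    e ∈ M.interiorFaces ↔ e ∈ M.complex.faces ∧ e.card = 3 ∧
      ∃ t₁ ∈ M.elements, ∃ t₂ ∈ M.elements, t₁ ≠ t₂ ∧ e ⊆ t₁ ∧ e ⊆ t₂ := by
  simp [interiorFaces]

open Classical in
theorem eq_erase_of_subset (ht : t ∈ M.elements) (he : e ⊆ t) (hec : e.card = 3) :
    ∃ k ∈ t, e = t.erase k := by
  obtain ⟨a, ha⟩ : ∃ a, t \ e = {a} := by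
    rw [← Finset.card_eq_one, Finset.card_sdiff_of_subset he, (isTet ht).card, hec]
  refine ⟨a, (Finset.mem_sdiff.1 (ha ▸ Finset.mem_singleton_self a)).1, ?_⟩
  rw [← Finset.sdiff_singleton_eq_erase, ← ha, Finset.sdiff_sdiff_eq_self he]

open Classical in
theorem erase_mem_interiorFaces (ht : t ∈ M.elements) {k : E3} (hk : k ∈ t)
    {t' : Finset E3} (ht' : t' ∈ M.elements) (hne : t' ≠ t) (hsub : t.erase k ⊆ t') :
    t.erase k ∈ M.interiorFaces := by
  have hc : (t.erase k).card = 3 := by rw [Finset.card_erase_of_mem hk, (isTet ht).card]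
  refine mem_interiorFaces.2 ⟨?_, hc, t, ht, t', ht', hne.symm, Finset.erase_subset k t, hsub⟩
  exact M.complex.down_closed (M.mem_elements.1 ht).1 (Finset.erase_subset k t)
    (Finset.card_pos.1 (by rw [hc]; norm_num))

-- Faces correspond to omitted vertices, and a face that is not interior belongs to `t` alone, where
-- `G` is assumed to vanish.
open Classical in
theorem sum_erase_eq_sum_interiorFaces (ht : t ∈ M.elements) (G : Finset E3 → ℝ)
    (hG : ∀ k ∈ t, (∀ t' ∈ M.elements, t.erase k ⊆ t' → t' = t) → G (t.erase k) = 0) :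
    ∑ k ∈ t, G (t.erase k) = ∑ e ∈ M.interiorFaces with e ⊆ t, G e := by
  rw [← Finset.sum_image (f := G) (s := t) (g := fun k => t.erase k)
    (fun a ha b hb h => Finset.erase_injOn t ha hb h)]
  refine (Finset.sum_subset (fun e he => ?_) fun e he hne => ?_).symm
  · obtain ⟨he, het⟩ := Finset.mem_filter.1 he
    obtain ⟨k, hk, rfl⟩ := eq_erase_of_subset ht het (mem_interiorFaces.1 he).2.1
    exact Finset.mem_image_of_mem _ hk
  · obtain ⟨k, hk, rfl⟩ := Finset.mem_image.1 he
    refine hG k hk fun t' ht' hsub => ?_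
    by_contra hcon
    exact hne (Finset.mem_filter.2
      ⟨erase_mem_interiorFaces ht hk ht' hcon hsub, Finset.erase_subset k t⟩)

open Classical in
theorem card_interiorFaces_le (ht : t ∈ M.elements) :
    (M.interiorFaces.filter fun e => e ⊆ t).card ≤ 4 := by
  rw [← (isTet ht).card]
  refine (Finset.card_le_card fun e he => ?_).trans (Finset.card_image_le (f := fun k => t.erase k))
  obtain ⟨he, het⟩ := Finset.mem_filter.1 he
  obtain ⟨k, hk, rfl⟩ := eq_erase_of_subset ht het (mem_interiorFaces.1 he).2.1
  exact Finset.mem_image_of_mem _ hk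

end TetMesh

namespace ProblemData

variable {P : ProblemData} {M : TetMesh P.Ω} {u φ : E3 → ℝ} {l γ : ℝ} {n : ℕ} {t e : Finset E3}

theorem exists_smooth_eq (hu : u ∈ M.feSpace n) (ht : t ∈ M.elements) :
    ∃ p : E3 → ℝ, ContDiff ℝ 2 p ∧ ∀ x ∈ cell t, u x = p x := by
  obtain ⟨p, -, hp⟩ := hu.2 t ht
  exact ⟨polyFun p, contDiff_polyFun p, hp⟩

theorem continuousOn_laplacianWithin (hu : u ∈ M.feSpace n) (ht : t ∈ M.elements) :
    ContinuousOn (InnerProductSpace.laplacianWithin u (cell t)) (cell t) := by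
  obtain ⟨p, hp, hup⟩ := exists_smooth_eq hu ht
  have hd : ContDiff ℝ 1 (fderiv ℝ p) := hp.fderiv_right (by norm_num)
  have hdd := hd.continuous_fderiv one_ne_zero
  refine ContinuousOn.congr (Continuous.continuousOn ?_) fun x hx =>
    laplacianWithin_cell_eq (TetMesh.isTet ht) hp hup hx
  fun_prop

theorem continuousOn_gradientWithin (hu : u ∈ M.feSpace n) (ht : t ∈ M.elements) :
    ContinuousOn (gradientWithin u (cell t)) (cell t) := by
  obtain ⟨p, hp, hup⟩ := exists_smooth_eq hu ht
  have hp1 : ContDiff ℝ 1 p := hp.of_le (by norm_num)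
  exact (continuous_gradient hp1).continuousOn.congr fun x hx =>
    gradientWithin_cell_eq (TetMesh.isTet ht) hp1 hup hx

theorem continuousOn_normalFlux (hu : u ∈ M.feSpace n) (ht : t ∈ M.elements) (he : e ⊆ t) :
    ContinuousOn (fun x => ⟪P.α • gradientWithin u (cell t) x, outwardNormal t e⟫_ℝ) (cell e) :=
  (((continuousOn_gradientWithin hu ht).mono (cell_mono he)).const_smul P.α).inner
    continuousOn_const

theorem continuousOn_jumpResidual (hu : u ∈ M.feSpace n) (e : Finset E3) :
    ContinuousOn (jumpResidual M u e) (cell e) := by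
  classical
  refine continuousOn_finsetSum _ fun t ht => ?_
  exact continuousOn_normalFlux hu (Finset.mem_filter.1 ht).1 (Finset.mem_filter.1 ht).2

theorem elementResidual_eq (P : ProblemData) (l : ℝ) (u : E3 → ℝ) (t : Finset E3) (x : E3) :
    P.elementResidual l u t x =
      P.forcing l u x + P.α * InnerProductSpace.laplacianWithin u (cell t) x := by
  rw [elementResidual, forcing]; ring

theorem Admissible.memLp_elementResidual (hP : P.Admissible) (hu : u ∈ M.feSpace n)
    (ht : t ∈ M.elements) : MemLp (P.elementResidual l u t) 2 (volume.restrict (cell t)) := by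
  have h1 := (hP.memLp_forcing (l := l) hu.1).mono_measure (TetMesh.restrict_cell_le hP.domain ht)
  have h2 := (memLp_cell_of_continuousOn (continuousOn_laplacianWithin hu ht)).const_mul P.α
  refine (h1.add h2).ae_eq (Filter.Eventually.of_forall fun x => ?_)
  rw [elementResidual_eq]
  rfl

open Classical in
/-- The contribution of an element to the residual. -/
theorem Admissible.integral_cell_residual (hP : P.Admissible) (hu : u ∈ M.feSpace₀ n)
    (hφ : IsTestFunction P.Ω φ) (ht : t ∈ M.elements) (hI : MemH10 P.Ω (M.interp φ)) :
    (∫ x in cell t, P.forcing l u x * (φ x - M.interp φ x)) -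
        P.α * ∫ x in cell t, ⟪weakGrad P.Ω u x, weakGrad P.Ω φ x - weakGrad P.Ω (M.interp φ) x⟫_ℝ =
      (∫ x in cell t, P.elementResidual l u t x * M.interpError φ t x) -
        ∑ k ∈ t, ∫ x in cell (t.erase k), ⟪P.α • gradientWithin u (cell t) x,
          outwardNormal t (t.erase k)⟫_ℝ * (φ x - M.interp φ x)
            ∂Measure.euclideanHausdorffMeasure 2 := by
  have hΩ := hP.domain
  have hT := TetMesh.isTet ht
  have hm := (isCompact_cell t).measurableSet
  have hφ1 : ContDiff ℝ 1 φ := hφ.smooth.of_le (by simp)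
  have hw := TetMesh.contDiff_interpError (M := M) (t := t) hφ1
  obtain ⟨p, hp, hup⟩ := exists_smooth_eq hu.1 ht
  have hp1 : ContDiff ℝ 1 p := hp.of_le (by norm_num)
  have hsub := TetMesh.interior_cell_subset hΩ ht
  set s : E3 → ℝ := fun x => ∑ a ∈ t, M.nodalMean φ a * bary t a x with hs
  have hs1 : ContDiff ℝ 1 s := ContDiff.sum fun a _ => contDiff_const.mul (contDiff_bary t a)
  have e1 : ∫ x in cell t, P.forcing l u x * (φ x - M.interp φ x) =
      ∫ x in cell t, P.forcing l u x * M.interpError φ t x :=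
    setIntegral_congr_fun hm fun x hx => by
      simp only [TetMesh.sub_interp_eq ht hx]
  -- On the open cell the three functions are smooth, so their weak gradients are classical; the
  -- boundary of the cell is null.
  have g1 := hu.2.isWeakGradient.ae_eq_gradient isOpen_interior hsub hp1
    fun x hx => hup x (interior_subset hx)
  have g2 := (hφ.memH10 hΩ.isOpen).isWeakGradient.ae_eq_gradient isOpen_interior hsub hφ1
    fun x _ => rfl
  have g3 := hI.isWeakGradient.ae_eq_gradient isOpen_interior hsub hs1
    fun x hx => TetMesh.interp_eq ht (interior_subset hx)
  rw [restrict_interior_cell] at g1 g2 g3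
  have e2 : ∫ x in cell t,
      ⟪weakGrad P.Ω u x, weakGrad P.Ω φ x - weakGrad P.Ω (M.interp φ) x⟫_ℝ =
      ∫ x in cell t, ⟪gradient p x, gradient (M.interpError φ t) x⟫_ℝ := by
    refine integral_congr_ae ?_
    filter_upwards [g1, g2, g3] with x h1 h2 h3
    have h4 : M.interpError φ t = fun x => φ x + (-1) * s x := by
      ext x; rw [TetMesh.interpError, hs]; ring
    rw [h1, h2, h3, h4, gradient_add_const_mul (hφ1.differentiable one_ne_zero)
      (hs1.differentiable one_ne_zero), neg_one_smul, sub_eq_add_neg]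
  have e3 : ∀ k ∈ t, ∫ x in cell (t.erase k), ⟪P.α • gradientWithin u (cell t) x,
          outwardNormal t (t.erase k)⟫_ℝ * (φ x - M.interp φ x)
            ∂Measure.euclideanHausdorffMeasure 2 =
      P.α * ∫ x in cell (t.erase k), ⟪gradientWithin u (cell t) x,
          outwardNormal t (t.erase k)⟫_ℝ * M.interpError φ t x
            ∂Measure.euclideanHausdorffMeasure 2 := by
    intro k _
    rw [← integral_const_mul]
    refine setIntegral_congr_fun (isCompact_cell _).measurableSet fun x hx => ?_
    simp only [TetMesh.sub_interp_eq ht (cell_mono (Finset.erase_subset k t) hx),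
      real_inner_smul_left]
    ring
  have hwm := memLp_cell_of_continuousOn (t := t) hw.continuous.continuousOn
  have h5 := integrable_mul_of_memLp ((hP.memLp_forcing (l := l) hu.1.1).mono_measure
    (TetMesh.restrict_cell_le hP.domain ht)) hwm
  have h6 := integrable_mul_of_memLp
    (memLp_cell_of_continuousOn (continuousOn_laplacianWithin hu.1 ht)) hwm
  have e4 : ∫ x in cell t, P.elementResidual l u t x * M.interpError φ t x =
      (∫ x in cell t, P.forcing l u x * M.interpError φ t x) +
      P.α * ∫ x in cell t,
        InnerProductSpace.laplacianWithin u (cell t) x * M.interpError φ t x := by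
    rw [← integral_const_mul, ← integral_add h5 (h6.const_mul P.α)]
    refine integral_congr_ae (Filter.Eventually.of_forall fun x => ?_)
    simp only [elementResidual_eq]
    ring
  rw [e1, e2, e4, hT.integral_inner_gradient hp hup hw, Finset.sum_congr rfl e3, ← Finset.mul_sum]
  ring

open Classical in
/-- The residual of a discrete solution in terms of element residuals and jump residuals. -/
theorem IsDiscreteSolution.globalResidual_eq_sum (hP : P.Admissible) (hn : 1 ≤ n)
    (h : P.IsDiscreteSolution M n l u) (hφ : IsTestFunction P.Ω φ) :
    P.globalResidual l u φ =
      (∑ t ∈ M.elements, ∫ x in cell t, P.elementResidual l u t x * M.interpError φ t x) -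
      ∑ e ∈ M.interiorFaces, ∫ x in cell e, jumpResidual M u e x * (φ x - M.interp φ x)
        ∂Measure.euclideanHausdorffMeasure 2 := by
  have hΩ := hP.domain
  have hI := TetMesh.interp_mem_feSpace₀ (M := M) (φ := φ) hΩ hn
  have hu := h.mem_feSpace₀
  have h0 := h.globalResidual_eq_zero hP hI
  have hφm := (hφ.memH10 hΩ.isOpen).isWeakGradient
  have hIm := hI.2.isWeakGradient
  have hum := hu.2.isWeakGradient
  have hF := hP.memLp_forcing (l := l) h.continuousOn
  have i1 : Integrable (fun x => P.forcing l u x * φ x) (volume.restrict P.Ω) :=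
    integrable_mul_of_memLp hF hφm.memLp
  have i2 : Integrable (fun x => P.forcing l u x * M.interp φ x) (volume.restrict P.Ω) :=
    integrable_mul_of_memLp hF hIm.memLp
  have i3 := integrable_inner_of_memLp hum.memLp_grad hφm.memLp_grad
  have i4 := integrable_inner_of_memLp hum.memLp_grad hIm.memLp_grad
  have e1 : P.globalResidual l u φ =
      (∫ x in P.Ω, P.forcing l u x * (φ x - M.interp φ x)) -
        P.α * ∫ x in P.Ω,
          ⟪weakGrad P.Ω u x, weakGrad P.Ω φ x - weakGrad P.Ω (M.interp φ) x⟫_ℝ := by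
    simp only [mul_sub, inner_sub_right]
    rw [integral_sub i1 i2, integral_sub i3 i4]
    rw [hP.globalResidual_eq h.continuousOn hφm.memLp]
    rw [hP.globalResidual_eq h.continuousOn hIm.memLp] at h0
    linarith
  have j1 : IntegrableOn (fun x => P.forcing l u x * (φ x - M.interp φ x)) P.Ω :=
    integrable_mul_of_memLp hF (hφm.memLp.sub hIm.memLp)
  have j2 : IntegrableOn (fun x =>
      ⟪weakGrad P.Ω u x, weakGrad P.Ω φ x - weakGrad P.Ω (M.interp φ) x⟫_ℝ) P.Ω :=
    integrable_inner_of_memLp hum.memLp_grad (hφm.memLp_grad.sub hIm.memLp_grad)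
  rw [e1, M.integral_eq_sum_cell hΩ j1, M.integral_eq_sum_cell hΩ j2, Finset.mul_sum,
    ← Finset.sum_sub_distrib,
    Finset.sum_congr rfl fun t ht => hP.integral_cell_residual hu hφ ht hI.2,
    Finset.sum_sub_distrib]
  congr 1
  rw [Finset.sum_congr rfl fun t ht => TetMesh.sum_erase_eq_sum_interiorFaces ht
    (fun e => ∫ x in cell e, ⟪P.α • gradientWithin u (cell t) x, outwardNormal t e⟫_ℝ *
      (φ x - M.interp φ x) ∂Measure.euclideanHausdorffMeasure 2) fun k hk huniq => ?_]
  -- Exchanging the sums collects at each face the normal fluxes of all elements containing it,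
  -- which is the jump residual.
  · rw [Finset.sum_comm' (t' := M.interiorFaces) (s' := fun e => M.elements.filter fun t => e ⊆ t)
      (by intro t e; simp only [Finset.mem_filter]; tauto)]
    refine Finset.sum_congr rfl fun e he => ?_
    rw [← integral_finsetSum]
    · simp only [jumpResidual, Finset.sum_mul]
    · intro t ht
      obtain ⟨ht, het⟩ := Finset.mem_filter.1 ht
      refine integrableOn_face (TetMesh.mem_interiorFaces.1 he).2.1 ?_
      refine (continuousOn_normalFlux hu.1 ht het).mul ?_
      refine hφ.smooth.continuous.continuousOn.sub (hI.1.1.mono ?_)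
      exact (cell_mono het).trans (TetMesh.cell_subset_closure ht)
  -- A face of a single element misses `Ω`, and outside `Ω` both `φ` and its interpolant vanish.
  · refine setIntegral_eq_zero_of_forall_eq_zero fun x hx => ?_
    have hxΩ := TetMesh.cell_erase_inter_eq_empty hΩ ht hk huniq hx
    rw [hφ.eq_zero hxΩ, TetMesh.interp_of_notMem hΩ hxΩ, sub_zero, mul_zero]

/-! ### The reliability estimate -/

/-- The constant in the residual estimate. -/
def residualConst (γ : ℝ) : ℝ :=
  √(TetMesh.interpConst γ) + 4 * √(TetMesh.interpTraceConst γ)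

theorem residualConst_nonneg (γ : ℝ) : 0 ≤ residualConst γ := by
  unfold residualConst; positivity

theorem errorIndicator_nonneg (l : ℝ) (u : E3 → ℝ) (t : Finset E3) :
    0 ≤ errorIndicator M l u t := Real.sqrt_nonneg _

theorem face_indicator_nonneg (u : E3 → ℝ) (e : Finset E3) :
    0 ≤ diamCell e * ∫ x in cell e, jumpResidual M u e x ^ 2 ∂Measure.euclideanHausdorffMeasure 2 :=
  mul_nonneg Metric.diam_nonneg (integral_nonneg fun _ => sq_nonneg _)

theorem cell_indicator_le (l : ℝ) (u : E3 → ℝ) (t : Finset E3) :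
    diamCell t * √(∫ x in cell t, P.elementResidual l u t x ^ 2) ≤ errorIndicator M l u t := by
  classical
  refine Real.le_sqrt_of_sq_le ?_
  rw [mul_pow, Real.sq_sqrt (integral_nonneg fun _ => sq_nonneg _)]
  exact le_add_of_nonneg_right (Finset.sum_nonneg fun e _ => face_indicator_nonneg u e)

theorem face_indicator_le (l : ℝ) (u : E3 → ℝ) (he : e ∈ M.interiorFaces) (het : e ⊆ t) :
    √(diamCell e * ∫ x in cell e, jumpResidual M u e x ^ 2
      ∂Measure.euclideanHausdorffMeasure 2) ≤ errorIndicator M l u t := by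
  classical
  refine Real.sqrt_le_sqrt ?_
  have h1 : 0 ≤ diamCell t ^ 2 * ∫ x in cell t, P.elementResidual l u t x ^ 2 :=
    mul_nonneg (sq_nonneg _) (integral_nonneg fun _ => sq_nonneg _)
  have h2 := Finset.single_le_sum (f := fun e => diamCell e * ∫ x in cell e, jumpResidual M u e x ^ 2
      ∂Measure.euclideanHausdorffMeasure 2) (s := M.interiorFaces.filter fun e => e ⊆ t)
    (fun e _ => face_indicator_nonneg u e) (Finset.mem_filter.2 ⟨he, het⟩)
  exact h2.trans (le_add_of_nonneg_left h1)

theorem Admissible.abs_integral_cell_le (hP : P.Admissible) (hM : M.ShapeRegular γ)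
    (hu : u ∈ M.feSpace n) (hφ : IsTestFunction P.Ω φ) (ht : t ∈ M.elements) :
    |∫ x in cell t, P.elementResidual l u t x * M.interpError φ t x| ≤
      √(TetMesh.interpConst γ) * (errorIndicator M l u t * √(M.patchEnergy φ t)) := by
  have hφ1 : ContDiff ℝ 1 φ := hφ.smooth.of_le (by simp)
  have hw := TetMesh.contDiff_interpError (M := M) (t := t) hφ1
  have h1 := abs_integral_mul_le (hP.memLp_elementResidual (l := l) hu ht)
    (memLp_cell_of_continuousOn (t := t) hw.continuous.continuousOn)
  have h2 := Real.sqrt_le_sqrt (hM.integral_sq_interpError_le hP.domain hφ ht)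
  have h3 : 0 ≤ TetMesh.interpConst γ := by
    have := TetMesh.nodalConst_nonneg (hM.one_le ht)
    have := TetMesh.ballVol_pos
    unfold TetMesh.interpConst; positivity
  have h4 := diamCell_pos (TetMesh.isTet ht)
  rw [Real.sqrt_mul (by positivity), Real.sqrt_mul h3, Real.sqrt_sq h4.le] at h2
  have h5 := cell_indicator_le (M := M) l u t
  calc _ ≤ √(∫ x in cell t, P.elementResidual l u t x ^ 2) *
        (√(TetMesh.interpConst γ) * diamCell t * √(M.patchEnergy φ t)) :=
        h1.trans (mul_le_mul_of_nonneg_left h2 (Real.sqrt_nonneg _))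
    _ = √(TetMesh.interpConst γ) * ((diamCell t *
          √(∫ x in cell t, P.elementResidual l u t x ^ 2)) * √(M.patchEnergy φ t)) := by ring
    _ ≤ _ := by gcongr

theorem Admissible.abs_integral_face_le (hP : P.Admissible) (hn : 1 ≤ n) (hM : M.ShapeRegular γ)
    (hu : u ∈ M.feSpace n) (hφ : IsTestFunction P.Ω φ) (ht : t ∈ M.elements)
    (he : e ∈ M.interiorFaces) (het : e ⊆ t) :
    |∫ x in cell e, jumpResidual M u e x * (φ x - M.interp φ x)
        ∂Measure.euclideanHausdorffMeasure 2| ≤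
      √(TetMesh.interpTraceConst γ) * (errorIndicator M l u t * √(M.patchEnergy φ t)) := by
  classical
  have hec := (TetMesh.mem_interiorFaces.1 he).2.1
  obtain ⟨k, hk, hek⟩ := TetMesh.eq_erase_of_subset ht het hec
  have hI := TetMesh.interp_mem_feSpace₀ (M := M) (φ := φ) hP.domain hn
  have hW : ContinuousOn (fun x => φ x - M.interp φ x) (cell e) :=
    hφ.smooth.continuous.continuousOn.sub
      (hI.1.1.mono ((cell_mono het).trans (TetMesh.cell_subset_closure ht)))
  have h1 := abs_integral_mul_le (memLp_face_of_continuousOn hec (continuousOn_jumpResidual hu e))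
    (memLp_face_of_continuousOn hec hW)
  have h2 : ∫ x in cell e, (φ x - M.interp φ x) ^ 2 ∂Measure.euclideanHausdorffMeasure 2 ≤
      TetMesh.interpTraceConst γ * diamCell e * M.patchEnergy φ t := by
    have := hM.integral_face_sq_interpError_le hP.domain hφ ht hk
    rw [← hek] at this
    refine le_of_eq_of_le (setIntegral_congr_fun (isCompact_cell _).measurableSet fun x hx => ?_) this
    simp only [TetMesh.sub_interp_eq ht (cell_mono het hx)]
  have h3 : 0 ≤ TetMesh.interpTraceConst γ := by
    have := TetMesh.nodalConst_nonneg (hM.one_le ht)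
    have := TetMesh.ballVol_pos
    unfold TetMesh.interpTraceConst TetMesh.interpConst TetMesh.stabConst; positivity
  have h4 : 0 ≤ diamCell e := Metric.diam_nonneg
  have h6 := Real.sqrt_le_sqrt h2
  rw [Real.sqrt_mul (by positivity), Real.sqrt_mul h3] at h6
  have h5 := face_indicator_le l u he het
  rw [Real.sqrt_mul h4] at h5
  calc _ ≤ √(∫ x in cell e, jumpResidual M u e x ^ 2 ∂Measure.euclideanHausdorffMeasure 2) *
        (√(TetMesh.interpTraceConst γ) * √(diamCell e) * √(M.patchEnergy φ t)) :=
        h1.trans (mul_le_mul_of_nonneg_left h6 (Real.sqrt_nonneg _))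
    _ = √(TetMesh.interpTraceConst γ) * ((√(diamCell e) *
          √(∫ x in cell e, jumpResidual M u e x ^ 2 ∂Measure.euclideanHausdorffMeasure 2)) *
            √(M.patchEnergy φ t)) := by ring
    _ ≤ _ := by gcongr

/-- The residual estimate for test functions. -/
theorem IsDiscreteSolution.abs_globalResidual_le_of_isTestFunction (hP : P.Admissible) (hn : 1 ≤ n)
    (hM : M.ShapeRegular γ) (h : P.IsDiscreteSolution M n l u) (hφ : IsTestFunction P.Ω φ) :
    |P.globalResidual l u φ| ≤ residualConst γ *
      ∑ t ∈ M.elements, errorIndicator M l u t * h1Norm P.Ω (M.patch t) φ := by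
  classical
  have hu := h.mem_feSpace₀.1
  set A : Finset E3 → ℝ := fun e => |∫ x in cell e, jumpResidual M u e x * (φ x - M.interp φ x)
        ∂Measure.euclideanHausdorffMeasure 2| with hA
  set X : Finset E3 → ℝ := fun t => errorIndicator M l u t * √(M.patchEnergy φ t) with hX
  have hX0 : ∀ t, 0 ≤ X t := fun t => mul_nonneg (errorIndicator_nonneg l u t) (Real.sqrt_nonneg _)
  -- Each face is charged to every element containing it. The overcounting is harmless, and a
  -- tetrahedron has at most four interior faces.
  have h1 : ∑ e ∈ M.interiorFaces, A e ≤
      ∑ t ∈ M.elements, ∑ e ∈ M.interiorFaces with e ⊆ t, A e := by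
    rw [Finset.sum_comm' (t' := M.interiorFaces) (s' := fun e => M.elements.filter fun t => e ⊆ t)
      (by intro t e; simp only [Finset.mem_filter]; tauto)]
    refine Finset.sum_le_sum fun e he => ?_
    obtain ⟨-, -, t, ht, -, -, -, het, -⟩ := TetMesh.mem_interiorFaces.1 he
    exact Finset.single_le_sum (f := fun _ => A e) (fun _ _ => abs_nonneg _)
      (Finset.mem_filter.2 ⟨ht, het⟩)
  have h2 : ∀ t ∈ M.elements, ∑ e ∈ M.interiorFaces with e ⊆ t, A e ≤
      4 * √(TetMesh.interpTraceConst γ) * X t := by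
    intro t ht
    have h3 : ∑ e ∈ M.interiorFaces with e ⊆ t, A e ≤
        ∑ e ∈ M.interiorFaces with e ⊆ t, √(TetMesh.interpTraceConst γ) * X t := by
      refine Finset.sum_le_sum fun e he => ?_
      exact hP.abs_integral_face_le hn hM hu hφ ht (Finset.mem_filter.1 he).1
        (Finset.mem_filter.1 he).2
    refine h3.trans ?_
    rw [Finset.sum_const, nsmul_eq_mul, mul_assoc]
    refine mul_le_mul_of_nonneg_right ?_ (mul_nonneg (Real.sqrt_nonneg _) (hX0 t))
    exact_mod_cast TetMesh.card_interiorFaces_le ht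
  have h3 : |P.globalResidual l u φ| ≤ residualConst γ * ∑ t ∈ M.elements, X t := by
    rw [h.globalResidual_eq_sum hP hn hφ]
    refine (abs_sub _ _).trans ?_
    refine (add_le_add (Finset.abs_sum_le_sum_abs _ _) (Finset.abs_sum_le_sum_abs _ _)).trans ?_
    refine (add_le_add (Finset.sum_le_sum fun t ht => hP.abs_integral_cell_le hM hu hφ ht)
      (h1.trans (Finset.sum_le_sum h2))).trans (le_of_eq ?_)
    rw [← Finset.mul_sum, ← Finset.mul_sum, residualConst]
    ring
  refine h3.trans (mul_le_mul_of_nonneg_left ?_ (residualConst_nonneg γ))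
  refine Finset.sum_le_sum fun t _ => ?_
  exact mul_le_mul_of_nonneg_left (TetMesh.sqrt_patchEnergy_le_h1Norm hP.domain hφ t)
    (errorIndicator_nonneg l u t)

end ProblemData

/-! ### Density: from test functions to `H¹₀` -/

/-- A crude triangle inequality in the plane: `(s + 2δ)²` absorbs `2 (a + b) δ + 2 δ²` because `a, b
≤ s`. It passes from the two `L²` norms to `h1Norm`. -/
theorem sqrt_sq_add_sq_le {a b a' b' δ : ℝ} (_ : 0 ≤ a) (_ : 0 ≤ b) (ha' : 0 ≤ a')
    (hb' : 0 ≤ b') (hδ : 0 ≤ δ) (h1 : a' ≤ a + δ) (h2 : b' ≤ b + δ) :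
    √(a' ^ 2 + b' ^ 2) ≤ √(a ^ 2 + b ^ 2) + 2 * δ := by
  set s := √(a ^ 2 + b ^ 2) with hs
  have hs2 : s ^ 2 = a ^ 2 + b ^ 2 := Real.sq_sqrt (by positivity)
  have hs0 : 0 ≤ s := Real.sqrt_nonneg _
  have has : a ≤ s := Real.le_sqrt_of_sq_le (by nlinarith)
  have hbs : b ≤ s := Real.le_sqrt_of_sq_le (by nlinarith)
  rw [Real.sqrt_le_left (by positivity)]
  have h3 := pow_le_pow_left₀ ha' h1 2
  have h4 := pow_le_pow_left₀ hb' h2 2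
  nlinarith [mul_le_mul_of_nonneg_right has hδ, mul_le_mul_of_nonneg_right hbs hδ]

theorem sqrt_integral_le_of_eLpNorm_le {X F : Type*} [MeasurableSpace X] {μ : Measure X}
    [NormedAddCommGroup F] [InnerProductSpace ℝ F] {f : X → F} (hf : MemLp f 2 μ) {ε : ℝ}
    (hε : 0 ≤ ε) (h : eLpNorm f 2 μ ≤ ENNReal.ofReal ε) : √(∫ x, ‖f x‖ ^ 2 ∂μ) ≤ ε := by
  rw [eLpNorm_two_eq hf] at h
  exact (ENNReal.ofReal_le_ofReal_iff hε).1 h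

/-- Functions in `H¹₀` are approximated by test functions, in the norms over all patches. -/
theorem TetMesh.exists_isTestFunction_close {Ω : Set E3} (M : TetMesh Ω) (hΩ : IsPolyhedralDomain Ω)
    {v : E3 → ℝ} (hv : MemH10 Ω v) {ε : ℝ} (hε : 0 < ε) :
    ∃ φ, IsTestFunction Ω φ ∧ √(∫ x in Ω, (v x - φ x) ^ 2) ≤ ε ∧
      √(∫ x in Ω, ‖weakGrad Ω v x - weakGrad Ω φ x‖ ^ 2) ≤ ε ∧
      ∀ t, h1Norm Ω (M.patch t) φ ≤ h1Norm Ω (M.patch t) v + 2 * ε := by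
  obtain ⟨φ, hφ, h1, h2⟩ := hv.2 ε hε
  have hvg := hv.isWeakGradient
  have hφg := (hφ.memH10 hΩ.isOpen).isWeakGradient
  have hgr := weakGrad_ae_eq hΩ.isOpen hφ.isWeakGradient
  have h1' := sqrt_integral_le_of_eLpNorm_le (hvg.memLp.sub hφg.memLp) hε.le h1
  have h2' : √(∫ x in Ω, ‖weakGrad Ω v x - weakGrad Ω φ x‖ ^ 2) ≤ ε := by
    refine sqrt_integral_le_of_eLpNorm_le (hvg.memLp_grad.sub hφg.memLp_grad) hε.le ?_
    refine le_of_eq_of_le (eLpNorm_congr_ae ?_) h2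
    filter_upwards [hgr] with x hx
    rw [Pi.sub_apply, hx]
  simp only [Pi.sub_apply, Real.norm_eq_abs, sq_abs] at h1'
  refine ⟨φ, hφ, h1', h2', fun t => ?_⟩
  have hle := M.restrict_patch_le hΩ t
  have k1 := sqrt_integral_norm_sub_le (hφg.memLp.mono_measure hle) (hvg.memLp.mono_measure hle)
  have k2 := sqrt_integral_norm_sub_le (hφg.memLp_grad.mono_measure hle)
    (hvg.memLp_grad.mono_measure hle)
  have m1 : √(∫ x in M.patch t, ‖φ x - v x‖ ^ 2) ≤ ε := by
    refine le_trans (Real.sqrt_le_sqrt ?_) h1'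
    simp only [Real.norm_eq_abs, sq_abs, ← sub_sq_comm (φ _) (v _)]
    exact integral_mono_measure hle (Filter.Eventually.of_forall fun x => sq_nonneg _)
      (by simpa using (hφg.memLp.sub hvg.memLp).integrable_sq)
  have m2 : √(∫ x in M.patch t, ‖weakGrad Ω φ x - weakGrad Ω v x‖ ^ 2) ≤ ε := by
    refine le_trans (Real.sqrt_le_sqrt ?_) h2'
    simp only [norm_sub_rev (weakGrad Ω v _)]
    exact integral_mono_measure hle (Filter.Eventually.of_forall fun x => sq_nonneg _)
      ((memLp_two_iff_integrable_sq_norm (hφg.memLp_grad.sub hvg.memLp_grad).1).1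
        (hφg.memLp_grad.sub hvg.memLp_grad))
  have key := sqrt_sq_add_sq_le (Real.sqrt_nonneg _) (Real.sqrt_nonneg _) (Real.sqrt_nonneg _)
    (Real.sqrt_nonneg _) hε.le (k1.trans (add_le_add le_rfl m1)) (k2.trans (add_le_add le_rfl m2))
  have hnn : ∀ {F : Type} [NormedAddCommGroup F] (f : E3 → F),
      0 ≤ ∫ x in M.patch t, ‖f x‖ ^ 2 := fun f => integral_nonneg fun x => sq_nonneg _
  rw [Real.sq_sqrt (hnn _), Real.sq_sqrt (hnn _), Real.sq_sqrt (hnn _), Real.sq_sqrt (hnn _)] at key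
  simp only [h1Norm]
  simpa only [Real.norm_eq_abs, sq_abs] using key

/-- The residual estimate in `H¹₀`. -/
theorem ProblemData.IsDiscreteSolution.abs_globalResidual_le {P : ProblemData} {M : TetMesh P.Ω}
    {u v : E3 → ℝ} {l γ : ℝ} {n : ℕ} (hP : P.Admissible) (hn : 1 ≤ n)
    (hM : M.ShapeRegular γ) (h : P.IsDiscreteSolution M n l u) (hv : MemH10 P.Ω v) :
    |P.globalResidual l u v| ≤ residualConst γ *
      ∑ t ∈ M.elements, errorIndicator M l u t * h1Norm P.Ω (M.patch t) v := by
  have hΩ := hP.domain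
  have hF := hP.memLp_forcing (l := l) h.continuousOn
  have hum := h.mem_feSpace₀.2.isWeakGradient
  have hvg := hv.isWeakGradient
  set a := √(∫ x in P.Ω, P.forcing l u x ^ 2) with ha
  set b := √(∫ x in P.Ω, ‖weakGrad P.Ω u x‖ ^ 2) with hb
  have ha0 : 0 ≤ a := Real.sqrt_nonneg _
  have hb0 : 0 ≤ b := Real.sqrt_nonneg _
  set S := ∑ t ∈ M.elements, errorIndicator M l u t with hS
  have hS0 : 0 ≤ S := Finset.sum_nonneg fun t _ => errorIndicator_nonneg l u t
  have hc := residualConst_nonneg γ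
  set Y := residualConst γ * ∑ t ∈ M.elements, errorIndicator M l u t * h1Norm P.Ω (M.patch t) v
  set K := residualConst γ * (2 * S) + a + P.α * b with hK
  have hα := hP.α_pos
  have hK0 : 0 ≤ K := by positivity
  -- The factor `K` may depend on the mesh and on the discrete solution, since it is multiplied by
  -- `ε → 0` and leaves no trace in the final constant.
  have main : ∀ ε : ℝ, 0 < ε → |P.globalResidual l u v| ≤ Y + K * ε := by
    intro ε hε
    obtain ⟨φ, hφ, h1, h2, h3⟩ := M.exists_isTestFunction_close hΩ hv hε
    have hφg := (hφ.memH10 hΩ.isOpen).isWeakGradient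
    have e1 : P.globalResidual l u v = P.globalResidual l u φ +
        ((∫ x in P.Ω, P.forcing l u x * (v x - φ x)) -
          P.α * ∫ x in P.Ω, ⟪weakGrad P.Ω u x, weakGrad P.Ω v x - weakGrad P.Ω φ x⟫_ℝ) := by
      rw [hP.globalResidual_eq h.continuousOn hvg.memLp,
        hP.globalResidual_eq h.continuousOn hφg.memLp]
      simp only [mul_sub, inner_sub_right]
      rw [integral_sub (integrable_mul_of_memLp hF hvg.memLp)
        (integrable_mul_of_memLp hF hφg.memLp),
        integral_sub (integrable_inner_of_memLp hum.memLp_grad hvg.memLp_grad)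
        (integrable_inner_of_memLp hum.memLp_grad hφg.memLp_grad)]
      ring
    have e2 : |∫ x in P.Ω, P.forcing l u x * (v x - φ x)| ≤ a * ε :=
      (abs_integral_mul_le hF (hvg.memLp.sub hφg.memLp)).trans
        (mul_le_mul_of_nonneg_left h1 ha0)
    have e3 : |∫ x in P.Ω, ⟪weakGrad P.Ω u x, weakGrad P.Ω v x - weakGrad P.Ω φ x⟫_ℝ| ≤ b * ε :=
      (abs_integral_inner_le hum.memLp_grad (hvg.memLp_grad.sub hφg.memLp_grad)).trans
        (mul_le_mul_of_nonneg_left h2 hb0)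
    have e4 := h.abs_globalResidual_le_of_isTestFunction hP hn hM hφ
    have e5 : ∑ t ∈ M.elements, errorIndicator M l u t * h1Norm P.Ω (M.patch t) φ ≤
        (∑ t ∈ M.elements, errorIndicator M l u t * h1Norm P.Ω (M.patch t) v) + S * (2 * ε) := by
      rw [hS, Finset.sum_mul, ← Finset.sum_add_distrib]
      refine Finset.sum_le_sum fun t _ => ?_
      rw [← mul_add]
      exact mul_le_mul_of_nonneg_left (h3 t) (errorIndicator_nonneg l u t)
    have e6 := mul_le_mul_of_nonneg_left e5 hc
    rw [e1]
    refine (abs_add_le _ _).trans ?_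
    have e7 := abs_sub (∫ x in P.Ω, P.forcing l u x * (v x - φ x))
      (P.α * ∫ x in P.Ω, ⟪weakGrad P.Ω u x, weakGrad P.Ω v x - weakGrad P.Ω φ x⟫_ℝ)
    rw [abs_mul, abs_of_pos hα] at e7
    have e8 := mul_le_mul_of_nonneg_left e3 hα.le
    rw [mul_add] at e6
    rw [hK]
    linarith
  refine le_of_forall_pos_le_add fun δ hδ => (main (δ / (K + 1)) (by positivity)).trans ?_
  have : K * (δ / (K + 1)) ≤ δ := by
    rw [mul_div_assoc', div_le_iff₀ (by positivity)]
    nlinarith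
  linarith

end

end NonlinearEigen

theorem mainTheorem5 (P : NonlinearEigen.ProblemData) (hP : P.Admissible)
    (n : ℕ) (hn : 1 ≤ n) (γ : ℝ) :
    ∃ C : ℝ, 0 < C ∧ ∀ M : NonlinearEigen.TetMesh P.Ω, M.ShapeRegular γ →
      ∀ (l : ℝ) (u : NonlinearEigen.E3 → ℝ), P.IsDiscreteSolution M n l u →
        ∀ v : NonlinearEigen.E3 → ℝ, NonlinearEigen.MemH10 P.Ω v →
          |P.globalResidual l u v| ≤
            C * ∑ t ∈ M.elements, NonlinearEigen.ProblemData.errorIndicator M l u t *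
              NonlinearEigen.h1Norm P.Ω (M.patch t) v := by
  -- `residualConst_nonneg` gives nonnegativity only; adding `1` makes the constant positive for
  -- every real `γ`.
  refine ⟨NonlinearEigen.ProblemData.residualConst γ + 1, ?_, fun M hM l u h v hv => ?_⟩
  · linarith [NonlinearEigen.ProblemData.residualConst_nonneg γ]
  · refine (h.abs_globalResidual_le hP hn hM hv).trans ?_
    refine mul_le_mul_of_nonneg_right (by linarith) (Finset.sum_nonneg fun t _ => ?_)
    exact mul_nonneg (NonlinearEigen.ProblemData.errorIndicator_nonneg l u t) (Real.sqrt_nonneg _)
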